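/- Let $X$ be a compact Kähler manifold with Kähler metric $g$. For an open set $U\subseteq X$ and a set $S\subseteq U$, a function $\xi$ is called an admissible weight function on $U$ for $S$ if - $\xi$ is continuous and non-negative on $U$, and for $x\in U$ one has $\xi(x)=0$ if and only if $x\in S$; - for every real $t$ the sub-level set $\{x\in U:\xi(x)\le t\}$ is precompact in $X$; - $\log\xi$ is of class $C^2$ on $U\setminus S$ and there is a constant $C$ such that $\sum_{j,k} \frac{\partial^2\log\xi}{\partial z_j\,\partial\bar z_k}(x)\, v_j\bar v_k\ \ge\ -C\,g_x(v,v)$ for all $x\in U\setminus S$ and all tangent vectors $v$ at $x$. If $U$ is not mentioned, $U=X$. Then: 1. Let $V\subset X$ be a smooth (closed) complex hypersurface, and let $\rho_V:X\to\mathbb{R}$ be a function that is equal to the Riemannian distance to $V$ in a neighbourhood of $V$ and that is positive and smooth on $X\setminus V$. Then for every $\nu>0$ the function $\rho_V^{\nu}$ is an admissible weight function for $V$. Further, if $V_1,\dots,V_m\subset X$ are smooth complex hypersurfaces, $\rho_{V_1},\dots,\rho_{V_m}$ are such functions for them, and $\nu_1,\dots,\nu_m>0$, then $\prod_j\rho_{V_j}^{\nu_j}$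 is an admissible weight function for $\bigcup_j V_j$. 2. Let $(L,h)$ be a holomorphic line bundle on $X$ with a smooth hermitian metric, let $s$ be a global holomorphic section of $L$, and let $V$ be its zero set (for instance, $s$ is the defining section of a hypersurface $V$). Then for every $\nu>0$ the function $|s|_h^{\nu}$ is an admissible weight function for $V$. 3. Every analytic subset $S$ of $X$ (that is, near each point of $X$, $S$ is the common zero locus of finitely many holomorphic functions) admits an admissible weight function. More specifically, if $U\subseteq X$ is open, $f_1,\dots,f_N$ are holomorphic functions on $U$ and $S=\{x\in U: f_1(x)=\dots=f_N(x)=0\}$, then for every $p>0$ the function $\bigl(\sum_{j=1}^N|f_j|^2\bigr)^p$ is an admissible weight function on $U$ for $S$. -/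

import Mathlib

open Set Bundle
open scoped Manifold ContDiff ENNReal Bundle Topology

/-- A complex manifold modelled on a complex normed space `E` is in particular a real analytic
manifold modelled on the underlying real normed space. -/
instance realManifoldOfComplex {E : Type*} [NormedAddCommGroup E] [NormedSpace ℂ E]
    {X : Type*} [TopologicalSpace X] [ChartedSpace E X] [IsManifold 𝓘(ℂ, E) ω X] :
    IsManifold 𝓘(ℝ, E) ω X := by
  apply isManifold_of_contDiffOn
  intro e e' he he'
  have h := (contDiffGroupoid ω 𝓘(ℂ, E)).compatible he he'
  rw [contDiffGroupoid, mem_groupoid_of_pregroupoid] at h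
  have h1 : ContDiffOn ℂ ω (𝓘(ℂ, E) ∘ (e.symm ≫ₕ e') ∘ 𝓘(ℂ, E).symm)
    (𝓘(ℂ, E).symm ⁻¹' (e.symm ≫ₕ e').source ∩ range 𝓘(ℂ, E)) := h.1
  exact h1.restrict_scalars ℝ

section ComplexGeometry

variable {E : Type*} [NormedAddCommGroup E] [NormedSpace ℂ E]
variable {X : Type*} [TopologicalSpace X] [ChartedSpace E X]

/-- The complex structure `J` of a complex manifold: multiplication by `i` on the (real) tangent
space `T_x X`, which is identified with `E` by the preferred holomorphic chart at `x`. -/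
def tangentI (x : X) (v : TangentSpace 𝓘(ℝ, E) x) : TangentSpace 𝓘(ℝ, E) x :=
  let v' : E := v
  (Complex.I • v' : E)

/-- The coordinate expression, in the chart at `x₀`, of the fundamental form
`ω(u, w) = b(J u, w)` attached to a field `b` of bilinear forms on the tangent spaces. -/
noncomputable def localFundamentalForm
    (b : ∀ x : X, TangentSpace 𝓘(ℝ, E) x →L[ℝ] TangentSpace 𝓘(ℝ, E) x →L[ℝ] ℝ)
    (x₀ : X) (u w y : E) : ℝ :=
  b ((chartAt E x₀).symm y)
    (tangentI _ (mfderiv 𝓘(ℝ, E) 𝓘(ℝ, E) (chartAt E x₀).symm y u))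
    (mfderiv 𝓘(ℝ, E) 𝓘(ℝ, E) (chartAt E x₀).symm y w)

variable (E X) in
/-- A Kähler metric on a complex manifold: a smooth Riemannian metric which is compatible with the
complex structure and whose fundamental form `ω` is closed, i.e. in holomorphic charts
`dω(u, v, w) = ∂_u ω(v, w) + ∂_v ω(w, u) + ∂_w ω(u, v)` vanishes. -/
structure KahlerMetric [IsManifold 𝓘(ℂ, E) ω X] extends
    ContMDiffRiemannianMetric 𝓘(ℝ, E) ∞ E (fun x : X => TangentSpace 𝓘(ℝ, E) x) where
  hermitian : ∀ (x : X) (v w : TangentSpace 𝓘(ℝ, E) x),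
    inner x (tangentI x v) (tangentI x w) = inner x v w
  closed : ∀ (x₀ : X), ∀ y ∈ (chartAt E x₀).target, ∀ u v w : E,
    fderiv ℝ (localFundamentalForm inner x₀ v w) y u
      + fderiv ℝ (localFundamentalForm inner x₀ w u) y v
      + fderiv ℝ (localFundamentalForm inner x₀ u v) y w = 0

/-- The distance from `x` to the set `V`: the infimum of the lengths of the `C¹` paths from `x` to
points of `V` (it is `∞` if there is no such path). -/
noncomputable def KahlerMetric.distTo [IsManifold 𝓘(ℂ, E) ω X] (g : KahlerMetric E X)
    (V : Set X) (x : X) : ℝ≥0∞ :=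
  letI : RiemannianBundle (fun x : X => TangentSpace 𝓘(ℝ, E) x) :=
    ⟨g.toContMDiffRiemannianMetric.toRiemannianMetric⟩
  ⨅ y ∈ V, Manifold.riemannianEDist 𝓘(ℝ, E) x y

/-- The complex Hessian of a real function `u` at `x` in direction `v`. In holomorphic coordinates
it is `∑ (∂²u / ∂z_j ∂z̄_k) v_j v̄_k = (D²u(v, v) + D²u(iv, iv)) / 4`. -/
noncomputable def complexHessian (u : X → ℝ) (x : X) (v : TangentSpace 𝓘(ℝ, E) x) : ℝ :=
  let v' : E := v
  let D2 := fderiv ℝ (fderiv ℝ (u ∘ (chartAt E x).symm)) (chartAt E x x)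
  (D2 v' v' + D2 (Complex.I • v') (Complex.I • v')) / 4

/-- `ξ` is an admissible weight function on the open set `U` for the singular set `S ⊆ U`:
it is continuous and non-negative, vanishes exactly on `S`, has precompact sub-level sets, and
on `U \ S` the complex Hessian of `log ξ` exists and is bounded from below by a multiple of the
metric. -/
structure IsAdmissibleWeightOn [IsManifold 𝓘(ℂ, E) ω X] (g : KahlerMetric E X)
    (U S : Set X) (ξ : X → ℝ) : Prop where
  continuousOn : ContinuousOn ξ U
  nonneg : ∀ x ∈ U, 0 ≤ ξ x
  eq_zero_iff : ∀ x ∈ U, ξ x = 0 ↔ x ∈ S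
  precompact : ∀ t : ℝ, IsCompact (closure {x ∈ U | ξ x ≤ t})
  contMDiffOn_log : ContMDiffOn 𝓘(ℝ, E) 𝓘(ℝ) 2 (fun x => Real.log (ξ x)) (U \ S)
  hessian_bounded_below : ∃ C : ℝ, ∀ x ∈ U \ S, ∀ v : TangentSpace 𝓘(ℝ, E) x,
    -C * g.inner x v v ≤ complexHessian (fun y => Real.log (ξ y)) x v

/-- `ξ` is an admissible weight function on `X` for the singular set `S`. -/
def IsAdmissibleWeight [IsManifold 𝓘(ℂ, E) ω X] (g : KahlerMetric E X)
    (S : Set X) (ξ : X → ℝ) : Prop :=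
  IsAdmissibleWeightOn g univ S ξ

variable (E) in
/-- A (smooth) complex hypersurface: a closed set which near each of its points is the zero set of
one holomorphic function with non-zero differential at that point. -/
def IsSmoothHypersurface (V : Set X) : Prop :=
  IsClosed V ∧ ∀ x ∈ V, ∃ U : Set X, IsOpen U ∧ x ∈ U ∧ ∃ f : X → ℂ,
    ContMDiffOn 𝓘(ℂ, E) 𝓘(ℂ) ω f U ∧ V ∩ U = {y ∈ U | f y = 0} ∧
    mfderiv 𝓘(ℂ, E) 𝓘(ℂ) f x ≠ 0

variable (E) in
/-- A (closed) analytic subset: locally, near every point of `X`, the common zero locus of finitely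
many holomorphic functions. -/
def IsAnalyticSubset (S : Set X) : Prop :=
  ∀ x : X, ∃ U : Set X, IsOpen U ∧ x ∈ U ∧ ∃ (N : ℕ) (f : Fin N → X → ℂ),
    (∀ j, ContMDiffOn 𝓘(ℂ, E) 𝓘(ℂ) ω (f j) U) ∧ S ∩ U = {y ∈ U | ∀ j, f j y = 0}

/-- `ρ` is a distance weight of `V`: near `V` it is the distance to `V`, and it is
extended to the rest of `X` as a smooth positive function. -/
structure IsDistanceWeight [IsManifold 𝓘(ℂ, E) ω X] (g : KahlerMetric E X)
    (V : Set X) (ρ : X → ℝ) : Prop where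
  eq_dist : ∃ U : Set X, IsOpen U ∧ V ⊆ U ∧ ∀ x ∈ U, 0 ≤ ρ x ∧ ENNReal.ofReal (ρ x) = g.distTo V x
  pos : ∀ x ∉ V, 0 < ρ x
  smooth : ContMDiffOn 𝓘(ℝ, E) 𝓘(ℝ) ∞ ρ Vᶜ

variable (E) in
/-- A smooth hermitian metric on a holomorphic line bundle `L`. Smoothness is expressed by the
squared length of the local holomorphic frames `e.symm x 1` of `L`. -/
structure LineBundleHermitianMetric (L : X → Type*) [TopologicalSpace (TotalSpace ℂ L)]
    [∀ x, AddCommGroup (L x)] [∀ x, Module ℂ (L x)] [∀ x, TopologicalSpace (L x)]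
    [FiberBundle ℂ L] where
  inner : ∀ x, L x →ₗ⋆[ℂ] L x →ₗ[ℂ] ℂ
  conj_symm : ∀ x (v w : L x), inner x v w = starRingEnd ℂ (inner x w v)
  pos : ∀ x (v : L x), v ≠ 0 → 0 < (inner x v v).re
  smooth : ∀ x₀ : X, ContMDiffOn 𝓘(ℝ, E) 𝓘(ℝ) ∞
    (fun x => (inner x ((trivializationAt ℂ L x₀).symm x 1)
      ((trivializationAt ℂ L x₀).symm x 1)).re) (trivializationAt ℂ L x₀).baseSet

/-- The pointwise length `|v|_h` of a vector in a hermitian line bundle. -/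
noncomputable def LineBundleHermitianMetric.length {L : X → Type*}
    [TopologicalSpace (TotalSpace ℂ L)]
    [∀ x, AddCommGroup (L x)] [∀ x, Module ℂ (L x)] [∀ x, TopologicalSpace (L x)]
    [FiberBundle ℂ L] (h : LineBundleHermitianMetric E L) {x : X} (v : L x) : ℝ :=
  Real.sqrt (h.inner x v v).re

end ComplexGeometry

/-!
On compact `X` all sub-level sets are precompact, and the lower bound for the complex Hessian has to
be found only near each point (`isAdmissibleWeight_of_local`). In a holomorphic chart the complex
Hessian becomes the Levi form on the model space `E`, which is invariant under holomorphic changes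
of coordinates (`leviForm_comp`, `complexHessian_eq_leviForm`).

*Sums of squares and sections.* The function `log ∑ |f_j|²` is plurisubharmonic
(`leviForm_log_sum_nonneg`), which is the claim for functions on an open set. In a local frame
`|s|_h² = |σ|² H` with `σ` holomorphic and `H > 0` smooth, and `log H` has a bounded complex
Hessian.

*Analytic subsets.* Local equations of `S` on a finite cover give functions `φ_i = ∑_j |f_ij|²`
with the same zero set but without any known comparison between them. Compactness yields a modulus
`B` which bounds `-log φ_j` in terms of `-log φ_i` on the overlaps, and `exists_slow_function`
provides a concave increasing unbounded `μ` growing so slowly that the values `μ (-log φ_i)` differ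
by at most a constant. The functions `exp (-μ (-log φ_i))` are then comparable and have
plurisubharmonic logarithms, so that gluing them with squares of cut-off functions costs only a
bounded term in the complex Hessian of the logarithm (`leviForm_log_sum_sq_mul_exp_ge`). This needs
neither coherence nor a Łojasiewicz inequality.

*Distance to a hypersurface.* Choose a holomorphic chart in which `V` is a complex hyperplane
`ℓ = 0`. The normal geodesics of this hyperplane, i.e. the trajectories of the Hamiltonian
field of the cometric `S` issuing from the conormal covectors, depend smoothly on their initial
values, and their energy defines a function `q` solving the eikonal equation
`Dq (S Dq) = 4 q` (`exists_eikonal_solution`). The length of these geodesics bounds the distance to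
`V` from above by `√q`, and the eikonal equation makes `√q` 1-Lipschitz along paths, so that the
distance is `√q` near `V` (`exists_distTo_eq_sqrt`).

It remains to bound the Levi form of `log q` from below. As `q` vanishes on `ℓ = 0`, it can be
divided repeatedly by `ℓ` and its conjugate. Because the metric is hermitian, comparing
coefficients in the eikonal equation excludes the terms `Re (ℓ a)`, `Re (ℓ² a)` and `Re (ℓ³ a)`, so
that `q = |ℓ|² b + Re (ℓ⁴ c)` with `b > 0` (`eikonal_normalForm`). Hence
`log q = log |ℓ|² + log (b + Re (ℓ³ / ℓ̄ · c))`, where the first term is plurisubharmonic and the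
second one has bounded second derivatives (`exists_leviForm_log_ge`). The fundamental form of the
metric need not be closed for this. Products of distance weights follow since the lower bounds for
the logarithms add up.
-/

universe u v
set_option maxSynthPendingDepth 3

/-! ### Composition operators on spaces of continuous functions -/

section Omega

variable {K : Type*} [TopologicalSpace K] [CompactSpace K]

/-- Pointwise application `(A, h) ↦ (t ↦ A t (h t))` as a continuous bilinear map on spaces of
continuous functions. -/
noncomputable def pointwiseApplyCLM (K : Type*) [TopologicalSpace K] [CompactSpace K]
    (E : Type*) (F : Type*) [NormedAddCommGroup E] [NormedSpace ℝ E]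
    [NormedAddCommGroup F] [NormedSpace ℝ F] :
    C(K, E →L[ℝ] F) →L[ℝ] C(K, E) →L[ℝ] C(K, F) :=
  LinearMap.mkContinuous₂
    (LinearMap.mk₂ ℝ (fun (A : C(K, E →L[ℝ] F)) (h : C(K, E)) =>
        (⟨fun t => A t (h t), by fun_prop⟩ : C(K, F)))
      (fun _ _ _ => by ext; simp) (fun _ _ _ => by ext; simp)
      (fun _ _ _ => by ext; simp) (fun _ _ _ => by ext; simp)) 1
    (fun A h => by
      rw [ContinuousMap.norm_le _ (by positivity)]
      intro t
      rw [one_mul]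
      exact (A t).le_of_opNorm_le_of_le (A.norm_coe_le_norm t) (h.norm_coe_le_norm t))

@[simp] theorem pointwiseApplyCLM_apply {E F : Type*} [NormedAddCommGroup E] [NormedSpace ℝ E]
    [NormedAddCommGroup F] [NormedSpace ℝ F] (A : C(K, E →L[ℝ] F)) (h : C(K, E)) (t : K) :
    pointwiseApplyCLM K E F A h t = A t (h t) := rfl

/-- The operator `γ ↦ f ∘ γ` is differentiable because `f'` is uniformly continuous near the
compact range of `γ`. -/
theorem hasFDerivAt_continuousMap_comp {E F : Type*} [NormedAddCommGroup E] [NormedSpace ℝ E]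
    [NormedAddCommGroup F] [NormedSpace ℝ F] {f : C(E, F)} {f' : C(E, E →L[ℝ] F)}
    (hf : ∀ x, HasFDerivAt f (f' x) x) (γ : C(K, E)) :
    HasFDerivAt (fun γ : C(K, E) => f.comp γ) (pointwiseApplyCLM K E F (f'.comp γ)) γ := by
  rw [hasFDerivAt_iff_isLittleO_nhds_zero, Asymptotics.isLittleO_iff]
  intro ε hε
  have huc := (isCompact_range γ.continuous).uniformContinuousAt_of_continuousAt (f := f')
    (fun x _ => f'.continuous.continuousAt) (Metric.dist_mem_uniformity hε)
  obtain ⟨δ, hδ, hδ'⟩ := Metric.mem_uniformity_dist.1 huc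
  filter_upwards [Metric.ball_mem_nhds (0 : C(K, E)) hδ] with h hh
  rw [ContinuousMap.norm_le _ (by positivity)]
  intro t
  have hht : ‖h t‖ < δ := (h.norm_coe_le_norm t).trans_lt (by simpa using hh)
  have key : ‖f (γ t + h t) - f (γ t) - f' (γ t) (γ t + h t - γ t)‖ ≤
      ε * ‖γ t + h t - γ t‖ := by
    refine (convex_ball (γ t) δ).norm_image_sub_le_of_norm_hasFDerivWithin_le'
      (f' := fun y => f' y)
      (fun y _ => (hf y).hasFDerivWithinAt) (fun y hy => ?_) (Metric.mem_ball_self hδ) (by simpa)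
    have h1 : dist (f' (γ t)) (f' y) < ε := hδ' (by rw [dist_comm]; exact hy) (mem_range_self t)
    rw [dist_comm, dist_eq_norm] at h1
    exact h1.le
  simp only [add_sub_cancel_left] at key
  refine (le_trans (le_of_eq ?_) key).trans
    (mul_le_mul_of_nonneg_left (h.norm_coe_le_norm t) hε.le)
  simp

theorem contDiff_pointwiseApplyCLM {E F : Type*} [NormedAddCommGroup E] [NormedSpace ℝ E]
    [NormedAddCommGroup F] [NormedSpace ℝ F] {n : WithTop ℕ∞} :
    ContDiff ℝ n (fun A : C(K, E →L[ℝ] F) => pointwiseApplyCLM K E F A) := by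
  have h := ContinuousLinearMap.contDiff (𝕜 := ℝ) (E := C(K, E →L[ℝ] F))
    (F := C(K, E) →L[ℝ] C(K, F)) (n := n) (pointwiseApplyCLM K E F)
  exact h

/-- The induction replaces `f` by its derivative and thereby `F` by `E →L[ℝ] F`, so `F` has to live
in a universe containing that of `E`. -/
theorem contDiff_continuousMap_comp_nat {E : Type u} [NormedAddCommGroup E]
    [NormedSpace ℝ E] (n : ℕ) : ∀ {F : Type (max u v)} [NormedAddCommGroup F] [NormedSpace ℝ F]
    (f : C(E, F)), ContDiff ℝ n f → ContDiff ℝ n (fun γ : C(K, E) => f.comp γ) := by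
  induction n with
  | zero =>
    intro F _ _ f _
    rw [Nat.cast_zero, contDiff_zero]
    exact ContinuousMap.continuous_postcomp f
  | succ n ih =>
    intro F _ _ f hf
    have hf' : ContDiff ℝ n (fderiv ℝ f) := hf.fderiv_right (by norm_cast)
    let f' : C(E, E →L[ℝ] F) := ⟨fderiv ℝ f, hf'.continuous⟩
    have hd : ∀ x, HasFDerivAt f (f' x) x := fun x =>
      (hf.differentiable (by norm_cast) x).hasFDerivAt
    have := ih f' hf'
    push_cast
    rw [contDiff_succ_iff_hasFDerivAt]
    exact ⟨fun γ => pointwiseApplyCLM K E F (f'.comp γ),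
      contDiff_pointwiseApplyCLM.comp this,
      fun γ => hasFDerivAt_continuousMap_comp hd γ⟩

/-- Composition with a fixed smooth map is a smooth operation on continuous functions on a compact
space. -/
theorem contDiff_continuousMap_comp {E : Type u} [NormedAddCommGroup E]
    [NormedSpace ℝ E] {F : Type v} [NormedAddCommGroup F] [NormedSpace ℝ F] {n : ℕ}
    (f : C(E, F)) (hf : ContDiff ℝ n f) : ContDiff ℝ n (fun γ : C(K, E) => f.comp γ) := by
  -- enlarge the universe of the target
  let e : ULift.{u} F ≃L[ℝ] F := ContinuousLinearEquiv.ulift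
  let g : C(E, ULift.{u} F) := ⟨fun x => e.symm (f x), by fun_prop⟩
  have hg : ContDiff ℝ n g := e.symm.contDiff.comp hf
  have h1 := contDiff_continuousMap_comp_nat.{u, v} (K := K) n g hg
  exact ((e : ULift.{u} F →L[ℝ] F).compLeftContinuous ℝ K).contDiff.comp h1

end Omega

/-! ### Smooth dependence of trajectories on the initial value -/

section Flow

variable {Z : Type*} [NormedAddCommGroup Z] [NormedSpace ℝ Z]

/-- The extension of a continuous function on `[0, 1]` to the real line, constant on both sides. -/
noncomputable def unitExtend (γ : C(unitInterval, Z)) (s : ℝ) : Z := γ (projIcc 0 1 zero_le_one s)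

omit [NormedSpace ℝ Z] in
theorem continuous_unitExtend (γ : C(unitInterval, Z)) : Continuous (unitExtend γ) :=
  γ.continuous.comp continuous_projIcc

omit [NormedSpace ℝ Z] in
theorem unitExtend_of_mem (γ : C(unitInterval, Z)) {s : ℝ} (hs : s ∈ Icc (0 : ℝ) 1) :
    unitExtend γ s = γ ⟨s, hs⟩ := by
  rw [unitExtend, projIcc_of_mem zero_le_one hs]

/-- The primitive `t ↦ ∫ s in 0..t, γ s` as a bounded operator on continuous functions
on `[0, 1]`. -/
noncomputable def primitiveCLM (Z : Type*) [NormedAddCommGroup Z] [NormedSpace ℝ Z] :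
    C(unitInterval, Z) →L[ℝ] C(unitInterval, Z) :=
  LinearMap.mkContinuous
    { toFun := fun γ => ⟨fun t => ∫ s in (0 : ℝ)..t, unitExtend γ s,
        (intervalIntegral.continuous_primitive
          (fun _ _ => (continuous_unitExtend γ).intervalIntegrable _ _) 0).comp
          continuous_subtype_val⟩
      map_add' := fun γ₁ γ₂ => by
        ext t
        simpa [unitExtend] using intervalIntegral.integral_add (μ := MeasureTheory.volume)
          ((continuous_unitExtend γ₁).intervalIntegrable 0 t)
          ((continuous_unitExtend γ₂).intervalIntegrable 0 t)
      map_smul' := fun c γ => by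
        ext t
        simp [unitExtend] } 1
    (fun γ => by
      rw [one_mul, ContinuousMap.norm_le _ (norm_nonneg _)]
      intro t
      refine (intervalIntegral.norm_integral_le_of_norm_le_const (C := ‖γ‖)
        (fun s _ => γ.norm_coe_le_norm _)).trans ?_
      rw [sub_zero, abs_of_nonneg t.2.1]
      exact mul_le_of_le_one_right (norm_nonneg _) t.2.2)

/-- The linearization of the integral equation `γ - ∫ f(γ) = const` at a constant curve. -/
theorem hasFDerivAt_integralOperator_const {n : ℕ} (hn : 1 ≤ n) (f : C(Z, Z))
    (hf : ContDiff ℝ n f) (z₀ : Z) :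
    HasFDerivAt (fun γ : C(unitInterval, Z) => γ - primitiveCLM Z (f.comp γ))
      (ContinuousLinearMap.id ℝ _ - (primitiveCLM Z).comp
        (pointwiseApplyCLM unitInterval Z Z (ContinuousMap.const _ (fderiv ℝ f z₀))))
      (ContinuousMap.const _ z₀) := by
  have hn' : (n : WithTop ℕ∞) ≠ 0 := by norm_cast; omega
  let f' : C(Z, Z →L[ℝ] Z) := ⟨fderiv ℝ f, hf.continuous_fderiv hn'⟩
  have h := hasFDerivAt_continuousMap_comp (f := f) (f' := f')
    (fun x => (hf.differentiable hn' x).hasFDerivAt) (ContinuousMap.const unitInterval z₀)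
  exact (hasFDerivAt_id _).sub ((primitiveCLM Z).hasFDerivAt.comp _ h)

/-- The integral equation `γ(t) = z + ∫₀ᵗ f(γ)` has a solution on `[0, 1]` depending smoothly on
`z`, for `z` near a zero `z₀` of `f` at which the linearization of `f` has square zero. -/
theorem exists_contDiffAt_flow [CompleteSpace Z] {n : ℕ} (hn : 1 ≤ n) (f : C(Z, Z))
    (hf : ContDiff ℝ n f) (z₀ : Z) (hz₀ : f z₀ = 0)
    (hnil : ∀ v, fderiv ℝ f z₀ (fderiv ℝ f z₀ v) = 0) :
    ∃ Γ : Z → C(unitInterval, Z), ContDiffAt ℝ n Γ z₀ ∧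
      (∀ᶠ z in 𝓝 z₀, ∀ t : unitInterval,
        Γ z t = z + ∫ s in (0 : ℝ)..t, f (unitExtend (Γ z) s)) ∧
      (∀ᶠ z in 𝓝 z₀, f z = 0 → Γ z = ContinuousMap.const _ z) := by
  have hn' : (n : WithTop ℕ∞) ≠ 0 := by norm_cast; omega
  set A := (primitiveCLM Z).comp
    (pointwiseApplyCLM unitInterval Z Z (ContinuousMap.const _ (fderiv ℝ f z₀))) with hA
  -- `A` has square zero like `Df(z₀)`, so `1 + A` is the inverse of `1 - A`
  have hAA : ∀ h, A (A h) = 0 := by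
    intro h
    ext t
    have h1 : ∀ s, unitExtend (pointwiseApplyCLM unitInterval Z Z
        (ContinuousMap.const _ (fderiv ℝ f z₀)) (A h)) s = 0 := by
      intro s
      have h2 : A h (projIcc 0 1 zero_le_one s) = fderiv ℝ f z₀
          (∫ r in (0 : ℝ)..(projIcc (0 : ℝ) 1 zero_le_one s), unitExtend h r) := by
        rw [← ContinuousLinearMap.intervalIntegral_comp_comm _
          ((continuous_unitExtend h).intervalIntegrable _ _)]
        rfl
      simp only [unitExtend, pointwiseApplyCLM_apply, ContinuousMap.const_apply]
      rw [h2, hnil]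
    change ∫ s in (0 : ℝ)..t, unitExtend (pointwiseApplyCLM unitInterval Z Z
        (ContinuousMap.const _ (fderiv ℝ f z₀)) (A h)) s = 0
    simp [h1]
  let e : C(unitInterval, Z) ≃L[ℝ] C(unitInterval, Z) :=
    ContinuousLinearEquiv.equivOfInverse (ContinuousLinearMap.id ℝ _ - A)
      (ContinuousLinearMap.id ℝ _ + A) (fun h => by simp [hAA]) (fun h => by simp [hAA])
  let T : C(unitInterval, Z) → C(unitInterval, Z) := fun γ => γ - primitiveCLM Z (f.comp γ)
  have hT : ContDiff ℝ n T :=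
    contDiff_id.sub ((primitiveCLM Z).contDiff.comp (contDiff_continuousMap_comp f hf))
  have hT' : HasFDerivAt T (e : C(unitInterval, Z) →L[ℝ] C(unitInterval, Z))
      (ContinuousMap.const _ z₀) := hasFDerivAt_integralOperator_const hn f hf z₀
  have hTs := hT.contDiffAt.hasStrictFDerivAt' hT' hn'
  have hconst : ∀ z, f z = 0 → T (ContinuousMap.const _ z) = ContinuousMap.const _ z := by
    intro z hz
    ext t
    have : ∀ s, unitExtend (f.comp (ContinuousMap.const unitInterval z)) s = 0 := fun s => by
      simp [unitExtend, hz]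
    rw [show T (ContinuousMap.const unitInterval z) t = z - ∫ s in (0 : ℝ)..t,
      unitExtend (f.comp (ContinuousMap.const unitInterval z)) s from rfl]
    simp only [this, intervalIntegral.integral_zero, sub_zero, ContinuousMap.const_apply]
  let c : Z →L[ℝ] C(unitInterval, Z) := ContinuousLinearMap.const ℝ unitInterval
  have hinv := hT.contDiffAt.to_localInverse (a := ContinuousMap.const unitInterval z₀) hT' hn'
  have hleft := hTs.eventually_left_inverse
  have hright := hTs.eventually_right_inverse
  rw [hconst z₀ hz₀] at hinv hright
  refine ⟨fun z => hT.contDiffAt.localInverse hT' hn' (c z), ?_, ?_, ?_⟩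
  · exact ContDiffAt.comp z₀ hinv c.contDiff.contDiffAt
  · filter_upwards [c.continuous.continuousAt.eventually hright] with z hz t
    have := DFunLike.congr_fun hz t
    rw [show (T _) t = _ - _ from rfl, sub_eq_iff_eq_add] at this
    exact this
  · filter_upwards [c.continuous.continuousAt.eventually hleft] with z hz hfz
    rw [show c z = ContinuousMap.const _ z from rfl] at hz ⊢
    rw [hconst z hfz] at hz
    exact hz

end Flow

/-! ### Division of functions by a complex linear form -/

section Hadamard

theorem exists_contDiff_eventuallyEq {E F : Type*} [NormedAddCommGroup E] [NormedSpace ℝ E]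
    [FiniteDimensional ℝ E] [NormedAddCommGroup F] [NormedSpace ℝ F] {n : ℕ} {f : E → F} {x : E}
    (hf : ContDiffAt ℝ n f x) : ∃ g : E → F, ContDiff ℝ n g ∧ g =ᶠ[𝓝 x] f := by
  obtain ⟨r, hr, hr'⟩ := Metric.eventually_nhds_iff.1 (hf.eventually (by simp))
  let b : ContDiffBump x := ⟨r / 4, r / 2, by positivity, by linarith⟩
  refine ⟨fun y => b y • f y, contDiff_iff_contDiffAt.2 fun y => ?_, ?_⟩
  · by_cases hy : y ∈ tsupport b
    · rw [b.tsupport_eq] at hy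
      have : dist y x < r := lt_of_le_of_lt (Metric.mem_closedBall.1 hy)
        (show r / 2 < r by linarith)
      exact b.contDiff.contDiffAt.smul (hr' this)
    · have h0 : (fun y => b y • f y) =ᶠ[𝓝 y] fun _ => 0 := by
        filter_upwards [notMem_tsupport_iff_eventuallyEq.1 hy] with z hz
        simp [hz]
      exact contDiffAt_const.congr_of_eventuallyEq h0
  · filter_upwards [b.eventuallyEq_one] with y hy
    simp [hy]

/-- The affine segment `t ↦ α y + t β y`, as a continuous function on `[0, 1]` depending linearly
on `y`. -/
noncomputable def segmentCLM {E E' : Type*} [NormedAddCommGroup E] [NormedSpace ℝ E]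
    [NormedAddCommGroup E'] [NormedSpace ℝ E'] (α β : E →L[ℝ] E') :
    E →L[ℝ] C(unitInterval, E') :=
  LinearMap.mkContinuous
    { toFun := fun y => ⟨fun t => α y + (t : ℝ) • β y, by fun_prop⟩
      map_add' := fun y z => by ext t; simp; abel
      map_smul' := fun c y => by ext t; simp [smul_smul, mul_comm] } (‖α‖ + ‖β‖)
    (fun y => by
      rw [ContinuousMap.norm_le _ (by positivity)]
      intro t
      refine (norm_add_le _ _).trans ?_
      rw [add_mul, norm_smul, Real.norm_of_nonneg t.2.1]
      refine add_le_add ?_ ?_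
      · exact α.le_opNorm y
      · exact (mul_le_of_le_one_left (norm_nonneg _) t.2.2).trans (β.le_opNorm y))

/-- Smoothness of the parameter integral is read off from the composition operator `γ ↦ g ∘ γ`. -/
theorem contDiff_integral_segment {E E' F : Type*} [NormedAddCommGroup E] [NormedSpace ℝ E]
    [NormedAddCommGroup E'] [NormedSpace ℝ E'] [NormedAddCommGroup F] [NormedSpace ℝ F]
    (α β : E →L[ℝ] E') {n : ℕ} {g : E' → F} (hg : ContDiff ℝ n g) :
    ContDiff ℝ n (fun y => ∫ t in (0 : ℝ)..1, g (α y + t • β y)) := by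
  have h1 := contDiff_continuousMap_comp (K := unitInterval) ⟨g, hg.continuous⟩ hg
  have h2 : ContDiff ℝ n (fun y => primitiveCLM F
      ((⟨g, hg.continuous⟩ : C(E', F)).comp (segmentCLM α β y))) :=
    (primitiveCLM F).contDiff.comp (h1.comp (segmentCLM α β).contDiff)
  have h3 := ((ContinuousMap.evalCLM (M := F) ℝ (1 : unitInterval)).contDiff (n := n)).comp h2
  convert h3 using 2 with y
  refine intervalIntegral.integral_congr fun t ht => ?_
  rw [uIcc_of_le zero_le_one] at ht
  rw [unitExtend_of_mem _ ht]
  rfl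

variable {E : Type*} [NormedAddCommGroup E] [NormedSpace ℂ E]

/-- The projection onto the kernel of `ℓ` along `e`. -/
noncomputable def kerProj (ℓ : E →L[ℂ] ℂ) (e : E) : E →L[ℝ] E :=
  (ContinuousLinearMap.id ℂ E - ℓ.smulRight e).restrictScalars ℝ

@[simp] theorem kerProj_apply (ℓ : E →L[ℂ] ℂ) (e y : E) : kerProj ℓ e y = y - ℓ y • e := rfl

theorem map_kerProj {ℓ : E →L[ℂ] ℂ} {e : E} (he : ℓ e = 1) (y : E) :
    ℓ (kerProj ℓ e y) = 0 := by simp [he]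

/-- Hadamard's lemma: a smooth function vanishing on the hyperplane `ℓ = 0` is a combination
of `ℓ` and its conjugate with smooth coefficients. -/
theorem exists_eq_mul_add_conj_mul [FiniteDimensional ℂ E] {ℓ : E →L[ℂ] ℂ} {e : E} (he : ℓ e = 1)
    {n : ℕ} {f : E → ℂ} (hf : ContDiffAt ℝ (n + 1 : ℕ) f 0)
    (h0 : ∀ᶠ y in 𝓝 (0 : E), ℓ y = 0 → f y = 0) :
    ∃ a b : E → ℂ, ContDiffAt ℝ n a 0 ∧ ContDiffAt ℝ n b 0 ∧
      ∀ᶠ y in 𝓝 (0 : E), f y = ℓ y * a y + starRingEnd ℂ (ℓ y) * b y := by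
  have : FiniteDimensional ℝ E := FiniteDimensional.complexToReal E
  obtain ⟨g, hg, hgf⟩ := exists_contDiff_eventuallyEq hf
  let β : E →L[ℝ] E := (ℓ.smulRight e).restrictScalars ℝ
  have hg' : ContDiff ℝ n (fderiv ℝ g) := hg.fderiv_right (by norm_cast)
  let L : E → (E →L[ℝ] ℂ) := fun y => ∫ t in (0 : ℝ)..1, fderiv ℝ g (kerProj ℓ e y + t • β y)
  have hL : ContDiff ℝ n L := contDiff_integral_segment _ _ hg'
  have key : ∀ y, g y - g (kerProj ℓ e y) = L y (ℓ y • e) := by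
    intro y
    have hd : ∀ t : ℝ, HasDerivAt (fun t : ℝ => g (kerProj ℓ e y + t • β y))
        (fderiv ℝ g (kerProj ℓ e y + t • β y) (β y)) t := by
      intro t
      have h1 : HasDerivAt (fun t : ℝ => kerProj ℓ e y + t • β y) (β y) t := by
        simpa using ((hasDerivAt_id t).smul_const (β y)).const_add (kerProj ℓ e y)
      exact (hg.differentiable (by norm_cast) _).hasFDerivAt.comp_hasDerivAt t h1
    have hc : Continuous fun t : ℝ => fderiv ℝ g (kerProj ℓ e y + t • β y) :=
      hg'.continuous.comp (by fun_prop)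
    have h2 := intervalIntegral.integral_eq_sub_of_hasDerivAt (a := 0) (b := 1)
      (fun t _ => hd t) ((hc.clm_apply continuous_const).intervalIntegrable _ _)
    rw [← ContinuousLinearMap.intervalIntegral_apply (hc.intervalIntegrable _ _)] at h2
    have h3 : kerProj ℓ e y + (1 : ℝ) • β y = y := by simp [β]
    rw [h3, zero_smul, add_zero] at h2
    exact h2.symm
  refine ⟨fun y => (L y e - Complex.I * L y (Complex.I • e)) / 2,
    fun y => (L y e + Complex.I * L y (Complex.I • e)) / 2, ?_, ?_, ?_⟩
  · have h1 := hL.clm_apply (contDiff_const (c := e))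
    have h2 := hL.clm_apply (contDiff_const (c := Complex.I • e))
    exact ((h1.sub (contDiff_const.mul h2)).div_const 2).contDiffAt
  · have h1 := hL.clm_apply (contDiff_const (c := e))
    have h2 := hL.clm_apply (contDiff_const (c := Complex.I • e))
    exact ((h1.add (contDiff_const.mul h2)).div_const 2).contDiffAt
  · have hπ : Filter.Tendsto (kerProj ℓ e) (𝓝 0) (𝓝 0) := by
      simpa using (kerProj ℓ e).continuous.tendsto 0
    filter_upwards [hgf, hπ.eventually hgf, hπ.eventually h0] with y h1 h2 h3
    have h4 := key y
    rw [h1, h2, h3 (map_kerProj he y), sub_zero] at h4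
    have h5 : ℓ y • e = (ℓ y).re • e + (ℓ y).im • (Complex.I • e) := by
      rw [← Complex.coe_smul, ← Complex.coe_smul, smul_smul, ← add_smul, Complex.re_add_im]
    rw [h4, h5, map_add, map_smul, map_smul, Complex.real_smul, Complex.real_smul]
    conv_rhs => rw [← Complex.re_add_im (ℓ y)]
    simp only [map_add, map_mul, Complex.conj_ofReal, Complex.conj_I]
    linear_combination ((ℓ y).im * L y (Complex.I • e) : ℂ) * Complex.I_sq

end Hadamard

/-! ### The Hamiltonian field of a cometric -/

section Hamilton

variable {E : Type*} [NormedAddCommGroup E] [NormedSpace ℝ E]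

/-- The Hamiltonian vector field of `H(x, p) = p(S(x) p) / 2` on the cotangent space
`E × E*`, where `S(x) : E* → E` is the inverse of a Riemannian metric. -/
noncomputable def hamField (S : E → (E →L[ℝ] ℝ) →L[ℝ] E) (z : E × (E →L[ℝ] ℝ)) :
    E × (E →L[ℝ] ℝ) :=
  (S z.1 z.2, (-(1 / 2) : ℝ) • z.2.comp ((fderiv ℝ S z.1).flip z.2))

/-- Twice the kinetic energy, `(x, p) ↦ p(S(x) p)`. -/
noncomputable def hamEnergy (S : E → (E →L[ℝ] ℝ) →L[ℝ] E) (z : E × (E →L[ℝ] ℝ)) : ℝ := z.2 (S z.1 z.2)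

variable {S : E → (E →L[ℝ] ℝ) →L[ℝ] E}

theorem contDiff_hamField {n : ℕ} (hS : ContDiff ℝ (n + 1 : ℕ) S) :
    ContDiff ℝ n (hamField S) := by
  have h1 : ContDiff ℝ n (fderiv ℝ S) := hS.fderiv_right (by norm_cast)
  have h2 : ContDiff ℝ n S := hS.of_le (by norm_cast; omega)
  have h3 : ContDiff ℝ n (fun z : E × (E →L[ℝ] ℝ) => (fderiv ℝ S z.1).flip) :=
    (ContinuousLinearMap.flipₗᵢ ℝ E (E →L[ℝ] ℝ) E).contDiff.comp (h1.comp contDiff_fst)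
  exact ((h2.comp contDiff_fst).clm_apply contDiff_snd).prodMk
    ((contDiff_snd.clm_comp (h3.clm_apply contDiff_snd)).const_smul _)

theorem contDiff_hamEnergy {n : ℕ} (hS : ContDiff ℝ n S) : ContDiff ℝ n (hamEnergy S) :=
  contDiff_snd.clm_apply ((hS.comp contDiff_fst).clm_apply contDiff_snd)

theorem hamField_zero (x : E) : hamField S (x, 0) = 0 := by
  simp [hamField]

theorem hasFDerivAt_hamField_fst (hS : Differentiable ℝ S) (z : E × (E →L[ℝ] ℝ)) :
    HasFDerivAt (fun z => (hamField S z).1)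
      ((S z.1).comp (ContinuousLinearMap.snd ℝ E (E →L[ℝ] ℝ)) +
        ((fderiv ℝ S z.1).flip z.2).comp (ContinuousLinearMap.fst ℝ E (E →L[ℝ] ℝ))) z := by
  have h := ((hS z.1).hasFDerivAt.comp z hasFDerivAt_fst).clm_apply
    (hasFDerivAt_snd (𝕜 := ℝ) (p := z))
  refine h.congr_fderiv ?_
  ext v <;> simp

/-- At the zero section the linearized field is `(ξ, π) ↦ (S(x) π, 0)`, whose square is zero. -/
theorem fderiv_hamField_zero {n : ℕ} (hn : 1 ≤ n) (hS : ContDiff ℝ (n + 1 : ℕ) S) (x : E)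
    (v : E × (E →L[ℝ] ℝ)) :
    fderiv ℝ (hamField S) (x, 0) v = (S x v.2, 0) := by
  have hn' : (n : WithTop ℕ∞) ≠ 0 := by norm_cast; omega
  have hd : DifferentiableAt ℝ (hamField S) (x, 0) :=
    (contDiff_hamField hS).differentiable hn' _
  have h1 := hd.hasFDerivAt.fst.unique
    (hasFDerivAt_hamField_fst (hS.differentiable (by norm_cast)) (x, 0))
  have hS' : ContDiff ℝ n (fderiv ℝ S) := hS.fderiv_right (by norm_cast)
  have h2 : HasFDerivAt (𝕜 := ℝ) (fun z : E × (E →L[ℝ] ℝ) => (hamField S z).2) 0 (x, 0) := by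
    have h3 : ContDiff ℝ n (fun z : E × (E →L[ℝ] ℝ) => (fderiv ℝ S z.1).flip) :=
      (ContinuousLinearMap.flipₗᵢ ℝ E (E →L[ℝ] ℝ) E).contDiff.comp (hS'.comp contDiff_fst)
    have h4 : DifferentiableAt ℝ (fun z : E × (E →L[ℝ] ℝ) => (fderiv ℝ S z.1).flip z.2)
        (x, (0 : E →L[ℝ] ℝ)) :=
      (h3.clm_apply contDiff_snd).differentiable hn' _
    have h6 : HasFDerivAt (fun z : E × (E →L[ℝ] ℝ) => z.2)
      (ContinuousLinearMap.snd ℝ E (E →L[ℝ] ℝ)) (x, 0) := hasFDerivAt_snd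
    have h5 := h6.clm_comp h4.hasFDerivAt
    refine (h5.const_smul (-(1 / 2) : ℝ)).congr_fderiv ?_
    ext v <;> simp
  have h3 := hd.hasFDerivAt.snd.unique h2
  refine Prod.ext ?_ ?_
  · have := DFunLike.congr_fun h1 v
    simpa using this
  · exact DFunLike.congr_fun h3 v

theorem hasFDerivAt_hamEnergy (hS : Differentiable ℝ S) (z : E × (E →L[ℝ] ℝ))
    (hsymm : ∀ p r : E →L[ℝ] ℝ, p (S z.1 r) = r (S z.1 p)) :
    HasFDerivAt (hamEnergy S)
      ((2 : ℝ) • (z.2.comp (S z.1)).comp (ContinuousLinearMap.snd ℝ E (E →L[ℝ] ℝ)) +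
        (z.2.comp ((fderiv ℝ S z.1).flip z.2)).comp
          (ContinuousLinearMap.fst ℝ E (E →L[ℝ] ℝ))) z := by
  have h := (hasFDerivAt_snd (𝕜 := ℝ) (p := z)).clm_apply (hasFDerivAt_hamField_fst hS z)
  refine h.congr_fderiv ?_
  refine ContinuousLinearMap.ext fun v => ?_
  have : v.2 (S z.1 z.2) = z.2 (S z.1 v.2) := hsymm _ _
  simp [hamField, this]
  ring

/-- The energy is conserved: its derivative along the Hamiltonian field vanishes. -/
theorem fderiv_hamEnergy_hamField (hS : Differentiable ℝ S) (z : E × (E →L[ℝ] ℝ))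
    (hsymm : ∀ p r : E →L[ℝ] ℝ, p (S z.1 r) = r (S z.1 p)) :
    fderiv ℝ (hamEnergy S) z (hamField S z) = 0 := by
  rw [(hasFDerivAt_hamEnergy hS z hsymm).fderiv]
  simp only [hamField, add_apply, smul_apply,
    ContinuousLinearMap.comp_apply, ContinuousLinearMap.coe_snd', ContinuousLinearMap.coe_fst',
    map_smul, smul_eq_mul]
  rw [hsymm z.2]
  simp

theorem eq_add_of_hasDerivAt_const {g : ℝ → ℝ} {k : ℝ}
    (hg : ∀ t ∈ Icc (0 : ℝ) 1, HasDerivAt g k t) {t : ℝ} (ht : t ∈ Icc (0 : ℝ) 1) :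
    g t = g 0 + t * k := by
  have h := constant_of_has_deriv_right_zero (f := fun t => g t - t * k) (a := 0) (b := 1)
    (fun s hs => ((hg s hs).sub ((hasDerivAt_id s).mul_const k)).continuousAt.continuousWithinAt)
    (fun s hs => by
      have := (hg s (Ico_subset_Icc_self hs)).sub ((hasDerivAt_id s).mul_const k)
      rw [one_mul, sub_self] at this
      exact this.hasDerivWithinAt) t ht
  linarith [h]

end Hamilton

/-! ### Variation of trajectories -/

section FlowVariation

variable {Z : Type*} [NormedAddCommGroup Z] [NormedSpace ℝ Z]

/-- The derivative of the solutions of an integral equation with respect to the initial value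
solves the linearized equation. -/
theorem flow_variation {f : C(Z, Z)} (hf : ContDiff ℝ 1 f) {Γ : Z → C(unitInterval, Z)} {z : Z}
    {W : Z →L[ℝ] C(unitInterval, Z)} (hW : HasFDerivAt Γ W z)
    (hΓ : ∀ᶠ z in 𝓝 z, ∀ t : unitInterval,
        Γ z t = z + ∫ s in (0 : ℝ)..t, f (unitExtend (Γ z) s)) (ζ : Z) (t : unitInterval) :
    W ζ t = ζ + ∫ s in (0 : ℝ)..t, fderiv ℝ f (unitExtend (Γ z) s) (unitExtend (W ζ) s) := by
  let f' : C(Z, Z →L[ℝ] Z) := ⟨fderiv ℝ f, hf.continuous_fderiv one_ne_zero⟩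
  let c : Z →L[ℝ] C(unitInterval, Z) := ContinuousLinearMap.const ℝ unitInterval
  have h1 : HasFDerivAt (fun z => c z + primitiveCLM Z (f.comp (Γ z)))
      (c + (primitiveCLM Z).comp
        ((pointwiseApplyCLM unitInterval Z Z (f'.comp (Γ z))).comp W)) z :=
    c.hasFDerivAt.add ((primitiveCLM Z).hasFDerivAt.comp z
      ((hasFDerivAt_continuousMap_comp (f' := f')
        (fun x => (hf.differentiable one_ne_zero x).hasFDerivAt) (Γ z)).comp z hW))
  have h2 : Γ =ᶠ[𝓝 z] fun z => c z + primitiveCLM Z (f.comp (Γ z)) := by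
    filter_upwards [hΓ] with z' hz'
    ext t
    exact hz' t
  have h3 := hW.unique (h1.congr_of_eventuallyEq h2)
  exact DFunLike.congr_fun (DFunLike.congr_fun h3 ζ) t

theorem hasDerivAt_add_primitive [CompleteSpace Z] {g : ℝ → Z} (hg : Continuous g) (z : Z)
    (t : ℝ) : HasDerivAt (fun t => z + ∫ s in (0 : ℝ)..t, g s) (g t) t :=
  (intervalIntegral.integral_hasDerivAt_right (hg.intervalIntegrable _ _)
    (hg.stronglyMeasurableAtFilter _ _) hg.continuousAt).const_add z

end FlowVariation

section Gauss

variable {E : Type*} [NormedAddCommGroup E] [NormedSpace ℝ E] [CompleteSpace E]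
  {S : E → (E →L[ℝ] ℝ) →L[ℝ] E}

theorem hamEnergy_flow_eq (hS : Differentiable ℝ S) (hf : Continuous (hamField S))
    {γ : C(unitInterval, E × (E →L[ℝ] ℝ))} {z : E × (E →L[ℝ] ℝ)}
    (hγ : ∀ t : unitInterval, γ t = z + ∫ s in (0 : ℝ)..t, hamField S (unitExtend γ s))
    (hsymm : ∀ t, ∀ p r : E →L[ℝ] ℝ, p (S (γ t).1 r) = r (S (γ t).1 p)) (t : unitInterval) :
    hamEnergy S (γ t) = hamEnergy S z := by
  set c : ℝ → E × (E →L[ℝ] ℝ) := fun t => z + ∫ s in (0 : ℝ)..t, hamField S (unitExtend γ s)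
    with hc
  have hc1 : ∀ t (ht : t ∈ Icc (0 : ℝ) 1), c t = γ ⟨t, ht⟩ := fun t ht => (hγ ⟨t, ht⟩).symm
  have hd : ∀ t ∈ Icc (0 : ℝ) 1, HasDerivAt (fun t => hamEnergy S (c t)) 0 t := by
    intro t ht
    have h1 := hasDerivAt_add_primitive (hf.comp (continuous_unitExtend γ)) z t
    have h2 := (hasFDerivAt_hamEnergy hS (γ ⟨t, ht⟩) (hsymm _)).differentiableAt.hasFDerivAt
    have h3 := fderiv_hamEnergy_hamField hS (γ ⟨t, ht⟩) (hsymm _)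
    rw [← hc1 t ht] at h2 h3
    have h4 := h2.comp_hasDerivAt t h1
    simp only [Function.comp_apply, unitExtend_of_mem γ ht] at h4
    rw [← hc1 t ht, h3] at h4
    exact h4
  have := eq_add_of_hasDerivAt_const hd t.2
  rw [hc1 t t.2, mul_zero, add_zero] at this
  simpa [hc] using this

/-- The first variation formula along a trajectory `(x(t), p(t))` of the Hamiltonian field: the
variation `p(δx)` of the action grows linearly, with slope half of the variation of the energy. -/
theorem flow_first_variation (hS : ContDiff ℝ 2 S)
    {γ w : C(unitInterval, E × (E →L[ℝ] ℝ))} {z ζ : E × (E →L[ℝ] ℝ)}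
    (hγ : ∀ t : unitInterval, γ t = z + ∫ s in (0 : ℝ)..t, hamField S (unitExtend γ s))
    (hw : ∀ t : unitInterval, w t =
      ζ + ∫ s in (0 : ℝ)..t, fderiv ℝ (hamField S) (unitExtend γ s) (unitExtend w s))
    (hsymm : ∀ t, ∀ p r : E →L[ℝ] ℝ, p (S (γ t).1 r) = r (S (γ t).1 p)) (k : ℝ)
    (hk : ∀ t, fderiv ℝ (hamEnergy S) (γ t) (w t) = k) :
    (γ 1).2 (w 1).1 = z.2 ζ.1 + k / 2 := by
  have hS' : Differentiable ℝ S := hS.differentiable (by norm_num)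
  have hfd : ContDiff ℝ 1 (hamField S) := contDiff_hamField (n := 1) hS
  have hcont1 : Continuous fun s => hamField S (unitExtend γ s) :=
    hfd.continuous.comp (continuous_unitExtend γ)
  have hcont2 : Continuous fun s => fderiv ℝ (hamField S) (unitExtend γ s) (unitExtend w s) :=
    ((hfd.continuous_fderiv one_ne_zero).comp (continuous_unitExtend γ)).clm_apply
      (continuous_unitExtend w)
  set c : ℝ → E × (E →L[ℝ] ℝ) := fun t => z + ∫ s in (0 : ℝ)..t, hamField S (unitExtend γ s)
    with hc
  set d : ℝ → E × (E →L[ℝ] ℝ) := fun t =>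
    ζ + ∫ s in (0 : ℝ)..t, fderiv ℝ (hamField S) (unitExtend γ s) (unitExtend w s) with hd
  have hc1 : ∀ t (ht : t ∈ Icc (0 : ℝ) 1), c t = γ ⟨t, ht⟩ := fun t ht => (hγ ⟨t, ht⟩).symm
  have hd1 : ∀ t (ht : t ∈ Icc (0 : ℝ) 1), d t = w ⟨t, ht⟩ := fun t ht => (hw ⟨t, ht⟩).symm
  have hder : ∀ t ∈ Icc (0 : ℝ) 1, HasDerivAt (fun t => (c t).2 (d t).1) (k / 2) t := by
    intro t ht
    have h1 := hasDerivAt_add_primitive hcont1 z t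
    have h2 := hasDerivAt_add_primitive hcont2 ζ t
    have h1' : HasDerivAt (fun t => (c t).2) _ t :=
      (ContinuousLinearMap.snd ℝ E (E →L[ℝ] ℝ)).hasFDerivAt.comp_hasDerivAt t h1
    have h2' : HasDerivAt (fun t => (d t).1) _ t :=
      (ContinuousLinearMap.fst ℝ E (E →L[ℝ] ℝ)).hasFDerivAt.comp_hasDerivAt t h2
    have h3 := h1'.clm_apply h2'
    refine h3.congr_deriv ?_
    rw [hc1 t ht, hd1 t ht, unitExtend_of_mem γ ht, unitExtend_of_mem w ht]
    have h4 := hk ⟨t, ht⟩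
    rw [(hasFDerivAt_hamEnergy hS' _ (hsymm _)).fderiv] at h4
    have h5 : (fderiv ℝ (hamField S) (γ ⟨t, ht⟩) (w ⟨t, ht⟩)).1 = _ :=
      DFunLike.congr_fun ((hfd.differentiable one_ne_zero (γ ⟨t, ht⟩)).hasFDerivAt.fst.unique
        (hasFDerivAt_hamField_fst hS' _)) (w ⟨t, ht⟩)
    simp only [ContinuousLinearMap.coe_fst', ContinuousLinearMap.coe_snd']
    rw [h5, ← h4]
    simp [hamField]
    ring
  have := eq_add_of_hasDerivAt_const hder (t := 1) (by simp)
  rw [hc1 1 (by simp), hd1 1 (by simp)] at this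
  simpa [hc, hd] using this

end Gauss

/-! ### Normal geodesics of a complex hyperplane -/

section Eikonal

variable {E : Type*} [NormedAddCommGroup E] [NormedSpace ℂ E]

/-- The real covector `v ↦ Re (ζ ℓ(v))` attached to a complex covector `ℓ` and a number `ζ`. -/
noncomputable def reCovector (ℓ : E →L[ℂ] ℂ) : ℂ →L[ℝ] (E →L[ℝ] ℝ) :=
  LinearMap.toContinuousLinearMap
    { toFun := fun ζ => Complex.reCLM.comp ((ζ • ℓ).restrictScalars ℝ)
      map_add' := fun a b => by ext v; simp [add_mul]
      map_smul' := fun a b => by ext v; simp [mul_assoc] }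

@[simp] theorem reCovector_apply (ℓ : E →L[ℂ] ℂ) (ζ : ℂ) (v : E) :
    reCovector ℓ ζ v = (ζ * ℓ v).re := rfl

/-- The initial data of the normal geodesics of the hyperplane `ℓ = 0`: the base point
`kerProj ℓ e θ` in the hyperplane together with the conormal covector `Re (conj (ℓ θ) ℓ)`. -/
noncomputable def conormalData (ℓ : E →L[ℂ] ℂ) (e : E) : E →L[ℝ] E × (E →L[ℝ] ℝ) :=
  (kerProj ℓ e).prod ((reCovector ℓ).comp
    ((Complex.conjCLE : ℂ →L[ℝ] ℂ).comp (ℓ.restrictScalars ℝ)))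

@[simp] theorem conormalData_fst (ℓ : E →L[ℂ] ℂ) (e θ : E) :
    (conormalData ℓ e θ).1 = kerProj ℓ e θ := rfl

@[simp] theorem conormalData_snd (ℓ : E →L[ℂ] ℂ) (e θ : E) :
    (conormalData ℓ e θ).2 = reCovector ℓ (starRingEnd ℂ (ℓ θ)) := rfl

/-- A linear map `E* → E` which is the inverse of the isomorphism `E → E*` given by a scalar product
compatible with the complex structure of `E`. The last condition says that `A` intertwines the
transposed complex structure `p ↦ p ∘ i` with `-i`. -/
structure IsHermitianCometric (A : (E →L[ℝ] ℝ) →L[ℝ] E) : Prop where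
  symm : ∀ p r : E →L[ℝ] ℝ, p (A r) = r (A p)
  pos : ∀ p : E →L[ℝ] ℝ, p ≠ 0 → 0 < p (A p)
  herm : ∀ p r : E →L[ℝ] ℝ, (∀ v, r v = p (Complex.I • v)) → A r = -(Complex.I • A p)

theorem IsHermitianCometric.apply_reCovector {A : (E →L[ℝ] ℝ) →L[ℝ] E}
    (hA : IsHermitianCometric A) (ℓ : E →L[ℂ] ℂ) (ζ : ℂ) :
    A (reCovector ℓ ζ) = starRingEnd ℂ ζ • A (reCovector ℓ 1) := by
  have h1 : A (reCovector ℓ Complex.I) = -(Complex.I • A (reCovector ℓ 1)) :=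
    hA.herm _ _ fun v => by simp
  have h2 : ζ = ζ.re • (1 : ℂ) + ζ.im • Complex.I := by
    rw [Complex.real_smul, Complex.real_smul, mul_one, Complex.re_add_im]
  conv_lhs => rw [h2]
  rw [map_add, map_smul, map_smul, map_add, map_smul, map_smul, h1, ← Complex.coe_smul,
    ← Complex.coe_smul, ← neg_smul, smul_smul, ← add_smul]
  congr 1
  apply Complex.ext <;> simp

/-- The squared length of the covector `Re (ζ ℓ)`. -/
theorem IsHermitianCometric.reCovector_apply_reCovector {A : (E →L[ℝ] ℝ) →L[ℝ] E}
    (hA : IsHermitianCometric A) (ℓ : E →L[ℂ] ℂ) (ζ : ℂ) :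
    reCovector ℓ ζ (A (reCovector ℓ ζ)) = ‖ζ‖ ^ 2 * (ℓ (A (reCovector ℓ 1))).re := by
  rw [hA.apply_reCovector, reCovector_apply, map_smul, smul_eq_mul, ← mul_assoc,
    Complex.mul_conj, Complex.re_ofReal_mul, Complex.normSq_eq_norm_sq]

variable [FiniteDimensional ℂ E] {S : E → (E →L[ℝ] ℝ) →L[ℝ] E}

/-- Trajectories of the Hamiltonian field on `[0, 1]` near the zero section: they depend smoothly on
the initial value, conserve the energy and satisfy the first variation formula. -/
theorem exists_hamiltonian_flow (hS : ContDiff ℝ 7 S)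
    (hA : ∀ᶠ x in 𝓝 (0 : E), IsHermitianCometric (S x)) :
    ∃ Γ : E × (E →L[ℝ] ℝ) → C(unitInterval, E × (E →L[ℝ] ℝ)), ContDiffAt ℝ 6 Γ 0 ∧
      Γ 0 = ContinuousMap.const _ 0 ∧ ∀ᶠ z in 𝓝 (0 : E × (E →L[ℝ] ℝ)),
        (∀ t : unitInterval, Γ z t = z + ∫ s in (0 : ℝ)..t, hamField S (unitExtend (Γ z) s)) ∧
        (∀ t, hamEnergy S (Γ z t) = hamEnergy S z) ∧
        (∀ t, IsHermitianCometric (S (Γ z t).1)) ∧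
        (hamField S z = 0 → Γ z = ContinuousMap.const _ z) ∧ DifferentiableAt ℝ Γ z ∧
        ∀ ζ, (Γ z 1).2 (fderiv ℝ Γ z ζ 1).1 = z.2 ζ.1 + fderiv ℝ (hamEnergy S) z ζ / 2 := by
  have : FiniteDimensional ℝ E := FiniteDimensional.complexToReal E
  have : CompleteSpace E := FiniteDimensional.complete ℝ E
  have hS' : Differentiable ℝ S := hS.differentiable (by norm_num)
  have hf6 : ContDiff ℝ (6 : ℕ) (hamField S) := contDiff_hamField (n := 6) hS
  have hf1 : ContDiff ℝ 1 (hamField S) := hf6.of_le (by norm_num)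
  have h00 : (0 : E × (E →L[ℝ] ℝ)) = ((0 : E), (0 : E →L[ℝ] ℝ)) := rfl
  have hd0 := fderiv_hamField_zero (n := 6) (by norm_num) hS (0 : E)
  obtain ⟨Γ, hΓ, hint, hconst⟩ := exists_contDiffAt_flow (n := 6) (by norm_num)
    ⟨hamField S, hf6.continuous⟩ hf6 0 (hamField_zero 0) (fun v => by
      change fderiv ℝ (hamField S) 0 (fderiv ℝ (hamField S) 0 v) = 0
      rw [h00, hd0, hd0]
      simp)
  have hΓ0 : Γ 0 = ContinuousMap.const _ 0 := hconst.self_of_nhds (hamField_zero 0)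
  have hherm : ∀ᶠ z in 𝓝 0, ∀ t, IsHermitianCometric (S (Γ z t).1) := by
    obtain ⟨r, hr, hr'⟩ := Metric.eventually_nhds_iff.1 hA
    have h1 := Metric.continuousAt_iff'.1 hΓ.continuousAt r hr
    filter_upwards [h1] with z hz t
    refine hr' ?_
    rw [hΓ0] at hz
    have h2 := (ContinuousMap.dist_apply_le_dist (f := Γ z) (g := ContinuousMap.const _ 0) t).trans_lt hz
    rw [ContinuousMap.const_apply] at h2
    exact (le_max_left _ _).trans_lt h2
  have hdiff : ∀ᶠ z in 𝓝 0, DifferentiableAt ℝ Γ z := by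
    filter_upwards [hΓ.eventually (by simp)] with z hz
    exact hz.differentiableAt (by norm_num)
  have henergy : ∀ᶠ z in 𝓝 0, ∀ t, hamEnergy S (Γ z t) = hamEnergy S z := by
    filter_upwards [hint, hherm] with z h1 h2 t
    exact hamEnergy_flow_eq hS' hf6.continuous h1 (fun t => (h2 t).symm) t
  refine ⟨Γ, hΓ, hΓ0, ?_⟩
  filter_upwards [hint, hint.eventually_nhds, henergy, henergy.eventually_nhds, hherm, hconst,
    hdiff] with z h1 h1' h2 h2' h3 h4 h5
  refine ⟨h1, h2, h3, h4, h5, fun ζ => ?_⟩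
  have hvar := flow_variation (f := ⟨hamField S, hf6.continuous⟩) hf1 h5.hasFDerivAt h1' ζ
  refine flow_first_variation (hS.of_le (by norm_num)) h1 hvar (fun t => (h3 t).symm) _
    fun t => ?_
  have hE : Differentiable ℝ (hamEnergy S) :=
    (contDiff_hamEnergy (n := 7) hS).differentiable (by norm_num)
  have h6 : HasFDerivAt (fun z => hamEnergy S (Γ z t))
      ((fderiv ℝ (hamEnergy S) (Γ z t)).comp
        ((ContinuousMap.evalCLM ℝ t).comp (fderiv ℝ Γ z))) z :=
    (hE _).hasFDerivAt.comp z
      ((ContinuousMap.evalCLM (M := E × (E →L[ℝ] ℝ)) ℝ t).hasFDerivAt.comp z h5.hasFDerivAt)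
  have h7 := h6.unique ((hE z).hasFDerivAt.congr_of_eventuallyEq
    (h2'.mono fun z hz => hz t))
  exact DFunLike.congr_fun h7 ζ

/-- At the zero section, the endpoint of the flow moves by `ξ + S(0) π` under the variation
`(ξ, π)` of the initial data. -/
theorem fderiv_flow_zero (hS : ContDiff ℝ 7 S)
    {Γ : E × (E →L[ℝ] ℝ) → C(unitInterval, E × (E →L[ℝ] ℝ))}
    (hΓ : DifferentiableAt ℝ Γ 0) (hΓ0 : Γ 0 = ContinuousMap.const _ 0)
    (hint : ∀ᶠ z in 𝓝 (0 : E × (E →L[ℝ] ℝ)), ∀ t : unitInterval,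
      Γ z t = z + ∫ s in (0 : ℝ)..t, hamField S (unitExtend (Γ z) s))
    (ζ : E × (E →L[ℝ] ℝ)) :
    (fderiv ℝ Γ 0 ζ 1).1 = ζ.1 + S 0 ζ.2 := by
  have : FiniteDimensional ℝ E := FiniteDimensional.complexToReal E
  have : CompleteSpace E := FiniteDimensional.complete ℝ E
  have hf6 : ContDiff ℝ (6 : ℕ) (hamField S) := contDiff_hamField (n := 6) hS
  have hf1 : ContDiff ℝ 1 (hamField S) := hf6.of_le (by norm_num)
  have hvar := flow_variation (f := ⟨hamField S, hf6.continuous⟩) hf1 hΓ.hasFDerivAt hint ζ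
  have hd0 := fderiv_hamField_zero (n := 6) (by norm_num) hS (0 : E)
  set w := fderiv ℝ Γ 0 ζ with hw
  have h1 : ∀ t : unitInterval, w t = ζ + ∫ s in (0 : ℝ)..t, (S 0 (unitExtend w s).2, 0) := by
    intro t
    rw [hvar t]
    congr 1
    refine intervalIntegral.integral_congr fun s _ => ?_
    have h2 : unitExtend (Γ 0) s = ((0 : E), (0 : E →L[ℝ] ℝ)) := by rw [hΓ0]; rfl
    simp only [h2]
    exact hd0 _
  have hi : ∀ t : ℝ, IntervalIntegrable (fun s => (S 0 (unitExtend w s).2, (0 : E →L[ℝ] ℝ)))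
      MeasureTheory.volume 0 t := fun t => by
    refine Continuous.intervalIntegrable ?_ _ _
    exact ((S 0).continuous.comp (continuous_snd.comp (continuous_unitExtend w))).prodMk
      continuous_const
  have h2 : ∀ t : unitInterval, (w t).2 = ζ.2 := by
    intro t
    have h3 := ContinuousLinearMap.intervalIntegral_comp_comm
      (ContinuousLinearMap.snd ℝ E (E →L[ℝ] ℝ)) (hi t)
    rw [h1 t, Prod.snd_add]
    simp only [ContinuousLinearMap.coe_snd', intervalIntegral.integral_zero] at h3
    rw [← h3, add_zero]
  have h3 := ContinuousLinearMap.intervalIntegral_comp_comm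
      (ContinuousLinearMap.fst ℝ E (E →L[ℝ] ℝ)) (hi (1 : unitInterval))
  rw [h1 1, Prod.fst_add]
  simp only [ContinuousLinearMap.coe_fst'] at h3
  rw [← h3]
  have h4 : ∀ s, (unitExtend w s).2 = ζ.2 := fun s => h2 _
  simp [h4]

end Eikonal

/-! ### Solution of the eikonal equation -/

section EikonalSolution

variable {E : Type*} [NormedAddCommGroup E] [NormedSpace ℂ E] [FiniteDimensional ℂ E]
  {S : E → (E →L[ℝ] ℝ) →L[ℝ] E}

/-- A solution of the eikonal equation with zero set `ℓ = 0`: the energy `q` of the normal geodesic of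
the hyperplane `ℓ = 0` which ends at a given point at time `1`. The last clause provides this
geodesic, a curve of constant squared speed `q x` from the hyperplane to `x`. -/
theorem exists_eikonal_solution (hS : ContDiff ℝ 7 S)
    (hA : ∀ᶠ x in 𝓝 (0 : E), IsHermitianCometric (S x)) {ℓ : E →L[ℂ] ℂ} {e : E} (he : ℓ e = 1) :
    ∃ q : E → ℝ, ContDiffAt ℝ 6 q 0 ∧
      (∀ᶠ x in 𝓝 (0 : E), fderiv ℝ q x (S x (fderiv ℝ q x)) = 4 * q x) ∧
      (∀ᶠ x in 𝓝 (0 : E), ℓ x = 0 → q x = 0) ∧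
      (∃ c > 0, ∀ᶠ x in 𝓝 (0 : E), c * ‖ℓ x‖ ^ 2 ≤ q x) ∧
      ∀ U ∈ 𝓝 (0 : E), ∀ᶠ x in 𝓝 (0 : E), ∃ c : ℝ → E, ContDiff ℝ 1 c ∧
        (∀ t ∈ Icc (0 : ℝ) 1, c t ∈ U) ∧ ℓ (c 0) = 0 ∧ c 1 = x ∧
        ∀ t ∈ Icc (0 : ℝ) 1, ∃ p, deriv c t = S (c t) p ∧ p (S (c t) p) = q x := by
  have : FiniteDimensional ℝ E := FiniteDimensional.complexToReal E
  have : CompleteSpace E := FiniteDimensional.complete ℝ E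
  obtain ⟨Γ, hΓ, hΓ0, hprop⟩ := exists_hamiltonian_flow hS hA
  have hf6 : ContDiff ℝ (6 : ℕ) (hamField S) := contDiff_hamField (n := 6) hS
  have hE7 : ContDiff ℝ (7 : ℕ) (hamEnergy S) := contDiff_hamEnergy hS
  set ι := conormalData ℓ e with hι
  have hι0 : ι 0 = 0 := map_zero ι
  have hιt : Filter.Tendsto ι (𝓝 0) (𝓝 0) := by simpa using ι.continuous.tendsto 0
  let ev : C(unitInterval, E × (E →L[ℝ] ℝ)) →L[ℝ] E :=
    (ContinuousLinearMap.fst ℝ E (E →L[ℝ] ℝ)).comp (ContinuousMap.evalCLM ℝ 1)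
  let X : E → E := fun θ => (Γ (ι θ) 1).1
  have hX : ContDiffAt ℝ 6 X 0 := by
    have h1 : ContDiffAt ℝ 6 Γ (ι 0) := by rwa [hι0]
    exact ev.contDiff.contDiffAt.comp 0 (h1.comp 0 ι.contDiff.contDiffAt)
  have hX0 : X 0 = 0 := by simp [X, hι0, hΓ0]
  have hX' : ∀ᶠ θ in 𝓝 0, HasFDerivAt X (ev.comp ((fderiv ℝ Γ (ι θ)).comp ι)) θ := by
    filter_upwards [hιt.eventually hprop] with θ hθ
    exact ev.hasFDerivAt.comp θ (hθ.2.2.2.2.1.hasFDerivAt.comp θ ι.hasFDerivAt)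
  -- the differential of `X` at the origin is injective: pair with the covector
  -- `p = Re (conj (ℓ τ) ℓ)`, which vanishes on the kernel of `ℓ`
  have hA0 := hA.self_of_nhds
  have hdX : ∀ τ, ev.comp ((fderiv ℝ Γ (ι 0)).comp ι) τ =
      kerProj ℓ e τ + S 0 (reCovector ℓ (starRingEnd ℂ (ℓ τ))) := by
    intro τ
    have h1 := fderiv_flow_zero hS (hΓ.differentiableAt (by norm_num)) hΓ0
      (hprop.mono fun z hz => hz.1) (ι τ)
    rw [← hι0] at h1
    exact h1
  have hinj : Function.Injective (ev.comp ((fderiv ℝ Γ (ι 0)).comp ι)) := by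
    rw [injective_iff_map_eq_zero]
    intro τ hτ
    rw [hdX] at hτ
    set p := reCovector ℓ (starRingEnd ℂ (ℓ τ)) with hp
    have h1 : p (S 0 p) = 0 := by
      have h2 : p (kerProj ℓ e τ) = 0 := by rw [hp, reCovector_apply, map_kerProj he]; simp
      have h3 := congrArg p hτ
      rwa [map_add, h2, zero_add, map_zero] at h3
    have h2 : p = 0 := by
      by_contra h
      exact (hA0.pos p h).ne' h1
    have h3 : ℓ τ = 0 := by
      have h4 := DFunLike.congr_fun h2 τ
      rw [hp, reCovector_apply, ← Complex.normSq_eq_conj_mul_self, Complex.ofReal_re] at h4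
      exact Complex.normSq_eq_zero.1 h4
    rw [h2, map_zero, add_zero, kerProj_apply, h3, zero_smul, sub_zero] at hτ
    exact hτ
  let D : E ≃L[ℝ] E := (LinearEquiv.ofInjectiveEndo
    ((ev.comp ((fderiv ℝ Γ (ι 0)).comp ι) : E →L[ℝ] E) : E →ₗ[ℝ] E) hinj).toContinuousLinearEquiv
  have hXD : HasFDerivAt X (D : E →L[ℝ] E) 0 := by
    refine hX'.self_of_nhds.congr_fderiv ?_
    ext v
    rfl
  have h6 : (6 : WithTop ℕ∞) ≠ 0 := by norm_num
  have hXs := hX.hasStrictFDerivAt' hXD h6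
  set Y := hX.localInverse hXD h6 with hY
  have hYc : ContDiffAt ℝ 6 Y 0 := by
    have := hX.to_localInverse hXD h6
    rwa [hX0] at this
  have hY0 : Y 0 = 0 := by
    have := hX.localInverse_apply_image hXD h6
    rwa [hX0] at this
  have hYt : Filter.Tendsto Y (𝓝 0) (𝓝 0) := by
    have := hYc.continuousAt.tendsto
    rwa [hY0] at this
  have hYX : ∀ᶠ θ in 𝓝 0, Y (X θ) = θ := hXs.eventually_left_inverse
  have hXY : ∀ᶠ x in 𝓝 0, X (Y x) = x := by
    have := hXs.eventually_right_inverse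
    rwa [hX0] at this
  let Q : E → ℝ := fun θ => hamEnergy S (ι θ)
  have hQ : ContDiff ℝ 7 Q := hE7.comp ι.contDiff
  have hιY : Filter.Tendsto (fun x => ι (Y x)) (𝓝 0) (𝓝 0) := hιt.comp hYt
  -- points of the hyperplane are stationary
  have hstat : ∀ᶠ θ in 𝓝 0, ℓ θ = 0 → X θ = θ := by
    filter_upwards [hιt.eventually hprop] with θ hθ hℓ
    have h1 : ι θ = (θ, 0) := by
      refine Prod.ext ?_ ?_
      · simp [hι, hℓ]
      · rw [hι, conormalData_snd, hℓ, map_zero, map_zero]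
    have h2 := hθ.2.2.2.1 (by rw [h1, hamField_zero])
    simp only [X]
    rw [h2, ContinuousMap.const_apply, h1]
  -- the Gauss lemma: the normal geodesics meet the level sets of `q` orthogonally; the initial
  -- covector annihilates the hyperplane, so the first variation formula has no boundary term at `0`
  have hgauss : ∀ᶠ x in 𝓝 0, fderiv ℝ (fun x => Q (Y x)) x = (2 : ℝ) • (Γ (ι (Y x)) 1).2 := by
    have hYd : ∀ᶠ x in 𝓝 0, DifferentiableAt ℝ Y x :=
      (hYc.eventually (by simp)).mono fun x hx => hx.differentiableAt h6
    filter_upwards [hYd, hXY.eventually_nhds, hYt.eventually hX', hιY.eventually hprop]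
      with x h1 h2 h3 h4
    have h5 := (h3.comp x h1.hasFDerivAt).unique
      ((hasFDerivAt_id x).congr_of_eventuallyEq h2)
    have h7 : HasFDerivAt (fun x => Q (Y x)) (((fderiv ℝ (hamEnergy S) (ι (Y x))).comp ι).comp
        (fderiv ℝ Y x)) x :=
      ((hE7.differentiable (by norm_num) _).hasFDerivAt.comp (Y x) ι.hasFDerivAt).comp x
        h1.hasFDerivAt
    rw [h7.fderiv]
    ext v
    have h8 := h4.2.2.2.2.2 (ι (fderiv ℝ Y x v))
    have h9 : (fderiv ℝ Γ (ι (Y x)) (ι (fderiv ℝ Y x v)) 1).1 = v := DFunLike.congr_fun h5 v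
    have h10 : (ι (Y x)).2 (ι (fderiv ℝ Y x v)).1 = 0 := by
      rw [hι, conormalData_snd, conormalData_fst, reCovector_apply, map_kerProj he]
      simp
    rw [h9, h10, zero_add] at h8
    simp only [ContinuousLinearMap.comp_apply, smul_apply, smul_eq_mul]
    rw [h8]
    ring
  refine ⟨fun x => Q (Y x), ?_, ?_, ?_, ?_, ?_⟩
  · exact (hQ.of_le (by norm_num)).contDiffAt.comp 0 hYc
  · filter_upwards [hgauss, hXY, hιY.eventually hprop] with x h1 h2 h3
    rw [h1]
    have h4 := h3.2.1 1
    have h5 : (Γ (ι (Y x)) 1).1 = x := h2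
    rw [hamEnergy, h5] at h4
    simp only [map_smul, smul_apply, smul_eq_mul]
    rw [h4]
    simp only [Q]
    ring
  · filter_upwards [hYX, hstat] with x h1 h2 hx
    have h3 : Y x = x := by rw [h2 hx] at h1; exact h1
    rw [h3]
    simp only [Q, hamEnergy, hι, conormalData_snd, hx, map_zero]
  · have hpos0 : 0 < (ℓ (S 0 (reCovector ℓ 1))).re := by
      have h1 : reCovector ℓ 1 ≠ 0 := fun h => by
        have := DFunLike.congr_fun h e
        simp [he] at this
      simpa using hA0.pos _ h1
    set h0 := (ℓ (S 0 (reCovector ℓ 1))).re with hh0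
    have hcont : ∀ᶠ x in 𝓝 0, h0 / 2 < (ℓ (S x (reCovector ℓ 1))).re := by
      have hc : Continuous fun x => (ℓ (S x (reCovector ℓ 1))).re :=
        Complex.continuous_re.comp (ℓ.continuous.comp (hS.continuous.clm_apply continuous_const))
      exact hc.continuousAt.eventually (lt_mem_nhds (by linarith))
    obtain ⟨K, T, hT, hK⟩ := (hX.of_le (m := 1) (by norm_num)).exists_lipschitzOnWith
    have hπt : Filter.Tendsto (kerProj ℓ e) (𝓝 0) (𝓝 0) := by
      simpa using (kerProj ℓ e).continuous.tendsto 0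
    have hlow : ∀ᶠ θ in 𝓝 0, h0 / 2 * ‖ℓ θ‖ ^ 2 ≤ Q θ := by
      filter_upwards [hπt.eventually hcont, hπt.eventually hA] with θ h1 h2
      simp only [Q, hamEnergy, hι, conormalData_snd, conormalData_fst]
      rw [h2.reCovector_apply_reCovector, RCLike.norm_conj, mul_comm]
      exact mul_le_mul_of_nonneg_left h1.le (by positivity)
    set M : ℝ := ‖ℓ‖ * (K * ‖e‖) + 1 with hM
    have hMpos : 0 < M := by positivity
    have hup : ∀ᶠ θ in 𝓝 0, ‖ℓ (X θ)‖ ≤ M * ‖ℓ θ‖ := by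
      filter_upwards [hT, hπt.eventually hT, hπt.eventually hstat] with θ h1 h2 h3
      have h4 := hK.dist_le_mul _ h1 _ h2
      have h5 : θ - kerProj ℓ e θ = ℓ θ • e := by simp
      rw [dist_eq_norm, dist_eq_norm, h5, h3 (map_kerProj he θ), norm_smul] at h4
      have h6 : ℓ (X θ) = ℓ (X θ - kerProj ℓ e θ) := by rw [map_sub, map_kerProj he, sub_zero]
      rw [h6]
      calc ‖ℓ (X θ - kerProj ℓ e θ)‖ ≤ ‖ℓ‖ * (K * (‖ℓ θ‖ * ‖e‖)) := ℓ.le_opNorm_of_le h4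
        _ = (‖ℓ‖ * (K * ‖e‖)) * ‖ℓ θ‖ := by ring
        _ ≤ M * ‖ℓ θ‖ := by
          refine mul_le_mul_of_nonneg_right ?_ (norm_nonneg _)
          rw [hM]
          linarith
    refine ⟨h0 / 2 / M ^ 2, by positivity, ?_⟩
    filter_upwards [hYt.eventually hlow, hYt.eventually hup, hXY] with x h1 h2 h3
    rw [h3] at h2
    refine le_trans ?_ h1
    rw [div_mul_eq_mul_div, div_le_iff₀ (by positivity), mul_assoc]
    refine mul_le_mul_of_nonneg_left ?_ (by positivity)
    calc ‖ℓ x‖ ^ 2 ≤ (M * ‖ℓ (Y x)‖) ^ 2 := by gcongr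
      _ = _ := by ring
  · intro U hU
    have hnear : ∀ᶠ z in 𝓝 0, ∀ t, (Γ z t).1 ∈ U := by
      obtain ⟨r, hr, hr'⟩ := Metric.mem_nhds_iff.1 hU
      filter_upwards [Metric.continuousAt_iff'.1 hΓ.continuousAt r hr] with z hz t
      refine hr' ?_
      rw [hΓ0] at hz
      have h2 := (ContinuousMap.dist_apply_le_dist (f := Γ z)
        (g := ContinuousMap.const _ 0) t).trans_lt hz
      rw [ContinuousMap.const_apply] at h2
      exact (le_max_left _ _).trans_lt h2
    filter_upwards [hιY.eventually hprop, hιY.eventually hnear, hXY] with x h1 h2 h3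
    set z := ι (Y x) with hz
    have hcont : Continuous fun s => hamField S (unitExtend (Γ z) s) :=
      hf6.continuous.comp (continuous_unitExtend _)
    let c : ℝ → E × (E →L[ℝ] ℝ) := fun t =>
      z + ∫ s in (0 : ℝ)..t, hamField S (unitExtend (Γ z) s)
    have hc1 : ∀ t (ht : t ∈ Icc (0 : ℝ) 1), c t = Γ z ⟨t, ht⟩ := fun t ht => (h1.1 ⟨t, ht⟩).symm
    have hcd : ∀ t, HasDerivAt (fun t => (c t).1) (hamField S (unitExtend (Γ z) t)).1 t :=
      fun t => (ContinuousLinearMap.fst ℝ E (E →L[ℝ] ℝ)).hasFDerivAt.comp_hasDerivAt t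
        (hasDerivAt_add_primitive hcont z t)
    refine ⟨fun t => (c t).1, ?_, ?_, ?_, ?_, ?_⟩
    · rw [contDiff_one_iff_deriv]
      refine ⟨fun t => (hcd t).differentiableAt, ?_⟩
      rw [funext fun t => (hcd t).deriv]
      exact continuous_fst.comp hcont
    · intro t ht
      simp only [hc1 t ht]
      exact h2 _
    · have h4 : c 0 = z := by simp [c]
      simp only [h4, hz, hι, conormalData_fst]
      exact map_kerProj he _
    · simp only [hc1 1 (by simp)]
      exact h3
    · intro t ht
      refine ⟨(Γ z ⟨t, ht⟩).2, ?_, ?_⟩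
      · rw [(hcd t).deriv, unitExtend_of_mem _ ht]
        simp only [hc1 t ht]
        rfl
      · simp only [hc1 t ht]
        exact h1.2.1 ⟨t, ht⟩

end EikonalSolution

/-! ### Normal form of solutions of the eikonal equation -/

section NormalForm

variable {E : Type*} [NormedAddCommGroup E] [NormedSpace ℂ E]

/-- Hadamard's lemma for real functions. -/
theorem exists_eq_re_mul [FiniteDimensional ℂ E] {ℓ : E →L[ℂ] ℂ} {e : E} (he : ℓ e = 1)
    {n : ℕ} {f : E → ℝ} (hf : ContDiffAt ℝ (n + 1 : ℕ) f 0)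
    (h0 : ∀ᶠ y in 𝓝 (0 : E), ℓ y = 0 → f y = 0) :
    ∃ a : E → ℂ, ContDiffAt ℝ n a 0 ∧ ∀ᶠ y in 𝓝 (0 : E), f y = (ℓ y * a y).re := by
  obtain ⟨a, b, ha, hb, hab⟩ := exists_eq_mul_add_conj_mul he (n := n) (f := fun y => (f y : ℂ))
    (Complex.ofRealCLM.contDiff.contDiffAt.comp 0 hf) (h0.mono fun y hy h => by simp [hy h])
  refine ⟨fun y => a y + starRingEnd ℂ (b y),
    ha.add ((Complex.conjCLE : ℂ →L[ℝ] ℂ).contDiff.contDiffAt.comp 0 hb), ?_⟩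
  filter_upwards [hab] with y hy
  have := congrArg Complex.re hy
  simp at this ⊢
  linarith

/-- The differential of `Re (ℓᵏ a) + |ℓ|² b`, split into its part along `ℓ` and the contribution of the
derivatives of `a` and `b`, which is of higher order in `ℓ`. -/
theorem hasFDerivAt_normalForm (ℓ : E →L[ℂ] ℂ) {a : E → ℂ} {b : E → ℝ} {x : E}
    (ha : DifferentiableAt ℝ a x) (hb : DifferentiableAt ℝ b x) (k : ℕ) :
    HasFDerivAt (fun x => (ℓ x ^ k * a x).re + ‖ℓ x‖ ^ 2 * b x)
      (reCovector ℓ (k * ℓ x ^ (k - 1) * a x + 2 * starRingEnd ℂ (ℓ x) * b x) +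
        (Complex.reCLM.comp ((ℓ x ^ k) • fderiv ℝ a x) + (‖ℓ x‖ ^ 2) • fderiv ℝ b x)) x := by
  have hℓ : HasFDerivAt (fun x => ℓ x) (ℓ.restrictScalars ℝ) x :=
    (ℓ.restrictScalars ℝ).hasFDerivAt
  have h1 : HasFDerivAt (fun x => ℓ x ^ k) ((k * ℓ x ^ (k - 1)) • ℓ.restrictScalars ℝ) x := by
    have := (hasDerivAt_pow k (ℓ x)).hasFDerivAt.restrictScalars ℝ |>.comp x hℓ
    refine this.congr_fderiv ?_
    ext v
    simp [mul_comm]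
  have h2 := Complex.reCLM.hasFDerivAt.comp x (h1.mul ha.hasFDerivAt)
  have h3 : HasFDerivAt (fun x => ‖ℓ x‖ ^ 2) (2 • (innerSL ℝ (ℓ x)).comp (ℓ.restrictScalars ℝ)) x :=
    hℓ.norm_sq
  have h4 := h2.add (h3.mul hb.hasFDerivAt)
  refine h4.congr_fderiv ?_
  ext v
  simp [Complex.inner]
  ring

theorem IsHermitianCometric.apply_add {A : (E →L[ℝ] ℝ) →L[ℝ] E}
    (hA : IsHermitianCometric A) (ℓ : E →L[ℂ] ℂ) (ζ : ℂ) (R : E →L[ℝ] ℝ) :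
    (reCovector ℓ ζ + R) (A (reCovector ℓ ζ + R)) =
      ‖ζ‖ ^ 2 * (ℓ (A (reCovector ℓ 1))).re + 2 * R (A (reCovector ℓ ζ)) + R (A R) := by
  rw [map_add, add_apply, map_add, map_add, hA.reCovector_apply_reCovector, hA.symm _ R]
  ring

theorem eq_of_eventually_eq_ne {f g : ℝ → ℝ} (hf : ContinuousAt f 0) (hg : ContinuousAt g 0)
    (h : ∀ᶠ r in 𝓝 (0 : ℝ), r ≠ 0 → f r = g r) : f 0 = g 0 := by
  have h1 : f =ᶠ[𝓝[≠] (0 : ℝ)] g := eventually_nhdsWithin_iff.2 h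
  exact tendsto_nhds_unique (hf.tendsto.mono_left nhdsWithin_le_nhds |>.congr' h1)
    (hg.tendsto.mono_left nhdsWithin_le_nhds)

variable {S : E → (E →L[ℝ] ℝ) →L[ℝ] E}

/-- The eikonal equation for `Re (ℓᵏ a) + |ℓ|² b`, in expanded form. -/
theorem eikonal_expand {ℓ : E →L[ℂ] ℂ} {q : E → ℝ} {a : E → ℂ} {b : E → ℝ} {k : ℕ} {x : E}
    (hA : IsHermitianCometric (S x)) (hq : fderiv ℝ q x (S x (fderiv ℝ q x)) = 4 * q x)
    (hab : ∀ᶠ x in 𝓝 x, q x = (ℓ x ^ k * a x).re + ‖ℓ x‖ ^ 2 * b x)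
    (ha : DifferentiableAt ℝ a x) (hb : DifferentiableAt ℝ b x) :
    ‖k * ℓ x ^ (k - 1) * a x + 2 * starRingEnd ℂ (ℓ x) * b x‖ ^ 2 *
        (ℓ (S x (reCovector ℓ 1))).re +
      2 * (Complex.reCLM.comp ((ℓ x ^ k) • fderiv ℝ a x) + (‖ℓ x‖ ^ 2) • fderiv ℝ b x)
        (S x (reCovector ℓ (k * ℓ x ^ (k - 1) * a x + 2 * starRingEnd ℂ (ℓ x) * b x))) +
      (Complex.reCLM.comp ((ℓ x ^ k) • fderiv ℝ a x) + (‖ℓ x‖ ^ 2) • fderiv ℝ b x)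
        (S x (Complex.reCLM.comp ((ℓ x ^ k) • fderiv ℝ a x) + (‖ℓ x‖ ^ 2) • fderiv ℝ b x)) =
      4 * ((ℓ x ^ k * a x).re + ‖ℓ x‖ ^ 2 * b x) := by
  have h1 := ((hasFDerivAt_normalForm ℓ ha hb k).congr_of_eventuallyEq hab).fderiv
  rw [h1, hA.apply_add, hab.self_of_nhds] at hq
  exact hq

theorem tendsto_ray (y e : E) (σ : ℂ) :
    Filter.Tendsto (fun r : ℝ => y + ((r : ℂ) * σ) • e) (𝓝 0) (𝓝 y) := by
  have h : Continuous fun r : ℝ => y + ((r : ℂ) * σ) • e := by fun_prop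
  simpa using h.tendsto 0

/-- The complex coefficient of `ℓ` in the differential of `Re (ℓᵐ⁺² a) + |ℓ|² b` at
`y + r σ e`, divided by `r`. -/
noncomputable def rayCoeff (m : ℕ) (e : E) (a : E → ℂ) (b : E → ℝ) (y : E) (σ : ℂ) (r : ℝ) : ℂ :=
  (m + 2) * r ^ m * σ ^ (m + 1) * a (y + ((r : ℂ) * σ) • e) +
    2 * starRingEnd ℂ σ * b (y + ((r : ℂ) * σ) • e)

/-- The remaining part of the differential of `Re (ℓᵐ⁺² a) + |ℓ|² b` at
`y + r σ e`, divided by `r²`. -/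
noncomputable def rayRest (m : ℕ) (e : E) (a : E → ℂ) (b : E → ℝ) (y : E) (σ : ℂ) (r : ℝ) :
    E →L[ℝ] ℝ :=
  r ^ m • Complex.reCLM.comp ((σ ^ (m + 2)) • fderiv ℝ a (y + ((r : ℂ) * σ) • e)) +
    (‖σ‖ ^ 2) • fderiv ℝ b (y + ((r : ℂ) * σ) • e)

/-- The eikonal equation for `Re (ℓᵐ⁺² a) + |ℓ|² b` at the point `y + r σ e`, divided by `r²`. -/
theorem eikonal_ray {ℓ : E →L[ℂ] ℂ} {e : E} (he : ℓ e = 1) {q : E → ℝ} {a : E → ℂ}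
    {b : E → ℝ} {y : E} (hy : ℓ y = 0) (m : ℕ)
    (hA : ∀ᶠ x in 𝓝 y, IsHermitianCometric (S x))
    (hq : ∀ᶠ x in 𝓝 y, fderiv ℝ q x (S x (fderiv ℝ q x)) = 4 * q x)
    (hab : ∀ᶠ x in 𝓝 y, q x = (ℓ x ^ (m + 2) * a x).re + ‖ℓ x‖ ^ 2 * b x)
    (ha : ContDiffAt ℝ 1 a y) (hb : ContDiffAt ℝ 1 b y) (σ : ℂ) :
    ∀ᶠ r : ℝ in 𝓝 (0 : ℝ), r ≠ 0 → ∀ x, x = y + ((r : ℂ) * σ) • e →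
      ‖rayCoeff m e a b y σ r‖ ^ 2 * (ℓ (S x (reCovector ℓ 1))).re +
        2 * r * rayRest m e a b y σ r (S x (reCovector ℓ (rayCoeff m e a b y σ r))) +
        r ^ 2 * rayRest m e a b y σ r (S x (rayRest m e a b y σ r)) =
      4 * (r ^ m * (σ ^ (m + 2) * a x).re + ‖σ‖ ^ 2 * b x) := by
  have hray := tendsto_ray y e σ
  have hae := (ha.eventually (by simp)).mono fun x hx => hx.differentiableAt one_ne_zero
  have hbe := (hb.eventually (by simp)).mono fun x hx => hx.differentiableAt one_ne_zero
  filter_upwards [hray.eventually hA, hray.eventually hq, hray.eventually hab.eventually_nhds,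
      hray.eventually hae, hray.eventually hbe] with r h1 h2 h3 h4 h5 hr x hx
  have h6 := eikonal_expand h1 h2 h3 h4 h5
  have hℓx : ℓ (y + ((r : ℂ) * σ) • e) = r * σ := by simp [hy, he]
  rw [hℓx] at h6
  have hL : ((m + 2 : ℕ) : ℂ) * ((r : ℂ) * σ) ^ (m + 2 - 1) * a (y + ((r : ℂ) * σ) • e) +
      2 * starRingEnd ℂ ((r : ℂ) * σ) * b (y + ((r : ℂ) * σ) • e) =
      r • rayCoeff m e a b y σ r := by
    rw [show m + 2 - 1 = m + 1 from rfl]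
    simp [rayCoeff]
    ring
  have hR : Complex.reCLM.comp ((((r : ℂ) * σ) ^ (m + 2)) • fderiv ℝ a (y + ((r : ℂ) * σ) • e)) +
      (‖(r : ℂ) * σ‖ ^ 2) • fderiv ℝ b (y + ((r : ℂ) * σ) • e) =
        (r ^ 2) • rayRest m e a b y σ r := by
    ext v
    simp only [rayRest, add_apply, smul_apply, ContinuousLinearMap.comp_apply,
      Complex.reCLM_apply, smul_eq_mul, norm_mul, Complex.norm_real, Real.norm_eq_abs, mul_pow,
      sq_abs]
    rw [← Complex.ofReal_pow, mul_assoc, Complex.re_ofReal_mul]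
    ring
  rw [hL, hR] at h6
  subst hx
  generalize rayCoeff m e a b y σ r = Λ at *
  generalize rayRest m e a b y σ r = R at *
  have hre : (((r : ℂ) * σ) ^ (m + 2) * a (y + ((r : ℂ) * σ) • e)).re =
      r ^ (m + 2) * (σ ^ (m + 2) * a (y + ((r : ℂ) * σ) • e)).re := by
    rw [mul_pow, ← Complex.ofReal_pow, mul_assoc, Complex.re_ofReal_mul]
  rw [hre] at h6
  simp only [norm_smul, norm_mul, Complex.norm_real, Real.norm_eq_abs, mul_pow, sq_abs,
    map_smul, smul_apply, smul_eq_mul] at h6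
  have hr2 : r ^ 2 ≠ 0 := pow_ne_zero 2 hr
  apply mul_left_cancel₀ hr2
  linear_combination h6

theorem continuousAt_ray {F : Type*} [TopologicalSpace F] {f : E → F} {y : E}
    (hf : ContinuousAt f y) (e : E) (σ : ℂ) :
    ContinuousAt (fun r : ℝ => f (y + ((r : ℂ) * σ) • e)) 0 := by
  refine ContinuousAt.comp (g := f) (f := fun r : ℝ => y + ((r : ℂ) * σ) • e) (by simpa) ?_
  have h : Continuous fun r : ℝ => y + ((r : ℂ) * σ) • e := by fun_prop
  exact h.continuousAt

theorem continuousAt_rayCoeff (m : ℕ) (e : E) {a : E → ℂ} {b : E → ℝ} {y : E}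
    (ha : ContDiffAt ℝ 1 a y) (hb : ContDiffAt ℝ 1 b y) (σ : ℂ) :
    ContinuousAt (rayCoeff m e a b y σ) 0 := by
  have h1 := continuousAt_ray ha.continuousAt e σ
  have h2 := Complex.continuous_ofReal.continuousAt.comp (continuousAt_ray hb.continuousAt e σ)
  have h3 : ContinuousAt (fun r : ℝ => ((m : ℂ) + 2) * r ^ m * σ ^ (m + 1)) 0 := by
    have : Continuous (fun r : ℝ => ((m : ℂ) + 2) * r ^ m * σ ^ (m + 1)) := by fun_prop
    exact this.continuousAt
  exact (h3.mul h1).add (continuousAt_const.mul h2)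

theorem continuousAt_rayRest (m : ℕ) (e : E) {a : E → ℂ} {b : E → ℝ} {y : E}
    (ha : ContDiffAt ℝ 1 a y) (hb : ContDiffAt ℝ 1 b y) (σ : ℂ) :
    ContinuousAt (rayRest m e a b y σ) 0 := by
  have hac' := continuousAt_ray (ha.fderiv_right (m := 0) (by norm_num)).continuousAt e σ
  have hbc' := continuousAt_ray (hb.fderiv_right (m := 0) (by norm_num)).continuousAt e σ
  have h1 := hac'.const_smul (σ ^ (m + 2))
  have h2 := hbc'.const_smul (‖σ‖ ^ 2)
  have h3 := (continuousAt_const (y := Complex.reCLM)).clm_comp h1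
  have h4 : ContinuousAt (fun r : ℝ => r ^ m) 0 := (continuous_pow m).continuousAt
  exact (h4.smul h3).add h2

/-- Second order comparison in the eikonal equation, obtained from `r → 0` in `eikonal_ray`. -/
theorem eikonal_second_order {ℓ : E →L[ℂ] ℂ} {e : E} (he : ℓ e = 1) {q : E → ℝ} {a : E → ℂ}
    {b : E → ℝ} {y : E} (hy : ℓ y = 0) (hS : ContinuousAt S y)
    (hA : ∀ᶠ x in 𝓝 y, IsHermitianCometric (S x))
    (hq : ∀ᶠ x in 𝓝 y, fderiv ℝ q x (S x (fderiv ℝ q x)) = 4 * q x)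
    (hab : ∀ᶠ x in 𝓝 y, q x = (ℓ x ^ 2 * a x).re + ‖ℓ x‖ ^ 2 * b x)
    (ha : ContDiffAt ℝ 1 a y) (hb : ContDiffAt ℝ 1 b y) (σ : ℂ) :
    ‖σ * a y + starRingEnd ℂ σ * b y‖ ^ 2 * (ℓ (S y (reCovector ℓ 1))).re =
      (σ ^ 2 * a y).re + ‖σ‖ ^ 2 * b y := by
  have hΛ := continuousAt_rayCoeff 0 e ha hb σ
  have hR := continuousAt_rayRest 0 e ha hb σ
  have hSc := continuousAt_ray hS e σ
  have key := eq_of_eventually_eq_ne (f := fun r : ℝ =>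
      ‖rayCoeff 0 e a b y σ r‖ ^ 2 * (ℓ (S (y + ((r : ℂ) * σ) • e) (reCovector ℓ 1))).re +
        2 * r * rayRest 0 e a b y σ r
          (S (y + ((r : ℂ) * σ) • e) (reCovector ℓ (rayCoeff 0 e a b y σ r))) +
        r ^ 2 * rayRest 0 e a b y σ r (S (y + ((r : ℂ) * σ) • e) (rayRest 0 e a b y σ r)))
    (g := fun r : ℝ => 4 * (r ^ 0 * (σ ^ (0 + 2) * a (y + ((r : ℂ) * σ) • e)).re +
      ‖σ‖ ^ 2 * b (y + ((r : ℂ) * σ) • e))) ?_ ?_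
    ((eikonal_ray he hy 0 hA hq hab ha hb σ).mono fun r h hr => h hr _ rfl)
  · simp only [rayCoeff, Complex.ofReal_zero, zero_mul, zero_smul, add_zero, mul_zero, pow_zero,
      CharP.cast_eq_zero, zero_add, pow_one, mul_one, one_mul, ne_eq, OfNat.ofNat_ne_zero,
      not_false_eq_true, zero_pow] at key
    have h7 : ‖2 * σ * a y + 2 * starRingEnd ℂ σ * b y‖ ^ 2 =
        4 * ‖σ * a y + starRingEnd ℂ σ * b y‖ ^ 2 := by
      rw [show 2 * σ * a y + 2 * starRingEnd ℂ σ * b y =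
        2 * (σ * a y + starRingEnd ℂ σ * b y) by ring, norm_mul, mul_pow]
      norm_num
    rw [h7] at key
    linarith
  · have h1 := Complex.continuous_re.continuousAt.comp (ℓ.continuous.continuousAt.comp
      (hSc.clm_apply (continuousAt_const (y := reCovector ℓ 1))))
    have h2 := hR.clm_apply (hSc.clm_apply ((reCovector ℓ).continuous.continuousAt.comp hΛ))
    have h3 := hR.clm_apply (hSc.clm_apply hR)
    have h4 : ContinuousAt (fun r : ℝ => 2 * r) 0 := by fun_prop
    have h5 : ContinuousAt (fun r : ℝ => r ^ 2) 0 := by fun_prop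
    exact (((hΛ.norm.pow 2).mul h1).add (h4.mul h2)).add (h5.mul h3)
  · have h1 := Complex.continuous_re.continuousAt.comp ((continuousAt_const (y := σ ^ 2)).mul
      (continuousAt_ray ha.continuousAt e σ))
    have h2 := continuousAt_ray hb.continuousAt e σ
    exact continuousAt_const.mul ((continuousAt_const.mul h1).add (continuousAt_const.mul h2))

end NormalForm

section NormalForm

variable {E : Type*} [NormedAddCommGroup E] [NormedSpace ℂ E]
  {S : E → (E →L[ℝ] ℝ) →L[ℝ] E}

theorem IsHermitianCometric.re_pos {A : (E →L[ℝ] ℝ) →L[ℝ] E} (hA : IsHermitianCometric A)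
    {ℓ : E →L[ℂ] ℂ} {e : E} (he : ℓ e = 1) : 0 < (ℓ (A (reCovector ℓ 1))).re := by
  have h1 : reCovector ℓ 1 ≠ 0 := fun h => by
    have := DFunLike.congr_fun h e
    simp [he] at this
  simpa using hA.pos _ h1

/-- The identities forced by the second order comparison leave only `a = 0` and `h b = 1`, if the
quadratic form `Re (σ² a) + |σ|² b` is definite. -/
theorem eq_zero_of_quadratic_identities {a : ℂ} {b h c : ℝ} (hc : 0 < c) (hh : 0 < h)
    (h1 : ∀ σ : ℂ, ‖σ * a + starRingEnd ℂ σ * b‖ ^ 2 * h = (σ ^ 2 * a).re + ‖σ‖ ^ 2 * b)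
    (h2 : ∀ σ : ℂ, c * ‖σ‖ ^ 2 ≤ (σ ^ 2 * a).re + ‖σ‖ ^ 2 * b) : a = 0 ∧ h * b = 1 := by
  have e1 := h1 1
  have e2 := h1 Complex.I
  have e3 := h1 (1 + Complex.I)
  have e4 := h2 1
  have e5 := h2 Complex.I
  simp only [← Complex.normSq_eq_norm_sq] at e1 e2 e3 e4 e5
  simp only [Complex.normSq_apply, pow_two, Complex.add_re, Complex.add_im, Complex.mul_re, Complex.mul_im, Complex.one_re, Complex.one_im, Complex.I_re,
    Complex.I_im, map_add, map_one, Complex.conj_I, Complex.neg_re, Complex.neg_im,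
    Complex.ofReal_re, Complex.ofReal_im] at e1 e2 e3 e4 e5
  obtain ⟨σ, hσ⟩ := IsAlgClosed.exists_pow_nat_eq (-(starRingEnd ℂ a)) (n := 2) (by norm_num)
  have e6 := h2 σ
  have hσn : ‖σ‖ ^ 2 = ‖a‖ := by rw [← norm_pow, hσ, norm_neg, RCLike.norm_conj]
  have hn : ‖a‖ ^ 2 = a.re ^ 2 + a.im ^ 2 := by
    rw [← Complex.normSq_eq_norm_sq, Complex.normSq_apply]; ring
  rw [hσ, hσn, neg_mul, ← Complex.normSq_eq_conj_mul_self, Complex.neg_re, Complex.ofReal_re,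
    Complex.normSq_eq_norm_sq] at e6
  have f1 : 2 * h * b * a.re = a.re := by linarith
  have f2 : h * (a.re ^ 2 + a.im ^ 2 + b ^ 2) = b := by linarith
  have f3 : 2 * h * b * a.im = a.im := by nlinarith
  have hb : 0 < b := by linarith
  have ha : a = 0 := by
    by_contra hne
    have hpos : 0 < ‖a‖ := norm_pos_iff.2 hne
    have f4 : 2 * h * b = 1 := by
      by_contra hcon
      have hre : a.re = 0 := by
        by_contra h'; exact hcon (mul_right_cancel₀ h' (by rw [f1, one_mul]))
      have him : a.im = 0 := by
        by_contra h'; exact hcon (mul_right_cancel₀ h' (by rw [f3, one_mul]))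
      exact hne (Complex.ext hre him)
    have f5 : ‖a‖ ^ 2 = b ^ 2 := by
      have : h * (‖a‖ ^ 2 - b ^ 2) = 0 := by rw [hn]; nlinarith
      have := (mul_eq_zero.1 this).resolve_left hh.ne'
      linarith
    have f6 : ‖a‖ = b := by
      rw [← Real.sqrt_sq (norm_nonneg a), f5, Real.sqrt_sq hb.le]
    rw [f6] at e6
    nlinarith
  refine ⟨ha, ?_⟩
  rw [ha] at f2
  simp only [Complex.zero_re, Complex.zero_im] at f2
  have : b * (h * b - 1) = 0 := by nlinarith
  have := (mul_eq_zero.1 this).resolve_left hb.ne'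
  linarith

/-- Third order comparison in the eikonal equation: the terms of order `r³` at `y + r σ e` give an
identity between `|σ|²` times a real linear form in `σ`, and `Re (σ³ a y)`. Such an identity
forces `a y = 0`. -/
theorem eikonal_third_order {ℓ : E →L[ℂ] ℂ} {e : E} (he : ℓ e = 1) {q : E → ℝ} {a : E → ℂ}
    {b : E → ℝ} {y : E} (hy : ℓ y = 0) (hS : DifferentiableAt ℝ S y)
    (hA : ∀ᶠ x in 𝓝 y, IsHermitianCometric (S x))
    (hq : ∀ᶠ x in 𝓝 y, fderiv ℝ q x (S x (fderiv ℝ q x)) = 4 * q x)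
    (hab : ∀ᶠ x in 𝓝 y, q x = (ℓ x ^ 3 * a x).re + ‖ℓ x‖ ^ 2 * b x)
    (ha : ContDiffAt ℝ 1 a y) (hb : ContDiffAt ℝ 1 b y)
    (hhb : (ℓ (S y (reCovector ℓ 1))).re * b y = 1) : a y = 0 := by
  let h : E → ℝ := fun x => (ℓ (S x (reCovector ℓ 1))).re
  have hh : DifferentiableAt ℝ h y := by
    have h1 : DifferentiableAt ℝ (fun x => S x (reCovector ℓ 1)) y :=
      hS.clm_apply (differentiableAt_const _)
    exact (Complex.reCLM.comp (ℓ.restrictScalars ℝ)).differentiableAt.comp y h1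
  have hbd : DifferentiableAt ℝ b y := hb.differentiableAt one_ne_zero
  -- the second order terms cancel up to `|ℓ|² κ`, where `κ` vanishes at `y`
  let κ : E → ℝ := fun x => h x * b x ^ 2 - b x
  have hκ : DifferentiableAt ℝ κ y := (hh.mul (hbd.pow 2)).sub hbd
  have hκ0 : κ y = 0 := by
    have : h y * b y = 1 := hhb
    simp only [κ]
    linear_combination b y * this
  have key : ∀ σ : ℂ, ‖σ‖ ^ 2 * (4 * fderiv ℝ κ y (σ • e) +
      4 * b y * fderiv ℝ b y (S y (reCovector ℓ (starRingEnd ℂ σ)))) +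
      8 * (σ ^ 3 * a y).re = 0 := by
    intro σ
    have hΛ := continuousAt_rayCoeff 1 e ha hb σ
    have hR := continuousAt_rayRest 1 e ha hb σ
    have hSc := continuousAt_ray hS.continuousAt e σ
    have hac := continuousAt_ray ha.continuousAt e σ
    have hbc := continuousAt_ray hb.continuousAt e σ
    have hhc := continuousAt_ray hh.continuousAt e σ
    let B : ℝ → ℝ := fun r =>
      (4 - 12 * h (y + ((r : ℂ) * σ) • e) * b (y + ((r : ℂ) * σ) • e)) *
          (σ ^ 3 * a (y + ((r : ℂ) * σ) • e)).re -
        9 * r * h (y + ((r : ℂ) * σ) • e) * ‖σ ^ 2 * a (y + ((r : ℂ) * σ) • e)‖ ^ 2 -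
        2 * rayRest 1 e a b y σ r
          (S (y + ((r : ℂ) * σ) • e) (reCovector ℓ (rayCoeff 1 e a b y σ r))) -
        r * rayRest 1 e a b y σ r (S (y + ((r : ℂ) * σ) • e) (rayRest 1 e a b y σ r))
    have hB : ContinuousAt B 0 := by
      have h2 := hR.clm_apply (hSc.clm_apply ((reCovector ℓ).continuous.continuousAt.comp hΛ))
      have h3 := hR.clm_apply (hSc.clm_apply hR)
      have h4 : ContinuousAt (fun r : ℝ => r) 0 := continuousAt_id
      have h5 := Complex.continuous_re.continuousAt.comp
        ((continuousAt_const (y := σ ^ 3)).mul hac)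
      have h6 := ((continuousAt_const (y := σ ^ 2)).mul hac).norm.pow 2
      exact ((((continuousAt_const.sub ((continuousAt_const.mul hhc).mul hbc)).mul h5).sub
        (((continuousAt_const.mul h4).mul hhc).mul h6)).sub (continuousAt_const.mul h2)).sub
        (h4.mul h3)
    have hslope : Filter.Tendsto (fun r : ℝ => 4 * ‖σ‖ ^ 2 *
        (r⁻¹ • (κ (y + ((r : ℂ) * σ) • e) - κ y))) (𝓝[≠] 0)
        (𝓝 (4 * ‖σ‖ ^ 2 * fderiv ℝ κ y (σ • e))) := by
      have h1 : HasDerivAt (fun r : ℝ => y + ((r : ℂ) * σ) • e) (σ • e) 0 := by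
        have h2 : HasDerivAt (fun r : ℝ => y + r • (σ • e)) ((1 : ℝ) • (σ • e)) 0 :=
          ((hasDerivAt_id (0 : ℝ)).smul_const (σ • e)).const_add y
        rw [one_smul] at h2
        refine h2.congr_of_eventuallyEq (Filter.Eventually.of_forall fun r => ?_)
        simp only [← smul_smul, Complex.coe_smul]
      have h3 : HasFDerivAt κ (fderiv ℝ κ y) (y + (((0 : ℝ) : ℂ) * σ) • e) := by
        simpa using hκ.hasFDerivAt
      have h4 := (h3.comp_hasDerivAt (0 : ℝ) h1).tendsto_slope_zero
      simp only [Function.comp_apply, zero_add, Complex.ofReal_zero, zero_mul, zero_smul,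
        add_zero] at h4
      exact h4.const_mul _
    have heq : (fun r : ℝ => 4 * ‖σ‖ ^ 2 * (r⁻¹ • (κ (y + ((r : ℂ) * σ) • e) - κ y)))
        =ᶠ[𝓝[≠] 0] B := by
      refine eventually_nhdsWithin_iff.2 ?_
      filter_upwards [eikonal_ray he hy 1 hA hq hab ha hb σ] with r hr hr0
      have h1 := hr hr0 _ rfl
      have h2 : ‖rayCoeff 1 e a b y σ r‖ ^ 2 = 4 * ‖σ‖ ^ 2 * b (y + ((r : ℂ) * σ) • e) ^ 2 +
          12 * r * b (y + ((r : ℂ) * σ) • e) * (σ ^ 3 * a (y + ((r : ℂ) * σ) • e)).re +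
          9 * r ^ 2 * ‖σ ^ 2 * a (y + ((r : ℂ) * σ) • e)‖ ^ 2 := by
        rw [rayCoeff]
        generalize a (y + ((r : ℂ) * σ) • e) = a'
        generalize b (y + ((r : ℂ) * σ) • e) = b'
        simp only [← Complex.normSq_eq_norm_sq]
        simp only [Complex.normSq_apply, pow_succ, pow_zero, one_mul,
          Complex.add_re, Complex.add_im, Complex.mul_re, Complex.mul_im, Complex.ofReal_re,
          Complex.ofReal_im, Complex.conj_re, Complex.conj_im, Nat.cast_one, Complex.one_re,
          Complex.one_im, Complex.re_ofNat, Complex.im_ofNat]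
        ring
      have h3 : h (y + ((r : ℂ) * σ) • e) =
        (ℓ (S (y + ((r : ℂ) * σ) • e) (reCovector ℓ 1))).re := rfl
      rw [h2, ← h3] at h1
      rw [hκ0, sub_zero, smul_eq_mul, mul_left_comm, inv_mul_eq_iff_eq_mul₀ hr0]
      simp only [B, κ]
      linear_combination h1
    have hlim := tendsto_nhds_unique (hslope.congr' heq) (hB.tendsto.mono_left nhdsWithin_le_nhds)
    have hB0 : B 0 = -8 * (σ ^ 3 * a y).re -
        4 * ‖σ‖ ^ 2 * b y * fderiv ℝ b y (S y (reCovector ℓ (starRingEnd ℂ σ))) := by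
      have h1 : h y * b y = 1 := hhb
      have h2 : rayCoeff 1 e a b y σ 0 = (2 * b y) • starRingEnd ℂ σ := by
        simp [rayCoeff]
        ring
      have h3 : rayRest 1 e a b y σ 0 = (‖σ‖ ^ 2) • fderiv ℝ b y := by
        simp [rayRest]
      simp only [B, h2, h3, Complex.ofReal_zero, zero_mul, zero_smul, add_zero, mul_zero,
        sub_zero, map_smul, smul_apply, smul_eq_mul]
      linear_combination (-12 * (σ ^ 3 * a y).re) * h1
    rw [hB0] at hlim
    linear_combination hlim
  -- the identity for `σ = 1, i, 1 + i, 1 - i` determines `a y`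
  set M : ℂ → ℝ := fun σ => 4 * fderiv ℝ κ y (σ • e) +
      4 * b y * fderiv ℝ b y (S y (reCovector ℓ (starRingEnd ℂ σ))) with hM
  have hMadd : ∀ σ τ, M (σ + τ) = M σ + M τ := fun σ τ => by
    simp only [hM, add_smul, map_add]
    ring
  have hMsub : ∀ σ τ, M (σ - τ) = M σ - M τ := fun σ τ => by
    simp only [hM, sub_smul, map_sub]
    ring
  have k1 : ‖(1 : ℂ)‖ ^ 2 * M 1 + 8 * ((1 : ℂ) ^ 3 * a y).re = 0 := key 1
  have k2 : ‖Complex.I‖ ^ 2 * M Complex.I + 8 * (Complex.I ^ 3 * a y).re = 0 := key Complex.I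
  have k3 : ‖1 + Complex.I‖ ^ 2 * M (1 + Complex.I) + 8 * ((1 + Complex.I) ^ 3 * a y).re = 0 :=
    key (1 + Complex.I)
  have k4 : ‖1 - Complex.I‖ ^ 2 * M (1 - Complex.I) + 8 * ((1 - Complex.I) ^ 3 * a y).re = 0 :=
    key (1 - Complex.I)
  rw [hMadd] at k3
  rw [hMsub] at k4
  simp only [← Complex.normSq_eq_norm_sq] at k1 k2 k3 k4
  simp only [Complex.normSq_apply, pow_succ, pow_zero, one_mul, Complex.add_re, Complex.add_im, Complex.sub_re, Complex.sub_im, Complex.mul_re,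
    Complex.mul_im, Complex.one_re, Complex.one_im, Complex.I_re, Complex.I_im] at k1 k2 k3 k4
  apply Complex.ext
  · simp only [Complex.zero_re]
    linarith
  · simp only [Complex.zero_im]
    linarith

end NormalForm

section NormalForm

variable {E : Type*} [NormedAddCommGroup E] [NormedSpace ℂ E]
  {S : E → (E →L[ℝ] ℝ) →L[ℝ] E}

/-- The lower bound `c |ℓ|² ≤ q` passes to the quadratic part of `q` at points of `ℓ = 0`. -/
theorem quadratic_lower_bound_of_le {ℓ : E →L[ℂ] ℂ} {e : E} (he : ℓ e = 1) {q : E → ℝ}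
    {a : E → ℂ} {b : E → ℝ} {y : E} (hy : ℓ y = 0) {c : ℝ}
    (hq : ∀ᶠ x in 𝓝 y, c * ‖ℓ x‖ ^ 2 ≤ q x)
    (hab : ∀ᶠ x in 𝓝 y, q x = (ℓ x ^ 2 * a x).re + ‖ℓ x‖ ^ 2 * b x)
    (ha : ContinuousAt a y) (hb : ContinuousAt b y) (σ : ℂ) :
    c * ‖σ‖ ^ 2 ≤ (σ ^ 2 * a y).re + ‖σ‖ ^ 2 * b y := by
  have h1 : ContinuousAt (fun r : ℝ => (σ ^ 2 * a (y + ((r : ℂ) * σ) • e)).re +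
      ‖σ‖ ^ 2 * b (y + ((r : ℂ) * σ) • e)) 0 :=
    (Complex.continuous_re.continuousAt.comp ((continuousAt_const (y := σ ^ 2)).mul
      (continuousAt_ray ha e σ))).add
      ((continuousAt_const (y := ‖σ‖ ^ 2)).mul (continuousAt_ray hb e σ))
  have h2 := h1.tendsto.mono_left (nhdsWithin_le_nhds (s := {0}ᶜ))
  simp only [Complex.ofReal_zero, zero_mul, zero_smul, add_zero] at h2
  refine ge_of_tendsto h2 (eventually_nhdsWithin_iff.2 ?_)
  filter_upwards [(tendsto_ray y e σ).eventually hq, (tendsto_ray y e σ).eventually hab]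
    with r h3 h4 hr
  have hr2 : 0 < r ^ 2 := by have : r ≠ 0 := hr; positivity
  have hℓx : ℓ (y + ((r : ℂ) * σ) • e) = r * σ := by simp [hy, he]
  rw [h4, hℓx, norm_mul, Complex.norm_real, Real.norm_eq_abs, mul_pow, mul_pow, sq_abs,
    ← Complex.ofReal_pow, mul_assoc, Complex.re_ofReal_mul] at h3
  refine le_of_mul_le_mul_left ?_ hr2
  linarith

theorem re_pow_succ_mul_conj_mul (z w : ℂ) (m : ℕ) :
    (z ^ (m + 1) * (starRingEnd ℂ z * w)).re = ‖z‖ ^ 2 * (z ^ m * w).re := by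
  rw [← Complex.normSq_eq_norm_sq, ← Complex.re_ofReal_mul, Complex.normSq_eq_conj_mul_self]
  ring_nf

/-- A nonnegative solution of the eikonal equation vanishing on `ℓ = 0` is, up to a remainder
`Re (ℓ⁴ c)`, the product of `|ℓ|²` and a positive function: the first and second order terms are
determined by the metric, and there is no term `Re (ℓ³ a)`. -/
theorem eikonal_normalForm [FiniteDimensional ℂ E] {ℓ : E →L[ℂ] ℂ} {e : E} (he : ℓ e = 1)
    {q : E → ℝ} (hS : ContDiff ℝ 1 S) (hA : ∀ᶠ x in 𝓝 (0 : E), IsHermitianCometric (S x))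
    (hqs : ContDiffAt ℝ 6 q 0)
    (hq : ∀ᶠ x in 𝓝 (0 : E), fderiv ℝ q x (S x (fderiv ℝ q x)) = 4 * q x)
    (hq0 : ∀ᶠ x in 𝓝 (0 : E), ℓ x = 0 → q x = 0)
    (hqc : ∃ c > 0, ∀ᶠ x in 𝓝 (0 : E), c * ‖ℓ x‖ ^ 2 ≤ q x) :
    ∃ (b : E → ℝ) (c : E → ℂ), ContDiffAt ℝ 2 b 0 ∧ ContDiffAt ℝ 2 c 0 ∧ 0 < b 0 ∧
      ∀ᶠ x in 𝓝 (0 : E), q x = ‖ℓ x‖ ^ 2 * b x + (ℓ x ^ 4 * c x).re := by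
  obtain ⟨k, hk, hqk⟩ := hqc
  have hSd : Differentiable ℝ S := hS.differentiable one_ne_zero
  have hconj : ContDiff ℝ ω (starRingEnd ℂ) := (Complex.conjCLE : ℂ →L[ℝ] ℂ).contDiff
  have hre : ContDiff ℝ ω Complex.re := Complex.reCLM.contDiff
  have hℓ : ContDiff ℝ ω ℓ := (ℓ.restrictScalars ℝ).contDiff
  -- `q = Re (ℓ a0)`, and the eikonal equation on `ℓ = 0` gives `a0 = 0` there
  obtain ⟨a0, ha0, hqa0⟩ := exists_eq_re_mul he (n := 5) hqs hq0
  have ha0d : ∀ᶠ x in 𝓝 (0 : E), DifferentiableAt ℝ a0 x :=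
    (ha0.eventually (by simp)).mono fun x hx => hx.differentiableAt (by norm_num)
  have hv0 : ∀ᶠ y in 𝓝 (0 : E), ℓ y = 0 → a0 y = 0 := by
    filter_upwards [hA, hq, hqa0.eventually_nhds, ha0d] with y h1 h2 h3 h4 hy
    have h5 := eikonal_expand (k := 1) (b := fun _ => 0) h1 h2
      (h3.mono fun x hx => by simpa using hx) h4 (differentiableAt_const _)
    simp only [hy, Nat.cast_one, one_mul, map_zero, mul_zero, zero_mul, add_zero, pow_one,
      norm_zero, zero_smul, ContinuousLinearMap.comp_zero, zero_apply, Nat.sub_self, pow_zero,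
      Complex.zero_re, ne_eq, OfNat.ofNat_ne_zero, not_false_eq_true, zero_pow] at h5
    simpa [(h1.re_pos he).ne'] using h5
  -- `q = Re (ℓ² a) + |ℓ|² Re β`, with `a = 0` and `h Re β = 1` on `ℓ = 0`
  obtain ⟨a, β, ha, hβ, haβ⟩ := exists_eq_mul_add_conj_mul he (n := 4) ha0 hv0
  have hb : ContDiffAt ℝ 4 (fun x => (β x).re) 0 :=
    (hre.of_le le_top).contDiffAt.comp 0 hβ
  have hab : ∀ᶠ x in 𝓝 (0 : E), q x = (ℓ x ^ 2 * a x).re + ‖ℓ x‖ ^ 2 * (β x).re := by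
    filter_upwards [hqa0, haβ] with x h1 h2
    have h3 := re_pow_succ_mul_conj_mul (ℓ x) (β x) 0
    rw [h1, h2, mul_add, Complex.add_re]
    simp only [zero_add, pow_one, pow_zero, one_mul] at h3
    rw [h3, ← mul_assoc, ← pow_two]
  have hv1 : ∀ᶠ y in 𝓝 (0 : E), ℓ y = 0 →
      a y = 0 ∧ (ℓ (S y (reCovector ℓ 1))).re * (β y).re = 1 := by
    filter_upwards [hA.eventually_nhds, hq.eventually_nhds, hab.eventually_nhds,
      hqk.eventually_nhds, ha.eventually (by simp), hb.eventually (by simp)]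
      with y h1 h2 h3 h4 h5 h6 hy
    exact eq_zero_of_quadratic_identities hk (h1.self_of_nhds.re_pos he)
      (fun σ => eikonal_second_order he hy hS.continuous.continuousAt h1 h2 h3
        (h5.of_le (by norm_num)) (h6.of_le (by norm_num)) σ)
      (fun σ => quadratic_lower_bound_of_le he hy h4 h3 h5.continuousAt h6.continuousAt σ)
  -- `q = Re (ℓ³ a1) + |ℓ|² (…)`, with `a1 = 0` on `ℓ = 0`
  obtain ⟨a1, a2, ha1, ha2, ha12⟩ := exists_eq_mul_add_conj_mul he (n := 3) ha
    (hv1.mono fun y h hy => (h hy).1)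
  have hb' : ContDiffAt ℝ 3 (fun x => (β x).re + (ℓ x * a2 x).re) 0 :=
    (hb.of_le (by norm_num)).add ((hre.of_le le_top).contDiffAt.comp 0
      ((hℓ.of_le le_top).contDiffAt.mul ha2))
  have hab' : ∀ᶠ x in 𝓝 (0 : E), q x =
      (ℓ x ^ 3 * a1 x).re + ‖ℓ x‖ ^ 2 * ((β x).re + (ℓ x * a2 x).re) := by
    filter_upwards [hab, ha12] with x h1 h2
    have h3 := re_pow_succ_mul_conj_mul (ℓ x) (a2 x) 1
    rw [h1, h2, mul_add, Complex.add_re, h3, ← mul_assoc, ← pow_succ, pow_one]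
    ring
  have hv2 : ∀ᶠ y in 𝓝 (0 : E), ℓ y = 0 → a1 y = 0 := by
    filter_upwards [hA.eventually_nhds, hq.eventually_nhds, hab'.eventually_nhds,
      hv1, ha1.eventually (by simp), hb'.eventually (by simp)]
      with y h1 h2 h3 h4 h5 h6 hy
    refine eikonal_third_order he hy hSd.differentiableAt h1 h2 h3 (h5.of_le (by norm_num))
      (h6.of_le (by norm_num)) ?_
    simpa [hy] using (h4 hy).2
  obtain ⟨c1, c2, hc1, hc2, hc12⟩ := exists_eq_mul_add_conj_mul he (n := 2) ha1 hv2
  refine ⟨fun x => (β x).re + (ℓ x * a2 x).re + (ℓ x ^ 2 * c2 x).re, c1,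
    (hb'.of_le (by norm_num)).add ((hre.of_le le_top).contDiffAt.comp 0
      (((hℓ.of_le le_top).contDiffAt.pow 2).mul hc2)), hc1, ?_, ?_⟩
  · have h1 := (hv1.self_of_nhds (map_zero ℓ)).2
    have h2 := hA.self_of_nhds.re_pos he
    simp only [map_zero, zero_mul, ne_eq, OfNat.ofNat_ne_zero, not_false_eq_true, zero_pow,
      Complex.zero_re, add_zero]
    by_contra h
    nlinarith
  · filter_upwards [hab', hc12] with x h1 h2
    have h3 := re_pow_succ_mul_conj_mul (ℓ x) (c2 x) 2
    rw [h1, h2, mul_add (ℓ x ^ 3), Complex.add_re, h3, ← mul_assoc, ← pow_succ]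
    ring

end NormalForm

/-! ### Second order jets of curves -/

section Jets

variable {F G : Type*} [NormedAddCommGroup F] [NormedSpace ℝ F] [NormedAddCommGroup G]
  [NormedSpace ℝ G]

/-- The curve `c` has value `c₀`, first derivative `c₁` and second derivative `c₂` at time `0`. -/
def HasJet (c : ℝ → F) (c₀ c₁ c₂ : F) : Prop :=
  c 0 = c₀ ∧ ∃ c' : ℝ → F, (∀ᶠ t in 𝓝 0, HasDerivAt c (c' t) t) ∧ c' 0 = c₁ ∧ HasDerivAt c' c₂ 0

variable {c d : ℝ → F} {c₀ c₁ c₂ d₀ d₁ d₂ : F}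

theorem HasJet.continuousAt (h : HasJet c c₀ c₁ c₂) : ContinuousAt c 0 := by
  obtain ⟨-, c', h1, -⟩ := h
  exact h1.self_of_nhds.continuousAt

theorem HasJet.tendsto (h : HasJet c c₀ c₁ c₂) : Filter.Tendsto c (𝓝 0) (𝓝 c₀) := by
  have := h.continuousAt.tendsto
  rwa [h.1] at this

theorem HasJet.congr (h : HasJet c c₀ c₁ c₂) (hd : d =ᶠ[𝓝 0] c) : HasJet d c₀ c₁ c₂ := by
  obtain ⟨h0, c', h1, h2, h3⟩ := h
  refine ⟨hd.self_of_nhds.trans h0, c', ?_, h2, h3⟩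
  filter_upwards [h1, hd.eventually_nhds] with t h4 h5
  exact h4.congr_of_eventuallyEq h5

theorem HasJet.unique (h : HasJet c c₀ c₁ c₂) (h' : HasJet c d₀ d₁ d₂) :
    c₁ = d₁ ∧ c₂ = d₂ := by
  obtain ⟨h0, c', h1, h2, h3⟩ := h
  obtain ⟨k0, d', k1, k2, k3⟩ := h'
  have h4 : c' =ᶠ[𝓝 0] d' := by
    filter_upwards [h1, k1] with t h5 h6 using h5.unique h6
  exact ⟨by rw [← h2, ← k2, h4.self_of_nhds], h3.unique (k3.congr_of_eventuallyEq h4)⟩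

theorem HasJet.of_eq (h : HasJet c c₀ c₁ c₂) (h0 : c₀ = d₀) (h1 : c₁ = d₁) (h2 : c₂ = d₂) :
    HasJet c d₀ d₁ d₂ := by
  subst h0 h1 h2
  exact h

theorem hasJet_const (x : F) : HasJet (fun _ => x) x 0 0 :=
  ⟨rfl, fun _ => 0, Filter.Eventually.of_forall fun t => hasDerivAt_const t x, rfl,
    hasDerivAt_const _ _⟩

theorem hasJet_line (y v : F) : HasJet (fun t : ℝ => y + t • v) y v 0 := by
  refine ⟨by simp, fun _ => v, Filter.Eventually.of_forall fun t => ?_, rfl, hasDerivAt_const _ _⟩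
  simpa using ((hasDerivAt_id t).smul_const v).const_add y

theorem HasJet.add (h : HasJet c c₀ c₁ c₂) (h' : HasJet d d₀ d₁ d₂) :
    HasJet (fun t => c t + d t) (c₀ + d₀) (c₁ + d₁) (c₂ + d₂) := by
  obtain ⟨h0, c', h1, h2, h3⟩ := h
  obtain ⟨k0, d', k1, k2, k3⟩ := h'
  refine ⟨by simp [h0, k0], fun t => c' t + d' t, ?_, by simp [h2, k2], h3.add k3⟩
  filter_upwards [h1, k1] with t h5 h6 using h5.add h6

theorem HasJet.sum {ι : Type*} (s : Finset ι) {c : ι → ℝ → F} {c₀ c₁ c₂ : ι → F}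
    (h : ∀ i ∈ s, HasJet (c i) (c₀ i) (c₁ i) (c₂ i)) :
    HasJet (fun t => ∑ i ∈ s, c i t) (∑ i ∈ s, c₀ i) (∑ i ∈ s, c₁ i) (∑ i ∈ s, c₂ i) := by
  classical
  induction s using Finset.induction_on with
  | empty => simpa using hasJet_const (0 : F)
  | insert i s hi ih =>
    simp only [Finset.sum_insert hi]
    exact (h i (Finset.mem_insert_self i s)).add
      (ih fun j hj => h j (Finset.mem_insert_of_mem hj))

theorem HasJet.clm (h : HasJet c c₀ c₁ c₂) (L : F →L[ℝ] G) :
    HasJet (fun t => L (c t)) (L c₀) (L c₁) (L c₂) := by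
  obtain ⟨h0, c', h1, h2, h3⟩ := h
  refine ⟨by simp [h0], fun t => L (c' t), ?_, by simp [h2], L.hasFDerivAt.comp_hasDerivAt 0 h3⟩
  filter_upwards [h1] with t h5 using L.hasFDerivAt.comp_hasDerivAt t h5

theorem HasJet.mul {A : Type*} [NormedRing A] [NormedAlgebra ℝ A] {c d : ℝ → A}
    {c₀ c₁ c₂ d₀ d₁ d₂ : A} (h : HasJet c c₀ c₁ c₂) (h' : HasJet d d₀ d₁ d₂) :
    HasJet (fun t => c t * d t) (c₀ * d₀) (c₁ * d₀ + c₀ * d₁)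
      (c₂ * d₀ + c₁ * d₁ + (c₁ * d₁ + c₀ * d₂)) := by
  obtain ⟨h0, c', h1, h2, h3⟩ := h
  obtain ⟨k0, d', k1, k2, k3⟩ := h'
  subst h0 k0 h2 k2
  refine ⟨rfl, fun t => c' t * d t + c t * d' t, ?_, rfl, ?_⟩
  · filter_upwards [h1, k1] with t h5 h6 using h5.mul h6
  · exact (h3.mul k1.self_of_nhds).add (h1.self_of_nhds.mul k3)

/-- Composition with a function of one real or complex variable. -/
theorem HasJet.scomp {𝕜 : Type*} [RCLike 𝕜] {c : ℝ → 𝕜} {c₀ c₁ c₂ : 𝕜}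
    (h : HasJet c c₀ c₁ c₂) {φ φ' : 𝕜 → 𝕜} {d : 𝕜} (hφ : ∀ᶠ s in 𝓝 c₀, HasDerivAt φ (φ' s) s)
    (hφ' : HasDerivAt φ' d c₀) :
    HasJet (fun t => φ (c t)) (φ c₀) (c₁ * φ' c₀) (c₂ * φ' c₀ + c₁ * (c₁ * d)) := by
  have ht := h.tendsto
  obtain ⟨h0, c', h1, h2, h3⟩ := h
  subst h0 h2
  refine ⟨rfl, fun t => c' t * φ' (c t), ?_, rfl, ?_⟩
  · filter_upwards [h1, ht.eventually hφ] with t h5 h6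
    exact h6.scomp t h5
  · exact h3.mul (hφ'.scomp 0 h1.self_of_nhds)

theorem HasJet.comp (h : HasJet c c₀ c₁ c₂) {u : F → G} (hu : ContDiffAt ℝ 2 u c₀) :
    HasJet (fun t => u (c t)) (u c₀) (fderiv ℝ u c₀ c₁)
      (fderiv ℝ (fderiv ℝ u) c₀ c₁ c₁ + fderiv ℝ u c₀ c₂) := by
  have ht := h.tendsto
  obtain ⟨h0, c', h1, h2, h3⟩ := h
  subst h0 h2
  refine ⟨rfl, fun t => fderiv ℝ u (c t) (c' t), ?_, rfl, ?_⟩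
  · filter_upwards [h1, ht.eventually (hu.eventually (by simp))] with t h5 h6
    exact (h6.differentiableAt (by norm_num)).hasFDerivAt.comp_hasDerivAt t h5
  · have h4 : DifferentiableAt ℝ (fderiv ℝ u) (c 0) :=
      (hu.fderiv_right (m := 1) (by norm_num)).differentiableAt one_ne_zero
    exact (h4.hasFDerivAt.comp_hasDerivAt 0 h1.self_of_nhds).clm_apply h3

theorem ContDiffAt.hasJet_line {u : F → G} {y : F} (hu : ContDiffAt ℝ 2 u y) (v : F) :
    HasJet (fun t : ℝ => u (y + t • v)) (u y) (fderiv ℝ u y v) (fderiv ℝ (fderiv ℝ u) y v v) := by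
  simpa using (_root_.hasJet_line y v).comp hu

theorem HasJet.log {c : ℝ → ℝ} {c₀ c₁ c₂ : ℝ} (h : HasJet c c₀ c₁ c₂) (h0 : c₀ ≠ 0) :
    HasJet (fun t => Real.log (c t)) (Real.log c₀) (c₁ / c₀) (c₂ / c₀ - (c₁ / c₀) ^ 2) := by
  have := h.scomp (φ := Real.log) (φ' := fun s => s⁻¹) (d := -(c₀ ^ 2)⁻¹)
    ((eventually_ne_nhds h0).mono fun s hs => Real.hasDerivAt_log hs)
    (hasDerivAt_inv h0)
  exact this.of_eq rfl (by rw [div_eq_mul_inv]) (by field_simp; ring)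

theorem HasJet.exp {c : ℝ → ℝ} {c₀ c₁ c₂ : ℝ} (h : HasJet c c₀ c₁ c₂) :
    HasJet (fun t => Real.exp (c t)) (Real.exp c₀) (Real.exp c₀ * c₁)
      (Real.exp c₀ * (c₂ + c₁ ^ 2)) := by
  have := h.scomp (φ := Real.exp) (φ' := Real.exp) (d := Real.exp c₀)
    (Filter.Eventually.of_forall fun s => Real.hasDerivAt_exp s) (Real.hasDerivAt_exp _)
  exact this.of_eq rfl (by ring) (by ring)

end Jets

/-! ### The Levi form -/

section LeviForm

variable {E E' : Type*} [NormedAddCommGroup E] [NormedSpace ℂ E] [NormedAddCommGroup E']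
  [NormedSpace ℂ E']

/-- The Levi form of a real function `u` on a complex vector space,
`∑ (∂²u / ∂z_j ∂z̄_k) v_j v̄_k = (D²u(v, v) + D²u(iv, iv)) / 4`. -/
noncomputable def leviForm (u : E → ℝ) (y v : E) : ℝ :=
  (fderiv ℝ (fderiv ℝ u) y v v + fderiv ℝ (fderiv ℝ u) y (Complex.I • v) (Complex.I • v)) / 4

theorem leviForm_congr {u u' : E → ℝ} {y : E} (h : u =ᶠ[𝓝 y] u') (v : E) :
    leviForm u y v = leviForm u' y v := by
  rw [leviForm, leviForm, h.fderiv.fderiv_eq]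

/-- The Levi form can be computed from the second derivatives along the lines in the directions `v`
and `iv`. -/
theorem leviForm_eq_of_hasJet {u : E → ℝ} {y v : E} (hu : ContDiffAt ℝ 2 u y)
    {a a' b b' c c' : ℝ} (h : HasJet (fun t : ℝ => u (y + t • v)) a b c)
    (h' : HasJet (fun t : ℝ => u (y + t • (Complex.I • v))) a' b' c') :
    leviForm u y v = (c + c') / 4 := by
  rw [leviForm, ((hu.hasJet_line v).unique h).2, ((hu.hasJet_line (Complex.I • v)).unique h').2]

theorem ContDiffAt.hasJet_line_complex {u : E → E'} {y : E} (hu : ContDiffAt ℂ 2 u y) (v : E) :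
    HasJet (fun t : ℝ => u (y + t • v)) (u y) (fderiv ℂ u y v)
      (fderiv ℂ (fderiv ℂ u) y v v) := by
  have ht := (_root_.hasJet_line y v).tendsto
  refine ⟨by simp, fun t => fderiv ℂ u (y + t • v) v, ?_, by simp, ?_⟩
  · filter_upwards [ht.eventually (hu.eventually (by simp))] with t h6
    have h1 := (h6.differentiableAt (by norm_num)).hasFDerivAt.restrictScalars ℝ
    have h2 : HasDerivAt (fun t : ℝ => y + t • v) v t := by
      simpa using ((hasDerivAt_id t).smul_const v).const_add y
    exact h1.comp_hasDerivAt t h2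
  · have h4 : DifferentiableAt ℂ (fderiv ℂ u) (y + (0 : ℝ) • v) := by
      simpa using (hu.fderiv_right (m := 1) (by norm_num)).differentiableAt one_ne_zero
    have h1 := h4.hasFDerivAt.restrictScalars ℝ
    have h2 : HasDerivAt (fun t : ℝ => y + t • v) v 0 := by
      simpa using ((hasDerivAt_id (0 : ℝ)).smul_const v).const_add y
    have h3 := h1.comp_hasDerivAt 0 h2
    have h5 := ((ContinuousLinearMap.apply ℂ E' v).restrictScalars ℝ).hasFDerivAt.comp_hasDerivAt 0 h3
    simpa [Function.comp_def] using h5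

theorem ContDiffAt.hasJet_line_I_smul {u : E → E'} {y : E} (hu : ContDiffAt ℂ 2 u y) (v : E) :
    HasJet (fun t : ℝ => u (y + t • (Complex.I • v))) (u y) (Complex.I • fderiv ℂ u y v)
      (-fderiv ℂ (fderiv ℂ u) y v v) := by
  have h := hu.hasJet_line_complex (Complex.I • v)
  simpa [smul_smul] using h

/-- Invariance of the Levi form under holomorphic changes of variables. -/
theorem leviForm_comp {u : E' → ℝ} {τ : E → E'} {y : E} (hu : ContDiffAt ℝ 2 u (τ y))
    (hτ : ContDiffAt ℂ 2 τ y) (v : E) :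
    leviForm (fun x => u (τ x)) y v = leviForm u (τ y) (fderiv ℂ τ y v) := by
  have h1 := (hτ.hasJet_line_complex v).comp hu
  have h2 := (hτ.hasJet_line_I_smul v).comp hu
  have h3 : ContDiffAt ℝ 2 (fun x => u (τ x)) y := hu.comp y (hτ.restrict_scalars ℝ)
  rw [leviForm_eq_of_hasJet h3 h1 h2, leviForm, map_neg]
  ring

theorem leviForm_add {u w : E → ℝ} {y : E} (hu : ContDiffAt ℝ 2 u y) (hw : ContDiffAt ℝ 2 w y)
    (v : E) : leviForm (fun x => u x + w x) y v = leviForm u y v + leviForm w y v := by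
  rw [leviForm_eq_of_hasJet (hu.add hw) ((hu.hasJet_line v).add (hw.hasJet_line v))
    ((hu.hasJet_line _).add (hw.hasJet_line _)), leviForm, leviForm]
  ring

theorem leviForm_const_mul {u : E → ℝ} {y : E} (hu : ContDiffAt ℝ 2 u y) (k : ℝ) (v : E) :
    leviForm (fun x => k * u x) y v = k * leviForm u y v := by
  rw [leviForm_eq_of_hasJet (contDiffAt_const.mul hu) ((hasJet_const k).mul (hu.hasJet_line v))
    ((hasJet_const k).mul (hu.hasJet_line _)), leviForm]
  ring

/-- The second derivatives of a `C²` function are locally bounded. -/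
theorem exists_abs_leviForm_le {u : E → ℝ} {y₀ : E} (hu : ContDiffAt ℝ 2 u y₀) :
    ∃ C, ∀ᶠ y in 𝓝 y₀, ∀ v, |leviForm u y v| ≤ C * ‖v‖ ^ 2 := by
  have h1 : ContinuousAt (fderiv ℝ (fderiv ℝ u)) y₀ :=
    ((hu.fderiv_right (m := 1) (by norm_num)).fderiv_right (m := 0) (by norm_num)).continuousAt
  refine ⟨‖fderiv ℝ (fderiv ℝ u) y₀‖ + 1, ?_⟩
  filter_upwards [h1.norm.eventually_lt_const (lt_add_one _)] with y hy v
  have h2 : ∀ w : E, ‖w‖ = ‖v‖ → |fderiv ℝ (fderiv ℝ u) y w w| ≤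
      (‖fderiv ℝ (fderiv ℝ u) y₀‖ + 1) * ‖v‖ ^ 2 := fun w hw => by
    calc _ ≤ ‖fderiv ℝ (fderiv ℝ u) y‖ * ‖w‖ * ‖w‖ := ContinuousLinearMap.le_opNorm₂ _ _ _
      _ ≤ _ := by rw [hw, mul_assoc, ← pow_two]; gcongr
  have h3 := abs_le.1 (h2 v rfl)
  have h4 := abs_le.1 (h2 (Complex.I • v) (by simp [norm_smul]))
  rw [leviForm, abs_le]
  have : 0 ≤ (‖fderiv ℝ (fderiv ℝ u) y₀‖ + 1) * ‖v‖ ^ 2 := by positivity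
  constructor <;> linarith

theorem HasJet.norm_sq {c : ℝ → ℂ} {c₀ c₁ c₂ : ℂ} (h : HasJet c c₀ c₁ c₂) :
    HasJet (fun t => ‖c t‖ ^ 2) (‖c₀‖ ^ 2) (2 * (starRingEnd ℂ c₀ * c₁).re)
      (2 * ‖c₁‖ ^ 2 + 2 * (starRingEnd ℂ c₀ * c₂).re) := by
  have h1 := ((h.clm (Complex.conjCLE : ℂ →L[ℝ] ℂ)).mul h).clm Complex.reCLM
  have h2 : ∀ z : ℂ, ‖z‖ ^ 2 = (starRingEnd ℂ z * z).re := fun z => by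
    rw [← Complex.normSq_eq_conj_mul_self, Complex.ofReal_re, Complex.normSq_eq_norm_sq]
  simp only [h2]
  refine h1.of_eq rfl ?_ ?_ <;>
  · simp only [Complex.reCLM_apply, ContinuousLinearEquiv.coe_coe, Complex.conjCLE_apply,
      Complex.add_re, Complex.mul_re, Complex.conj_re, Complex.conj_im]
    ring

/-- `log ∑ |f_j|²` is plurisubharmonic for holomorphic `f_j`. -/
theorem leviForm_log_sum_nonneg {ι : Type*} (s : Finset ι) {f : ι → E → ℂ} {y : E}
    (hf : ∀ j ∈ s, ContDiffAt ℂ 2 (f j) y) (h0 : ∑ j ∈ s, ‖f j y‖ ^ 2 ≠ 0) (v : E) :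
    0 ≤ leviForm (fun x => Real.log (∑ j ∈ s, ‖f j x‖ ^ 2)) y v := by
  have hC : ContDiffAt ℝ 2 (fun x => Real.log (∑ j ∈ s, ‖f j x‖ ^ 2)) y :=
    (ContDiffAt.sum fun j hj => ((hf j hj).restrict_scalars ℝ).norm_sq ℝ).log h0
  have h1 := (HasJet.sum s fun j hj => ((hf j hj).hasJet_line_complex v).norm_sq).log h0
  have h2 := (HasJet.sum s fun j hj => ((hf j hj).hasJet_line_I_smul v).norm_sq).log h0
  rw [leviForm_eq_of_hasJet hC h1 h2]
  have hF : 0 < ∑ j ∈ s, ‖f j y‖ ^ 2 :=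
    lt_of_le_of_ne (Finset.sum_nonneg fun j _ => by positivity) h0.symm
  have e1 : ∑ j ∈ s, 2 * ((starRingEnd ℂ) (f j y) * fderiv ℂ (f j) y v).re =
      2 * (∑ j ∈ s, (starRingEnd ℂ) (f j y) * fderiv ℂ (f j) y v).re := by
    rw [Complex.re_sum, Finset.mul_sum]
  have e2 : ∑ j ∈ s, 2 * ((starRingEnd ℂ) (f j y) * Complex.I • fderiv ℂ (f j) y v).re =
      -2 * (∑ j ∈ s, (starRingEnd ℂ) (f j y) * fderiv ℂ (f j) y v).im := by
    rw [Complex.im_sum, Finset.mul_sum]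
    refine Finset.sum_congr rfl fun j _ => ?_
    rw [smul_eq_mul, mul_left_comm, Complex.I_mul_re]
    ring
  have e3 : ∀ Q : ι → ℂ, ∑ j ∈ s, (2 * ‖fderiv ℂ (f j) y v‖ ^ 2 + 2 * (Q j).re) =
      2 * ∑ j ∈ s, ‖fderiv ℂ (f j) y v‖ ^ 2 + 2 * ∑ j ∈ s, (Q j).re := fun Q => by
    rw [Finset.sum_add_distrib, Finset.mul_sum, Finset.mul_sum]
  have e4 : ∑ j ∈ s, ((starRingEnd ℂ) (f j y) * -fderiv ℂ (fderiv ℂ (f j)) y v v).re =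
      -∑ j ∈ s, ((starRingEnd ℂ) (f j y) * fderiv ℂ (fderiv ℂ (f j)) y v v).re := by
    rw [← Finset.sum_neg_distrib]
    simp
  have e5 : ∀ j, ‖Complex.I • fderiv ℂ (f j) y v‖ = ‖fderiv ℂ (f j) y v‖ := fun j => by simp
  have hCS : ‖∑ j ∈ s, (starRingEnd ℂ) (f j y) * fderiv ℂ (f j) y v‖ ^ 2 ≤
      (∑ j ∈ s, ‖f j y‖ ^ 2) * ∑ j ∈ s, ‖fderiv ℂ (f j) y v‖ ^ 2 := by
    calc _ ≤ (∑ j ∈ s, ‖f j y‖ * ‖fderiv ℂ (f j) y v‖) ^ 2 := by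
          gcongr
          refine (norm_sum_le _ _).trans_eq (Finset.sum_congr rfl fun j _ => ?_)
          rw [norm_mul, RCLike.norm_conj]
      _ ≤ _ := Finset.sum_mul_sq_le_sq_mul_sq _ _ _
  rw [← Complex.normSq_eq_norm_sq, Complex.normSq_apply] at hCS
  simp only [e5, e3, e4, e1, e2]
  set z := ∑ j ∈ s, (starRingEnd ℂ) (f j y) * fderiv ℂ (f j) y v
  set F := ∑ j ∈ s, ‖f j y‖ ^ 2
  set D := ∑ j ∈ s, ‖fderiv ℂ (f j) y v‖ ^ 2
  set R := ∑ j ∈ s, ((starRingEnd ℂ) (f j y) * fderiv ℂ (fderiv ℂ (f j)) y v v).re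
  have : ((2 * D + 2 * R) / F - (2 * z.re / F) ^ 2 + ((2 * D + 2 * -R) / F - (-2 * z.im / F) ^ 2)) / 4
      = (F * D - (z.re * z.re + z.im * z.im)) / F ^ 2 := by
    field_simp
    ring
  rw [this]
  exact div_nonneg (sub_nonneg.2 hCS) (by positivity)

end LeviForm

/-! ### Lower bounds for Levi forms of logarithms -/

section JetBounds

variable {F G : Type*} [NormedAddCommGroup F] [NormedSpace ℝ F] [NormedAddCommGroup G]
  [NormedSpace ℝ G]

/-- The curve `c` has a second order jet at time `0` whose derivatives of order `k` are bounded by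
`K rᵏ`. -/
def HasJetBound (c : ℝ → F) (K r : ℝ) : Prop :=
  ∃ c₀ c₁ c₂, HasJet c c₀ c₁ c₂ ∧ ‖c₀‖ ≤ K ∧ ‖c₁‖ ≤ K * r ∧ ‖c₂‖ ≤ K * r ^ 2

theorem HasJetBound.add {c d : ℝ → F} {K K' r : ℝ} (h : HasJetBound c K r)
    (h' : HasJetBound d K' r) : HasJetBound (fun t => c t + d t) (K + K') r := by
  obtain ⟨c₀, c₁, c₂, hc, h0, h1, h2⟩ := h
  obtain ⟨d₀, d₁, d₂, hd, k0, k1, k2⟩ := h'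
  refine ⟨_, _, _, hc.add hd, ?_, ?_, ?_⟩
  · exact (norm_add_le _ _).trans (by linarith)
  · exact (norm_add_le _ _).trans (by linarith)
  · exact (norm_add_le _ _).trans (by linarith)

theorem HasJetBound.clm {c : ℝ → F} {K r : ℝ} (h : HasJetBound c K r) (L : F →L[ℝ] G) :
    HasJetBound (fun t => L (c t)) (‖L‖ * K) r := by
  obtain ⟨c₀, c₁, c₂, hc, h0, h1, h2⟩ := h
  refine ⟨_, _, _, hc.clm L, L.le_opNorm_of_le h0, ?_, ?_⟩
  · rw [mul_assoc]; exact L.le_opNorm_of_le h1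
  · rw [mul_assoc]; exact L.le_opNorm_of_le h2

theorem HasJetBound.mul {A : Type*} [NormedRing A] [NormedAlgebra ℝ A] {c d : ℝ → A} {K K' r : ℝ}
    (h : HasJetBound c K r) (h' : HasJetBound d K' r) :
    HasJetBound (fun t => c t * d t) (4 * (K * K')) r := by
  obtain ⟨c₀, c₁, c₂, hc, h0, h1, h2⟩ := h
  obtain ⟨d₀, d₁, d₂, hd, k0, k1, k2⟩ := h'
  have hK : 0 ≤ K := (norm_nonneg _).trans h0
  have hK' : 0 ≤ K' := (norm_nonneg _).trans k0
  have hr : 0 ≤ K * r := (norm_nonneg _).trans h1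
  have hr' : 0 ≤ K' * r := (norm_nonneg _).trans k1
  have hm : ∀ {x y : A} {α β : ℝ}, ‖x‖ ≤ α → ‖y‖ ≤ β → ‖x * y‖ ≤ α * β := fun hx hy =>
    (norm_mul_le _ _).trans
      (mul_le_mul hx hy (norm_nonneg _) ((norm_nonneg _).trans hx))
  refine ⟨_, _, _, hc.mul hd, ?_, ?_, ?_⟩
  · have := hm h0 k0
    nlinarith [mul_nonneg hK hK']
  · have e1 := hm h1 k0
    have e2 := hm h0 k1
    have := norm_add_le (c₁ * d₀) (c₀ * d₁)
    nlinarith [mul_nonneg hK hr']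
  · have e1 := hm h2 k0
    have e2 := hm h0 k2
    have e3 := hm h1 k1
    have e4 := norm_add_le (c₂ * d₀ + c₁ * d₁) (c₁ * d₁ + c₀ * d₂)
    have e5 := norm_add_le (c₂ * d₀) (c₁ * d₁)
    have e6 := norm_add_le (c₁ * d₁) (c₀ * d₂)
    nlinarith

/-- The restrictions of a `C²` function to lines through nearby points have uniformly bounded jets. -/
theorem exists_hasJetBound_line {u : F → G} {y₀ : F} (hu : ContDiffAt ℝ 2 u y₀) :
    ∃ K, ∀ᶠ y in 𝓝 y₀, ∀ v, HasJetBound (fun t : ℝ => u (y + t • v)) K ‖v‖ := by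
  have hu1 : ContDiffAt ℝ 1 (fderiv ℝ u) y₀ := hu.fderiv_right (by norm_num)
  have hu2 : ContDiffAt ℝ 0 (fderiv ℝ (fderiv ℝ u)) y₀ := hu1.fderiv_right (by norm_num)
  refine ⟨‖u y₀‖ + ‖fderiv ℝ u y₀‖ + ‖fderiv ℝ (fderiv ℝ u) y₀‖ + 1, ?_⟩
  filter_upwards [hu.eventually (by simp),
    hu.continuousAt.norm.eventually_lt_const (lt_add_one _),
    hu1.continuousAt.norm.eventually_lt_const (lt_add_one _),
    hu2.continuousAt.norm.eventually_lt_const (lt_add_one _)] with y h h0 h1 h2 v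
  have n0 := norm_nonneg (u y₀)
  have n1 := norm_nonneg (fderiv ℝ u y₀)
  have n2 := norm_nonneg (fderiv ℝ (fderiv ℝ u) y₀)
  refine ⟨_, _, _, h.hasJet_line v, by linarith, ?_, ?_⟩
  · refine (ContinuousLinearMap.le_opNorm _ _).trans ?_
    gcongr
    linarith
  · refine (ContinuousLinearMap.le_opNorm₂ _ _ _).trans ?_
    rw [mul_assoc, ← pow_two]
    gcongr
    linarith

theorem HasJetBound.log {c : ℝ → ℝ} {K r m : ℝ} (h : HasJetBound c K r) (hm : 0 < m)
    (hc : m ≤ c 0) : ∃ c₂, (∃ c₀ c₁, HasJet (fun t => Real.log (c t)) c₀ c₁ c₂) ∧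
      -(K / m + K ^ 2 / m ^ 2) * r ^ 2 ≤ c₂ := by
  obtain ⟨c₀, c₁, c₂, hj, h0, h1, h2⟩ := h
  rw [hj.1] at hc
  have hc0 : 0 < c₀ := hm.trans_le hc
  refine ⟨_, ⟨_, _, hj.log hc0.ne'⟩, ?_⟩
  rw [Real.norm_eq_abs] at h1 h2
  have hK : 0 ≤ K := (norm_nonneg _).trans h0
  have e1 : |c₂ / c₀| ≤ K * r ^ 2 / m := by
    rw [abs_div, abs_of_pos hc0]
    gcongr
  have e2 : (c₁ / c₀) ^ 2 ≤ (K * r / m) ^ 2 := by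
    rw [← sq_abs, abs_div, abs_of_pos hc0]
    gcongr
    exact (abs_nonneg _).trans h1
  have e3 := (abs_le.1 e1).1
  have : (K * r / m) ^ 2 = K ^ 2 / m ^ 2 * r ^ 2 := by ring
  rw [this] at e2
  have : K * r ^ 2 / m = K / m * r ^ 2 := by ring
  linarith

/-- The function `ζ³ / ζ̄` has bounded second derivatives near the origin. -/
theorem hasJetBound_cube_div_conj {ζ σ : ℂ} {c : ℝ → ℂ} (hc : HasJet c ζ σ 0) (h0 : ζ ≠ 0)
    (h1 : ‖ζ‖ ≤ 1) : HasJetBound (fun t => c t ^ 3 * (starRingEnd ℂ (c t))⁻¹) 14 ‖σ‖ := by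
  have hn : 0 < ‖ζ‖ := norm_pos_iff.2 h0
  have hz : starRingEnd ℂ ζ ≠ 0 := by simpa using h0
  have j1 := ((hc.mul hc).mul hc).mul ((hc.clm (Complex.conjCLE : ℂ →L[ℝ] ℂ)).scomp
    (φ := fun s => s⁻¹) (φ' := fun s => -(s ^ 2)⁻¹) (d := 2 / (starRingEnd ℂ ζ) ^ 3)
    ((eventually_ne_nhds hz).mono fun s hs => hasDerivAt_inv hs) ?_)
  · simp only [ContinuousLinearEquiv.coe_coe, Complex.conjCLE_apply] at j1
    have j2 := j1.congr (d := fun t => c t ^ 3 * (starRingEnd ℂ (c t))⁻¹)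
      (Filter.Eventually.of_forall fun t => by simp only; ring)
    have e0 : ‖ζ ^ 3 * (starRingEnd ℂ ζ)⁻¹‖ = ‖ζ‖ ^ 2 := by
      rw [norm_mul, norm_inv, RCLike.norm_conj, norm_pow]
      field_simp
    have j3 := j2.of_eq (d₀ := ζ ^ 3 * (starRingEnd ℂ ζ)⁻¹)
      (d₁ := 3 * (ζ ^ 2 * σ * (starRingEnd ℂ ζ)⁻¹) -
        ζ ^ 3 * starRingEnd ℂ σ * (starRingEnd ℂ ζ)⁻¹ ^ 2)
      (d₂ := 6 * (ζ * σ ^ 2 * (starRingEnd ℂ ζ)⁻¹) -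
        6 * (ζ ^ 2 * σ * starRingEnd ℂ σ * (starRingEnd ℂ ζ)⁻¹ ^ 2) +
        2 * (ζ ^ 3 * (starRingEnd ℂ σ) ^ 2 * (starRingEnd ℂ ζ)⁻¹ ^ 3))
      (by ring) (by field_simp; ring) (by simp only [map_zero]; field_simp; ring)
    refine ⟨_, _, _, j3, ?_, ?_, ?_⟩
    · rw [e0]
      nlinarith
    · have n1 : ‖3 * (ζ ^ 2 * σ * (starRingEnd ℂ ζ)⁻¹)‖ = 3 * (‖ζ‖ * ‖σ‖) := by
        simp only [norm_mul, norm_inv, RCLike.norm_conj, norm_pow, Complex.norm_ofNat]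
        field_simp
      have n2 : ‖ζ ^ 3 * starRingEnd ℂ σ * (starRingEnd ℂ ζ)⁻¹ ^ 2‖ = ‖ζ‖ * ‖σ‖ := by
        simp only [norm_mul, norm_inv, RCLike.norm_conj, norm_pow]
        field_simp
      refine (norm_sub_le _ _).trans ?_
      rw [n1, n2]
      nlinarith [norm_nonneg σ]
    · have n1 : ‖6 * (ζ * σ ^ 2 * (starRingEnd ℂ ζ)⁻¹)‖ = 6 * ‖σ‖ ^ 2 := by
        simp only [norm_mul, norm_inv, RCLike.norm_conj, norm_pow, Complex.norm_ofNat]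
        field_simp
      have n2 : ‖6 * (ζ ^ 2 * σ * starRingEnd ℂ σ * (starRingEnd ℂ ζ)⁻¹ ^ 2)‖ = 6 * ‖σ‖ ^ 2 := by
        simp only [norm_mul, norm_inv, RCLike.norm_conj, norm_pow, Complex.norm_ofNat]
        field_simp
      have n3 : ‖2 * (ζ ^ 3 * (starRingEnd ℂ σ) ^ 2 * (starRingEnd ℂ ζ)⁻¹ ^ 3)‖ =
          2 * ‖σ‖ ^ 2 := by
        simp only [norm_mul, norm_inv, RCLike.norm_conj, norm_pow, Complex.norm_ofNat]
        field_simp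
      refine (norm_add_le _ _).trans ((add_le_add_left (norm_sub_le _ _) _).trans ?_)
      rw [n1, n2, n3]
      linarith
  · have := (hasDerivAt_pow 2 (starRingEnd ℂ ζ)).inv (pow_ne_zero 2 hz)
    refine (this.neg).congr_deriv ?_
    field_simp
    norm_num [mul_comm]

end JetBounds

section LeviBounds

variable {E : Type*} [NormedAddCommGroup E] [NormedSpace ℂ E]

/-- If `q = |ℓ|² b + Re (ℓ⁴ c)` with `b > 0` then the Levi form of `log q` is bounded below near
`0`. Indeed `log q = log |ℓ|² + log (b + Re (ℓ³ / ℓ̄ · c))`, where the first term is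
plurisubharmonic, and the second one has bounded second derivatives. -/
theorem exists_leviForm_log_ge {ℓ : E →L[ℂ] ℂ} {q b : E → ℝ} {c : E → ℂ}
    (hb : ContDiffAt ℝ 2 b 0) (hc : ContDiffAt ℝ 2 c 0) (hb0 : 0 < b 0)
    (hq : ∀ᶠ x in 𝓝 (0 : E), q x = ‖ℓ x‖ ^ 2 * b x + (ℓ x ^ 4 * c x).re) :
    ∃ C, ∀ᶠ y in 𝓝 (0 : E), ℓ y ≠ 0 → 0 < q y ∧ ContDiffAt ℝ 2 (fun x => Real.log (q x)) y ∧
      ∀ v, -C * ‖v‖ ^ 2 ≤ leviForm (fun x => Real.log (q x)) y v := by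
  obtain ⟨Kb, hKb⟩ := exists_hasJetBound_line hb
  obtain ⟨Kc, hKc⟩ := exists_hasJetBound_line hc
  let w : E → ℝ := fun x => b x + Complex.reCLM (ℓ x ^ 3 * (starRingEnd ℂ (ℓ x))⁻¹ * c x)
  set K : ℝ := Kb + ‖Complex.reCLM‖ * (4 * (14 * (1 + ‖ℓ‖) ^ 2 * Kc)) with hK
  have hwpos : ∀ᶠ y in 𝓝 (0 : E), b 0 / 2 ≤ w y := by
    have h1 : Filter.Tendsto (fun y => b y - ‖ℓ y‖ ^ 2 * ‖c y‖) (𝓝 0)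
        (𝓝 (b 0 - ‖ℓ 0‖ ^ 2 * ‖c 0‖)) :=
      hb.continuousAt.sub ((ℓ.continuous.continuousAt.norm.pow 2).mul hc.continuousAt.norm)
    simp only [map_zero, norm_zero, ne_eq, OfNat.ofNat_ne_zero, not_false_eq_true, zero_pow,
      zero_mul, sub_zero] at h1
    filter_upwards [h1.eventually_const_lt (half_lt_self hb0)] with y hy
    have h2 : |(ℓ y ^ 3 * (starRingEnd ℂ (ℓ y))⁻¹ * c y).re| ≤ ‖ℓ y‖ ^ 2 * ‖c y‖ := by
      refine (Complex.abs_re_le_norm _).trans ?_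
      rw [norm_mul, norm_mul, norm_inv, RCLike.norm_conj, norm_pow]
      refine mul_le_mul_of_nonneg_right ?_ (norm_nonneg _)
      rcases eq_or_ne ‖ℓ y‖ 0 with h | h
      · simp [h]
      · field_simp
        exact le_rfl
    have := (abs_le.1 h2).1
    simp only [w, Complex.reCLM_apply]
    linarith
  have hsmall : ∀ᶠ y in 𝓝 (0 : E), ‖ℓ y‖ < 1 := by
    have := (ℓ.continuous.continuousAt (x := (0 : E))).norm
    exact this.eventually_lt_const (by simp)
  refine ⟨(K / (b 0 / 2) + K ^ 2 / (b 0 / 2) ^ 2) / 2, ?_⟩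
  filter_upwards [hKb, hKc, hwpos.eventually_nhds, hsmall, hq.eventually_nhds,
    hb.eventually (by simp), hc.eventually (by simp)] with y hKb hKc hw hsm hq hby hcy hy
  have hℓe : ∀ᶠ x in 𝓝 y, ℓ x ≠ 0 := ℓ.continuous.continuousAt.eventually_ne hy
  have hqw : ∀ᶠ x in 𝓝 y, q x = ‖ℓ x‖ ^ 2 * w x := by
    filter_upwards [hq, hℓe] with x h1 h2
    have h3 : (‖ℓ x‖ : ℂ) ^ 2 = starRingEnd ℂ (ℓ x) * ℓ x := by
      rw [← Complex.normSq_eq_conj_mul_self, Complex.normSq_eq_norm_sq]; push_cast; rfl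
    have h4 : ℓ x ^ 4 * c x = ((‖ℓ x‖ ^ 2 : ℝ) : ℂ) * (ℓ x ^ 3 * (starRingEnd ℂ (ℓ x))⁻¹ * c x) := by
      have h5 : starRingEnd ℂ (ℓ x) ≠ 0 := by simpa using h2
      push_cast
      rw [h3]
      field_simp
    rw [h1, h4, Complex.re_ofReal_mul, ← mul_add]
    rfl
  have hwy : 0 < w y := by linarith [hw.self_of_nhds]
  have hqy : 0 < q y := by
    rw [hqw.self_of_nhds]
    have := norm_pos_iff.2 hy
    positivity
  have hℓs : ∀ {n}, ContDiffAt ℝ n (fun x => ℓ x) y :=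
    (ℓ.restrictScalars ℝ).contDiff.contDiffAt
  have hwC : ContDiffAt ℝ 2 w y := by
    have h1 : ContDiffAt ℝ 2 (fun x => (starRingEnd ℂ (ℓ x))⁻¹) y :=
      ContDiffAt.inv ((Complex.conjCLE : ℂ →L[ℝ] ℂ).contDiff.contDiffAt.comp y hℓs)
        (by simpa using hy)
    exact hby.add (Complex.reCLM.contDiff.contDiffAt.comp y (((hℓs.pow 3).mul h1).mul hcy))
  have hlog : (fun x => Real.log (q x)) =ᶠ[𝓝 y] fun x =>
      Real.log (∑ _j ∈ ({()} : Finset Unit), ‖ℓ x‖ ^ 2) + Real.log (w x) := by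
    filter_upwards [hqw, hℓe, hw] with x h1 h2 h3
    rw [h1, Finset.sum_singleton, Real.log_mul (by simpa using h2) (by linarith)]
  have hC1 : ContDiffAt ℝ 2 (fun x => Real.log (∑ _j ∈ ({()} : Finset Unit), ‖ℓ x‖ ^ 2)) y := by
    simp only [Finset.sum_singleton]
    exact (hℓs.norm_sq ℝ).log (by simpa using hy)
  have hC2 : ContDiffAt ℝ 2 (fun x => Real.log (w x)) y := hwC.log hwy.ne'
  refine ⟨hqy, (hC1.add hC2).congr_of_eventuallyEq hlog, fun v => ?_⟩
  rw [leviForm_congr hlog, leviForm_add hC1 hC2]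
  have h1 := leviForm_log_sum_nonneg ({()} : Finset Unit) (f := fun _ => ℓ) (y := y)
    (fun j _ => ℓ.contDiff.contDiffAt) (by simpa using hy) v
  have hjw : ∀ u : E, HasJetBound (fun t : ℝ => w (y + t • u)) K ‖u‖ := by
    intro u
    have j1 : HasJet (fun t : ℝ => ℓ (y + t • u)) (ℓ y) (ℓ u) 0 := by
      simpa using (hasJet_line y u).clm (ℓ.restrictScalars ℝ)
    have j2 : HasJetBound (fun t : ℝ => ℓ (y + t • u) ^ 3 * (starRingEnd ℂ (ℓ (y + t • u)))⁻¹)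
        (14 * (1 + ‖ℓ‖) ^ 2) ‖u‖ := by
      obtain ⟨c₀, c₁, c₂, h0, h1, h2, h3⟩ := hasJetBound_cube_div_conj j1 hy hsm.le
      have hn := norm_nonneg ℓ
      have hu := ℓ.le_opNorm u
      refine ⟨c₀, c₁, c₂, h0, h1.trans ?_, h2.trans ?_, h3.trans ?_⟩
      · nlinarith
      · rw [mul_assoc]
        gcongr
        refine hu.trans ?_
        gcongr
        nlinarith
      · rw [mul_assoc, ← mul_pow]
        gcongr
        refine hu.trans ?_
        gcongr
        linarith
    exact (hKb u).add ((j2.mul (hKc u)).clm Complex.reCLM)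
  obtain ⟨d, ⟨d0, d1, hd⟩, hd'⟩ := (hjw v).log (half_pos hb0) (by simpa using hw.self_of_nhds)
  obtain ⟨e, ⟨e0, e1, he⟩, he'⟩ := (hjw (Complex.I • v)).log (half_pos hb0)
    (by simpa using hw.self_of_nhds)
  rw [leviForm_eq_of_hasJet hC2 hd he]
  have hIv : ‖Complex.I • v‖ = ‖v‖ := by simp [norm_smul]
  rw [hIv] at he'
  linarith

/-- A convex increasing function of a plurisubharmonic function is plurisubharmonic. -/
theorem leviForm_comp_nonneg {μ : ℝ → ℝ} (hμ : ContDiff ℝ 2 μ) (h1 : ∀ s, 0 ≤ deriv μ s)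
    (h2 : ∀ s, 0 ≤ deriv (deriv μ) s) {ψ : E → ℝ} {y v : E} (hψ : ContDiffAt ℝ 2 ψ y)
    (h : 0 ≤ leviForm ψ y v) : 0 ≤ leviForm (fun x => μ (ψ x)) y v := by
  have hμ1 : ContDiff ℝ 1 (deriv μ) := hμ.iterate_deriv' 1 1
  have key : ∀ u : E, HasJet (fun t : ℝ => μ (ψ (y + t • u))) (μ (ψ y))
      (fderiv ℝ ψ y u * deriv μ (ψ y)) (fderiv ℝ (fderiv ℝ ψ) y u u * deriv μ (ψ y) +
        fderiv ℝ ψ y u * (fderiv ℝ ψ y u * deriv (deriv μ) (ψ y))) := fun u =>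
    (hψ.hasJet_line u).scomp
      (Filter.Eventually.of_forall fun s => (hμ.differentiable (by norm_num) s).hasDerivAt)
      (hμ1.differentiable one_ne_zero _).hasDerivAt
  have hC : ContDiffAt ℝ 2 (fun x => μ (ψ x)) y := hμ.contDiffAt.comp y hψ
  rw [leviForm_eq_of_hasJet hC (key v) (key (Complex.I • v))]
  rw [leviForm] at h
  have e1 := mul_nonneg h (h1 (ψ y))
  have e2 := mul_nonneg (mul_self_nonneg (fderiv ℝ ψ y v)) (h2 (ψ y))
  have e3 := mul_nonneg (mul_self_nonneg (fderiv ℝ ψ y (Complex.I • v))) (h2 (ψ y))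
  linarith

/-- The logarithm of a sum `∑ θᵢ² exp wᵢ` of plurisubharmonic exponentials, glued by cut-off
functions, has a Levi form that is bounded below in terms of the derivatives of the cut-off
functions and the ratios of the terms. -/
theorem leviForm_log_sum_sq_mul_exp_ge {ι : Type*} (s : Finset ι) {θ w : ι → E → ℝ} {y v : E}
    (hθ : ∀ i ∈ s, ContDiffAt ℝ 2 (θ i) y) (hw : ∀ i ∈ s, ContDiffAt ℝ 2 (w i) y)
    (hL : ∀ i ∈ s, 0 ≤ leviForm (w i) y v)
    (hF : 0 < ∑ i ∈ s, θ i y ^ 2 * Real.exp (w i y)) {K M : ℝ}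
    (hK : ∀ i ∈ s, ∀ u, 2 * fderiv ℝ (θ i) y u ^ 2 -
      2 * θ i y * fderiv ℝ (fderiv ℝ (θ i)) y u u ≤ K * ‖u‖ ^ 2)
    (hM : ∑ i ∈ s, Real.exp (w i y) ≤ M * ∑ i ∈ s, θ i y ^ 2 * Real.exp (w i y)) (hK0 : 0 ≤ K) :
    -(K * M / 2) * ‖v‖ ^ 2 ≤
      leviForm (fun x => Real.log (∑ i ∈ s, θ i x ^ 2 * Real.exp (w i x))) y v := by
  have hC : ContDiffAt ℝ 2 (fun x => Real.log (∑ i ∈ s, θ i x ^ 2 * Real.exp (w i x))) y :=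
    (ContDiffAt.sum fun i hi => ((hθ i hi).pow 2).mul (hw i hi).exp).log hF.ne'
  have key : ∀ u : E, HasJet
      (fun t : ℝ => ∑ i ∈ s, θ i (y + t • u) ^ 2 * Real.exp (w i (y + t • u)))
      (∑ i ∈ s, θ i y ^ 2 * Real.exp (w i y))
      (∑ i ∈ s, Real.exp (w i y) *
        (θ i y * (θ i y * fderiv ℝ (w i) y u + 2 * fderiv ℝ (θ i) y u)))
      (∑ i ∈ s, (Real.exp (w i y) * (θ i y * fderiv ℝ (w i) y u + 2 * fderiv ℝ (θ i) y u) ^ 2 +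
        (Real.exp (w i y) * θ i y ^ 2 * fderiv ℝ (fderiv ℝ (w i)) y u u -
        Real.exp (w i y) * (2 * fderiv ℝ (θ i) y u ^ 2 -
          2 * θ i y * fderiv ℝ (fderiv ℝ (θ i)) y u u)))) := fun u => by
    refine HasJet.sum s fun i hi => ?_
    have h1 := (hθ i hi).hasJet_line u
    have h2 := ((h1.mul h1).mul ((hw i hi).hasJet_line u).exp).congr
      (d := fun t => θ i (y + t • u) ^ 2 * Real.exp (w i (y + t • u)))
      (Filter.Eventually.of_forall fun t => by simp only; ring)
    exact h2.of_eq (by ring) (by ring) (by ring)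
  rw [leviForm_eq_of_hasJet hC ((key v).log hF.ne') ((key (Complex.I • v)).log hF.ne')]
  have hF0 := hF
  set F := ∑ i ∈ s, θ i y ^ 2 * Real.exp (w i y) with hFdef
  have hCS : ∀ u : E, (∑ i ∈ s, Real.exp (w i y) *
      (θ i y * (θ i y * fderiv ℝ (w i) y u + 2 * fderiv ℝ (θ i) y u))) ^ 2 ≤
      F * ∑ i ∈ s, Real.exp (w i y) *
        (θ i y * fderiv ℝ (w i) y u + 2 * fderiv ℝ (θ i) y u) ^ 2 := fun u => by
    rw [hFdef]
    refine Finset.sum_sq_le_sum_mul_sum_of_sq_le_mul s (fun i _ => by positivity)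
      (fun i _ => by positivity) fun i _ => le_of_eq ?_
    ring
  have hKs : ∀ u : E, ‖u‖ = ‖v‖ → ∑ i ∈ s, Real.exp (w i y) * (2 * fderiv ℝ (θ i) y u ^ 2 -
      2 * θ i y * fderiv ℝ (fderiv ℝ (θ i)) y u u) ≤ M * F * (K * ‖v‖ ^ 2) := fun u hu => by
    calc _ ≤ ∑ i ∈ s, Real.exp (w i y) * (K * ‖v‖ ^ 2) := by
          refine Finset.sum_le_sum fun i hi => ?_
          have := hK i hi u
          rw [hu] at this
          gcongr
      _ = (∑ i ∈ s, Real.exp (w i y)) * (K * ‖v‖ ^ 2) := by rw [Finset.sum_mul]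
      _ ≤ _ := by gcongr
  have hLs : 0 ≤ ∑ i ∈ s, Real.exp (w i y) * θ i y ^ 2 * fderiv ℝ (fderiv ℝ (w i)) y v v +
      ∑ i ∈ s, Real.exp (w i y) * θ i y ^ 2 *
        fderiv ℝ (fderiv ℝ (w i)) y (Complex.I • v) (Complex.I • v) := by
    rw [← Finset.sum_add_distrib]
    refine Finset.sum_nonneg fun i hi => ?_
    have := hL i hi
    rw [leviForm] at this
    rw [← mul_add]
    exact mul_nonneg (by positivity) (by linarith)
  have hIv : ‖Complex.I • v‖ = ‖v‖ := by simp [norm_smul]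
  have k1 := hKs v rfl
  have k2 := hKs _ hIv
  have c1 := hCS v
  have c2 := hCS (Complex.I • v)
  simp only [Finset.sum_add_distrib, Finset.sum_sub_distrib] at c1 c2 k1 k2 hLs ⊢
  generalize ∑ i ∈ s, Real.exp (w i y) * (θ i y * (θ i y * fderiv ℝ (w i) y v +
    2 * fderiv ℝ (θ i) y v)) = A1 at *
  generalize ∑ i ∈ s, Real.exp (w i y) * (θ i y * (θ i y * fderiv ℝ (w i) y (Complex.I • v) +
    2 * fderiv ℝ (θ i) y (Complex.I • v))) = A2 at *
  rw [div_pow, div_pow]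
  have d1 : ∀ {A B : ℝ}, A ^ 2 ≤ F * B → A ^ 2 / F ^ 2 ≤ B / F := fun h => by
    rw [div_le_div_iff₀ (by positivity) hF0]
    nlinarith
  have d2 := d1 c1
  have d3 := d1 c2
  have d4 : ∀ {A : ℝ}, A ≤ M * F * (K * ‖v‖ ^ 2) → A / F ≤ M * (K * ‖v‖ ^ 2) := fun h => by
    rw [div_le_iff₀ hF0]
    linarith
  have d5 := d4 k1
  have d6 := d4 k2
  have d7 := div_nonneg hLs hF0.le
  rw [add_div] at d7
  simp only [add_div, sub_div]
  linarith

end LeviBounds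

/-! ### The complex Hessian on a complex manifold -/

section RestrictScalars

variable {E F : Type*} [NormedAddCommGroup E] [NormedSpace ℂ E] [NormedAddCommGroup F]
  [NormedSpace ℂ F] {X Y : Type*} [TopologicalSpace X] [ChartedSpace E X] [TopologicalSpace Y]
  [ChartedSpace F Y]

theorem ContMDiffAt.complexToReal {n : ℕ∞ω} {f : X → Y} {x : X}
    (h : ContMDiffAt 𝓘(ℂ, E) 𝓘(ℂ, F) n f x) : ContMDiffAt 𝓘(ℝ, E) 𝓘(ℝ, F) n f x := by
  rw [contMDiffAt_iff] at h ⊢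
  exact ⟨h.1, h.2.restrict_scalars ℝ⟩

theorem contMDiffAt_iff_contDiffAt_chartAt {𝕜 : Type*} [NontriviallyNormedField 𝕜]
    {E F : Type*} [NormedAddCommGroup E] [NormedSpace 𝕜 E] [NormedAddCommGroup F]
    [NormedSpace 𝕜 F] {X : Type*} [TopologicalSpace X] [ChartedSpace E X] {n : ℕ∞ω} {f : X → F}
    {x : X} : ContMDiffAt 𝓘(𝕜, E) 𝓘(𝕜, F) n f x ↔
      ContinuousAt f x ∧ ContDiffAt 𝕜 n (f ∘ (chartAt E x).symm) (chartAt E x x) := by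
  rw [contMDiffAt_iff]
  simp only [mfld_simps, contDiffWithinAt_univ]
  exact Iff.rfl

theorem mfderiv_eq_fderiv_chartAt {𝕜 : Type*} [NontriviallyNormedField 𝕜]
    {E F : Type*} [NormedAddCommGroup E] [NormedSpace 𝕜 E] [NormedAddCommGroup F]
    [NormedSpace 𝕜 F] {X : Type*} [TopologicalSpace X] [ChartedSpace E X] {f : X → F}
    {x : X} (hf : MDifferentiableAt 𝓘(𝕜, E) 𝓘(𝕜, F) f x) :
    mfderiv 𝓘(𝕜, E) 𝓘(𝕜, F) f x = fderiv 𝕜 (f ∘ (chartAt E x).symm) (chartAt E x x) := by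
  rw [hf.mfderiv]
  simp only [mfld_simps, writtenInExtChartAt, fderivWithin_univ]
  rfl

end RestrictScalars

section ComplexHessian

variable {E E' : Type*} [NormedAddCommGroup E] [NormedSpace ℂ E] [NormedAddCommGroup E']
  [NormedSpace ℂ E'] {X : Type*} [TopologicalSpace X] [ChartedSpace E X]

theorem complexHessian_eq_leviForm' (u : X → ℝ) (x : X) (v : TangentSpace 𝓘(ℝ, E) x) :
    complexHessian u x v = leviForm (u ∘ (chartAt E x).symm) (chartAt E x x) v := rfl

/-- The complex Hessian of a function of the form `w ∘ φ` with `φ` holomorphic. -/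
theorem complexHessian_eq_leviForm {u : X → ℝ} {w : E' → ℝ} {φ : X → E'} {x : X}
    (hφ : ContMDiffAt 𝓘(ℂ, E) 𝓘(ℂ, E') ω φ x) (hu : u =ᶠ[𝓝 x] w ∘ φ)
    (hw : ContDiffAt ℝ 2 w (φ x)) (v : TangentSpace 𝓘(ℝ, E) x) :
    complexHessian u x v = leviForm w (φ x) (mfderiv 𝓘(ℝ, E) 𝓘(ℝ, E') φ x v) := by
  have h1 := (contMDiffAt_iff_contDiffAt_chartAt.1 hφ).2
  have h2 : (chartAt E x).symm (chartAt E x x) = x := (chartAt E x).left_inv (mem_chart_source E x)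
  have h3 : Filter.Tendsto (chartAt E x).symm (𝓝 (chartAt E x x)) (𝓝 x) := by
    have := (chartAt E x).continuousAt_symm (mem_chart_target E x)
    rwa [ContinuousAt, h2] at this
  have h4 : (u ∘ (chartAt E x).symm) =ᶠ[𝓝 (chartAt E x x)]
      fun y => w ((φ ∘ (chartAt E x).symm) y) := h3.eventually hu
  have h5 : (φ ∘ (chartAt E x).symm) (chartAt E x x) = φ x := by simp [h2]
  have h6 : fderiv ℂ (φ ∘ (chartAt E x).symm) (chartAt E x x) v =
      mfderiv 𝓘(ℝ, E) 𝓘(ℝ, E') φ x v := by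
    rw [mfderiv_eq_fderiv_chartAt (hφ.complexToReal.mdifferentiableAt (by simp)),
      (h1.differentiableAt (by simp)).fderiv_restrictScalars ℝ]
    rfl
  refine (complexHessian_eq_leviForm' u x v).trans ((leviForm_congr h4 _).trans
    ((leviForm_comp (by rwa [h5]) (h1.of_le le_top) _).trans ?_))
  rw [h5, h6]

theorem complexHessian_congr {u u' : X → ℝ} {x : X} (h : u =ᶠ[𝓝 x] u')
    (v : TangentSpace 𝓘(ℝ, E) x) : complexHessian u x v = complexHessian u' x v := by
  have h2 : (chartAt E x).symm (chartAt E x x) = x := (chartAt E x).left_inv (mem_chart_source E x)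
  have h3 : Filter.Tendsto (chartAt E x).symm (𝓝 (chartAt E x x)) (𝓝 x) := by
    have := (chartAt E x).continuousAt_symm (mem_chart_target E x)
    rwa [ContinuousAt, h2] at this
  exact leviForm_congr (h3.eventually h) _

theorem complexHessian_add {u u' : X → ℝ} {x : X} (hu : ContMDiffAt 𝓘(ℝ, E) 𝓘(ℝ) 2 u x)
    (hu' : ContMDiffAt 𝓘(ℝ, E) 𝓘(ℝ) 2 u' x) (v : TangentSpace 𝓘(ℝ, E) x) :
    complexHessian (fun y => u y + u' y) x v = complexHessian u x v + complexHessian u' x v :=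
  leviForm_add (contMDiffAt_iff_contDiffAt_chartAt.1 hu).2
    (contMDiffAt_iff_contDiffAt_chartAt.1 hu').2 _

theorem complexHessian_const_mul {u : X → ℝ} {x : X} (hu : ContMDiffAt 𝓘(ℝ, E) 𝓘(ℝ) 2 u x)
    (k : ℝ) (v : TangentSpace 𝓘(ℝ, E) x) :
    complexHessian (fun y => k * u y) x v = k * complexHessian u x v :=
  leviForm_const_mul (contMDiffAt_iff_contDiffAt_chartAt.1 hu).2 _ _

end ComplexHessian

/-! ### Metrics and complex Hessians in holomorphic charts -/

section ChartMetric

variable {E : Type*} [NormedAddCommGroup E] [NormedSpace ℂ E] {X : Type*} [TopologicalSpace X]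
  [ChartedSpace E X]

/-- A local homeomorphism to the model space which is holomorphic in both directions. -/
structure IsHolomorphicChart (φ : OpenPartialHomeomorph X E) : Prop where
  holomorphic : ∀ x ∈ φ.source, ContMDiffAt 𝓘(ℂ, E) 𝓘(ℂ, E) ω φ x
  holomorphic_symm : ∀ y ∈ φ.target, ContMDiffAt 𝓘(ℂ, E) 𝓘(ℂ, E) ω φ.symm y

theorem isHolomorphicChart_chartAt [IsManifold 𝓘(ℂ, E) ω X] (x : X) :
    IsHolomorphicChart (chartAt E x) :=
  ⟨fun _ hx => (contMDiffOn_chart (I := 𝓘(ℂ, E)) (n := ω)).contMDiffAt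
      ((chartAt E x).open_source.mem_nhds hx),
    fun _ hy => (contMDiffOn_chart_symm (I := 𝓘(ℂ, E)) (n := ω)).contMDiffAt
      ((chartAt E x).open_target.mem_nhds hy)⟩

/-- The derivative of a chart, as an endomorphism of the model space. -/
noncomputable def chartDeriv (φ : X → E) (x : X) : E →L[ℝ] E := mfderiv 𝓘(ℝ, E) 𝓘(ℝ, E) φ x

/-- The derivative of the inverse of a chart, as an endomorphism of the model space. -/
noncomputable def chartDerivSymm (ψ : E → X) (y : E) : E →L[ℝ] E :=
  mfderiv 𝓘(ℝ, E) 𝓘(ℝ, E) ψ y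

variable {φ : OpenPartialHomeomorph X E}

theorem IsHolomorphicChart.mdifferentiableAt (hφ : IsHolomorphicChart φ) {x : X}
    (hx : x ∈ φ.source) : MDifferentiableAt 𝓘(ℝ, E) 𝓘(ℝ, E) φ x :=
  (hφ.holomorphic x hx).complexToReal.mdifferentiableAt (by simp)

theorem IsHolomorphicChart.mdifferentiableAt_symm (hφ : IsHolomorphicChart φ) {y : E}
    (hy : y ∈ φ.target) : MDifferentiableAt 𝓘(ℝ, E) 𝓘(ℝ, E) φ.symm y :=
  (hφ.holomorphic_symm y hy).complexToReal.mdifferentiableAt (by simp)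

theorem IsHolomorphicChart.chartDerivSymm_chartDeriv (hφ : IsHolomorphicChart φ) {x : X}
    (hx : x ∈ φ.source) (v : E) :
    chartDerivSymm φ.symm (φ x) (chartDeriv φ x v) = v := by
  have h1 := mfderiv_comp x (hφ.mdifferentiableAt_symm (φ.map_source hx))
    (hφ.mdifferentiableAt hx)
  have h2 : (φ.symm ∘ φ) =ᶠ[𝓝 x] id := φ.eventually_left_inverse hx
  rw [h2.mfderiv_eq, mfderiv_id] at h1
  exact (DFunLike.congr_fun h1 v).symm

theorem IsHolomorphicChart.chartDeriv_chartDerivSymm (hφ : IsHolomorphicChart φ) {y : E}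
    (hy : y ∈ φ.target) (v : E) :
    chartDeriv φ (φ.symm y) (chartDerivSymm φ.symm y v) = v := by
  have h1 := mfderiv_comp y (hφ.mdifferentiableAt (φ.map_target hy))
    (hφ.mdifferentiableAt_symm hy)
  have h2 : (φ ∘ φ.symm) =ᶠ[𝓝 y] id := φ.eventually_right_inverse hy
  rw [h2.mfderiv_eq, mfderiv_id] at h1
  exact (DFunLike.congr_fun h1 v).symm

variable [IsManifold 𝓘(ℂ, E) ω X] (g : KahlerMetric E X)

/-- The scalar product on a tangent space, as a bilinear form on the model space. -/
noncomputable def metricForm (x : X) : E →L[ℝ] E →L[ℝ] ℝ := g.inner x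

variable {g} in
theorem metricForm_symm (x : X) (u w : E) : metricForm g x u w = metricForm g x w u :=
  g.symm x u w

variable {g} in
theorem metricForm_pos (x : X) {v : E} (hv : v ≠ 0) : 0 < metricForm g x v v :=
  g.pos x v hv

variable {g} in
theorem metricForm_self_nonneg (x : X) (v : E) : 0 ≤ metricForm g x v v := by
  rcases eq_or_ne v 0 with rfl | hv
  · simp
  · exact (metricForm_pos x hv).le

/-- The coordinate expression of a Riemannian metric in a chart. -/
noncomputable def chartInner (φ : OpenPartialHomeomorph X E) (y : E) : E →L[ℝ] E →L[ℝ] ℝ :=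
  (metricForm g (φ.symm y)).bilinearComp (chartDerivSymm φ.symm y) (chartDerivSymm φ.symm y)

theorem chartInner_apply (y u w : E) : chartInner g φ y u w =
    metricForm g (φ.symm y) (chartDerivSymm φ.symm y u) (chartDerivSymm φ.symm y w) := rfl

/-- The coordinate expression of the metric is smooth: apply the metric to the images of constant vector
fields under the tangent map of `φ.symm`. -/
theorem contDiffAt_chartInner [FiniteDimensional ℂ E] (hφ : IsHolomorphicChart φ) {y : E}
    (hy : y ∈ φ.target) : ContDiffAt ℝ ∞ (chartInner g φ) y := by
  have : FiniteDimensional ℝ E := FiniteDimensional.complexToReal E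
  have h0 : ContMDiffOn 𝓘(ℝ, E) 𝓘(ℝ, E) ω φ.symm φ.target := fun z hz =>
    (hφ.holomorphic_symm z hz).complexToReal.contMDiffWithinAt
  have hu : UniqueMDiffOn 𝓘(ℝ, E) φ.target := φ.open_target.uniqueMDiffOn
  have hT := h0.contMDiffOn_tangentMapWithin (m := ∞) (by simp) hu
  have hsec : ∀ u : E, ContMDiffOn 𝓘(ℝ, E) (𝓘(ℝ, E).prod 𝓘(ℝ, E)) ∞
      (fun z => (TotalSpace.mk' E (φ.symm z) (mfderiv 𝓘(ℝ, E) 𝓘(ℝ, E) φ.symm z u) :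
        TangentBundle 𝓘(ℝ, E) X)) φ.target := by
    intro u
    have h1 : ContMDiffOn 𝓘(ℝ, E) (𝓘(ℝ, E).prod 𝓘(ℝ, E)) ∞
        (fun z : E => (TotalSpace.mk' E z u : TangentBundle 𝓘(ℝ, E) E)) φ.target := by
      intro z hz
      rw [contMDiffWithinAt_totalSpace]
      refine ⟨contMDiffWithinAt_id, ?_⟩
      simpa using contMDiffWithinAt_const
    refine (hT.comp h1 fun z hz => hz).congr fun z hz => ?_
    simp only [Function.comp_apply, tangentMapWithin]
    rw [mfderivWithin_of_isOpen φ.open_target hz]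
  have hpt : ∀ u w : E, ContDiffOn ℝ ∞ (fun z => chartInner g φ z u w) φ.target := by
    intro u w
    rw [← contMDiffOn_iff_contDiffOn]
    intro z hz
    have h1 := (g.contMDiff (φ.symm z)).comp_contMDiffWithinAt z ((h0 z hz).of_le le_top)
    have h2 : ContMDiffWithinAt 𝓘(ℝ, E) (𝓘(ℝ, E).prod 𝓘(ℝ)) ∞
      (fun m ↦ TotalSpace.mk' ℝ (E := Bundle.Trivial X ℝ) (φ.symm m)
        (chartInner g φ m u w)) φ.target z :=
      ContMDiffWithinAt.clm_bundle_apply₂ (F₁ := E) (F₂ := E) h1 (hsec u z hz) (hsec w z hz)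
    rw [contMDiffWithinAt_totalSpace] at h2
    exact h2.2
  have h3 : ContDiffOn ℝ ∞ (chartInner g φ) φ.target :=
    contDiffOn_clm_apply.2 fun u => contDiffOn_clm_apply.2 fun w => hpt u w
  exact h3.contDiffAt (φ.open_target.mem_nhds hy)

variable {g}

theorem chartInner_symm (y u w : E) : chartInner g φ y u w = chartInner g φ y w u :=
  metricForm_symm _ _ _

theorem chartInner_chartDeriv (hφ : IsHolomorphicChart φ) {x : X} (hx : x ∈ φ.source) (v : E) :
    chartInner g φ (φ x) (chartDeriv φ x v) (chartDeriv φ x v) = metricForm g x v v := by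
  rw [chartInner_apply, hφ.chartDerivSymm_chartDeriv hx, φ.left_inv hx]

theorem chartInner_pos (hφ : IsHolomorphicChart φ) {y : E} (hy : y ∈ φ.target) {v : E}
    (hv : v ≠ 0) : 0 < chartInner g φ y v v := by
  refine metricForm_pos _ fun h => hv ?_
  replace h : chartDerivSymm φ.symm y v = 0 := h
  have := hφ.chartDeriv_chartDerivSymm hy v
  rw [h, map_zero] at this
  exact this.symm

/-- The metric is locally bounded below by a multiple of the Euclidean one, by compactness of the unit
sphere. -/
theorem exists_le_chartInner [FiniteDimensional ℂ E] (hφ : IsHolomorphicChart φ) {y₀ : E}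
    (hy : y₀ ∈ φ.target) :
    ∃ c > 0, ∀ᶠ y in 𝓝 y₀, ∀ v, c * ‖v‖ ^ 2 ≤ chartInner g φ y v v := by
  have : FiniteDimensional ℝ E := FiniteDimensional.complexToReal E
  obtain ⟨c, hc, hcv⟩ : ∃ c > 0, ∀ v, c * ‖v‖ ^ 2 ≤ chartInner g φ y₀ v v := by
    have : ProperSpace E := FiniteDimensional.proper ℝ E
    have hcont : Continuous fun v => chartInner g φ y₀ v v := by fun_prop
    rcases (Metric.sphere (0 : E) 1).eq_empty_or_nonempty with h | h
    · refine ⟨1, one_pos, fun v => ?_⟩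
      have : v = 0 := by
        by_contra hv
        have : ‖v‖⁻¹ • v ∈ Metric.sphere (0 : E) 1 := by simp [norm_smul, hv]
        rw [h] at this
        exact this
      simp [this]
    · obtain ⟨v₀, hv₀, hmin⟩ := (isCompact_sphere (0 : E) 1).exists_isMinOn h hcont.continuousOn
      have hv0 : v₀ ≠ 0 := by
        rintro rfl
        simp at hv₀
      refine ⟨chartInner g φ y₀ v₀ v₀, chartInner_pos hφ hy hv0, fun v => ?_⟩
      rcases eq_or_ne v 0 with rfl | hv
      · simp
      · have hm : ‖v‖⁻¹ • v ∈ Metric.sphere (0 : E) 1 := by simp [norm_smul, hv]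
        have := isMinOn_iff.1 hmin _ hm
        simp only [map_smul, smul_apply, smul_eq_mul] at this
        have hn : ‖v‖ ≠ 0 := norm_ne_zero_iff.2 hv
        calc _ ≤ ‖v‖⁻¹ * (‖v‖⁻¹ * chartInner g φ y₀ v v) * ‖v‖ ^ 2 := by gcongr
          _ = _ := by field_simp
  refine ⟨c / 2, half_pos hc, ?_⟩
  have h1 := (contDiffAt_chartInner g hφ hy).continuousAt
  filter_upwards [Metric.tendsto_nhds.1 h1 (c / 2) (half_pos hc)] with y h2 v
  rw [dist_eq_norm] at h2
  have h3 : |(chartInner g φ y - chartInner g φ y₀) v v| ≤ c / 2 * ‖v‖ ^ 2 := by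
    refine (ContinuousLinearMap.le_opNorm₂ (chartInner g φ y - chartInner g φ y₀) v v).trans ?_
    rw [mul_assoc, ← pow_two]
    gcongr
  have h4 := (abs_le.1 h3).1
  have h5 := hcv v
  rw [sub_apply, sub_apply] at h4
  linarith

/-- The complex Hessian of `u` on `W` is bounded below near `x₀` by a multiple of the metric. -/
def HessianBoundedBelowAt (g : KahlerMetric E X) (W : Set X) (u : X → ℝ) (x₀ : X) : Prop :=
  ∃ C : ℝ, ∀ᶠ x in 𝓝 x₀, x ∈ W → ∀ v : TangentSpace 𝓘(ℝ, E) x,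
    -C * g.inner x v v ≤ complexHessian u x v

theorem HessianBoundedBelowAt.exists_global [CompactSpace X] {W : Set X} {u : X → ℝ}
    (h : ∀ x, HessianBoundedBelowAt g W u x) :
    ∃ C : ℝ, ∀ x ∈ W, ∀ v : TangentSpace 𝓘(ℝ, E) x,
      -C * g.inner x v v ≤ complexHessian u x v := by
  choose C hC using h
  obtain ⟨t, -, ht⟩ := isCompact_univ.elim_nhds_subcover _ fun x _ => hC x
  refine ⟨∑ i ∈ t, |C i|, fun x hx v => ?_⟩
  obtain ⟨i, hi, hxi⟩ := mem_iUnion₂.1 (ht (mem_univ x))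
  have h1 : C i ≤ ∑ i ∈ t, |C i| := (le_abs_self _).trans
    (Finset.single_le_sum (f := fun i => |C i|) (fun _ _ => abs_nonneg _) hi)
  have h2 := hxi hx v
  have h3 : C i * g.inner x v v ≤ (∑ i ∈ t, |C i|) * g.inner x v v :=
    mul_le_mul_of_nonneg_right h1 (metricForm_self_nonneg (E := E) (g := g) x v)
  linarith

/-- Local lower bounds for the complex Hessian can be checked in a holomorphic chart. -/
theorem hessianBoundedBelowAt_of_chart [FiniteDimensional ℂ E] (hφ : IsHolomorphicChart φ)
    {W : Set X} {u : X → ℝ} {x₀ : X} (hx₀ : x₀ ∈ φ.source) {w : E → ℝ} {C : ℝ}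
    (h : ∀ᶠ x in 𝓝 x₀, x ∈ W → u =ᶠ[𝓝 x] w ∘ φ)
    (hw : ∀ᶠ y in 𝓝 (φ x₀), φ.symm y ∈ W → ContDiffAt ℝ 2 w y ∧
      ∀ v, -C * ‖v‖ ^ 2 ≤ leviForm w y v) : HessianBoundedBelowAt g W u x₀ := by
  obtain ⟨c, hc, hcy⟩ := exists_le_chartInner (g := g) hφ (φ.map_source hx₀)
  have hcont : Filter.Tendsto φ (𝓝 x₀) (𝓝 (φ x₀)) := φ.continuousAt hx₀
  refine ⟨|C| / c, ?_⟩
  filter_upwards [h, hcont.eventually hw, hcont.eventually hcy, φ.open_source.mem_nhds hx₀]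
    with x h1 h2 h3 h4 hx v
  obtain ⟨h5, h6⟩ := h2 (by rwa [φ.left_inv h4])
  rw [complexHessian_eq_leviForm (hφ.holomorphic x h4) (h1 hx) h5]
  refine le_trans ?_ (h6 _)
  have h7 := h3 (chartDeriv φ x v)
  rw [chartInner_chartDeriv hφ h4 v] at h7
  have h8 : |C| * ‖chartDeriv φ x v‖ ^ 2 ≤ |C| / c * metricForm g x v v := by
    rw [div_mul_eq_mul_div, le_div_iff₀ hc]
    nlinarith [abs_nonneg C]
  have h9 : C * ‖chartDeriv φ x v‖ ^ 2 ≤ |C| * ‖chartDeriv φ x v‖ ^ 2 := by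
    gcongr
    exact le_abs_self C
  have h10 : -(|C| / c) * metricForm g x v v ≤ -C * ‖chartDeriv φ x v‖ ^ 2 := by linarith
  exact h10

theorem HessianBoundedBelowAt.mono {W W' : Set X} {u : X → ℝ} {x₀ : X}
    (h : HessianBoundedBelowAt g W u x₀) (hW : W' ⊆ W) : HessianBoundedBelowAt g W' u x₀ := by
  obtain ⟨C, hC⟩ := h
  exact ⟨C, hC.mono fun x h hx => h (hW hx)⟩

theorem HessianBoundedBelowAt.congr {W : Set X} {u u' : X → ℝ} {x₀ : X}
    (h : HessianBoundedBelowAt g W u x₀) (hu : ∀ x ∈ W, u' =ᶠ[𝓝 x] u) :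
    HessianBoundedBelowAt g W u' x₀ := by
  obtain ⟨C, hC⟩ := h
  exact ⟨C, hC.mono fun x h hx v => by rw [complexHessian_congr (hu x hx)]; exact h hx v⟩

theorem HessianBoundedBelowAt.const_mul {W : Set X} {u : X → ℝ} {x₀ : X}
    (h : HessianBoundedBelowAt g W u x₀) (hu : ∀ x ∈ W, ContMDiffAt 𝓘(ℝ, E) 𝓘(ℝ) 2 u x) {k : ℝ}
    (hk : 0 ≤ k) : HessianBoundedBelowAt g W (fun x => k * u x) x₀ := by
  obtain ⟨C, hC⟩ := h
  refine ⟨k * C, hC.mono fun x h hx v => ?_⟩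
  rw [complexHessian_const_mul (hu x hx)]
  have := mul_le_mul_of_nonneg_left (h hx v) hk
  linarith

theorem HessianBoundedBelowAt.add {W : Set X} {u u' : X → ℝ} {x₀ : X}
    (h : HessianBoundedBelowAt g W u x₀) (h' : HessianBoundedBelowAt g W u' x₀)
    (hu : ∀ x ∈ W, ContMDiffAt 𝓘(ℝ, E) 𝓘(ℝ) 2 u x)
    (hu' : ∀ x ∈ W, ContMDiffAt 𝓘(ℝ, E) 𝓘(ℝ) 2 u' x) :
    HessianBoundedBelowAt g W (fun x => u x + u' x) x₀ := by
  obtain ⟨C, hC⟩ := h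
  obtain ⟨C', hC'⟩ := h'
  refine ⟨C + C', ?_⟩
  filter_upwards [hC, hC'] with x h1 h2 hx v
  rw [complexHessian_add (hu x hx) (hu' x hx)]
  linarith [h1 hx v, h2 hx v]

theorem HessianBoundedBelowAt.sum {ι : Type*} (s : Finset ι) {W : Set X} {u : ι → X → ℝ} {x₀ : X}
    (h : ∀ i ∈ s, HessianBoundedBelowAt g W (u i) x₀)
    (hu : ∀ i ∈ s, ∀ x ∈ W, ContMDiffAt 𝓘(ℝ, E) 𝓘(ℝ) 2 (u i) x) :
    HessianBoundedBelowAt g W (fun x => ∑ i ∈ s, u i x) x₀ := by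
  classical
  induction s using Finset.induction_on with
  | empty =>
    refine ⟨0, Filter.Eventually.of_forall fun x _ v => ?_⟩
    have : complexHessian (E := E) (fun _ : X => (0 : ℝ)) x v = 0 := by
      have := complexHessian_const_mul (contMDiffAt_const (c := (0 : ℝ)) (x := x)) 0 v
      simpa using this
    simp [this]
  | insert i s hi ih =>
    simp only [Finset.sum_insert hi]
    refine (h i (Finset.mem_insert_self i s)).add
      (ih (fun j hj => h j (Finset.mem_insert_of_mem hj))
        fun j hj => hu j (Finset.mem_insert_of_mem hj))
      (hu i (Finset.mem_insert_self i s)) fun x hx => ?_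
    exact ContMDiffAt.sum fun j hj => hu j (Finset.mem_insert_of_mem hj) x hx

end ChartMetric

/-! ### Sums of squares of holomorphic functions -/

section AdmissibleWeights

variable {E : Type*} [NormedAddCommGroup E] [NormedSpace ℂ E] {X : Type*} [TopologicalSpace X]
  [ChartedSpace E X]

theorem ContMDiffAt.real_comp {u : X → ℝ} {x : X} {n : ℕ∞ω} {f : ℝ → ℝ}
    (hf : ContDiffAt ℝ n f (u x)) (hu : ContMDiffAt 𝓘(ℝ, E) 𝓘(ℝ) n u x) :
    ContMDiffAt 𝓘(ℝ, E) 𝓘(ℝ) n (fun y => f (u y)) x :=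
  hf.contMDiffAt.comp x hu

theorem contMDiffAt_norm_sq {f : X → ℂ} {x : X} (hf : ContMDiffAt 𝓘(ℂ, E) 𝓘(ℂ) ω f x) :
    ContMDiffAt 𝓘(ℝ, E) 𝓘(ℝ) ω (fun y => ‖f y‖ ^ 2) x :=
  (contDiff_norm_sq ℝ (E := ℂ)).contMDiff.contMDiffAt.comp x hf.complexToReal

theorem sum_norm_sq_eq_zero_iff {ι : Type*} [Fintype ι] {z : ι → ℂ} :
    ∑ j, ‖z j‖ ^ 2 = 0 ↔ ∀ j, z j = 0 := by
  rw [Finset.sum_eq_zero_iff_of_nonneg fun j _ => by positivity]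
  simp

theorem complexHessian_log_sum_nonneg {ι : Type*} [Fintype ι] {f : ι → X → ℂ} {x : X}
    (hf : ∀ j, ContMDiffAt 𝓘(ℂ, E) 𝓘(ℂ) ω (f j) x) (h0 : ∑ j, ‖f j x‖ ^ 2 ≠ 0)
    (v : TangentSpace 𝓘(ℝ, E) x) :
    0 ≤ complexHessian (fun y => Real.log (∑ j, ‖f j y‖ ^ 2)) x v := by
  have h2 : (chartAt E x).symm (chartAt E x x) = x := (chartAt E x).left_inv (mem_chart_source E x)
  refine leviForm_log_sum_nonneg Finset.univ (f := fun j => f j ∘ (chartAt E x).symm) (fun j _ =>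
    (contMDiffAt_iff_contDiffAt_chartAt.1 (hf j)).2.of_le le_top) ?_ _
  simpa [h2] using h0

section

variable [IsManifold 𝓘(ℂ, E) ω X] {g : KahlerMetric E X}

/-- On a compact manifold a weight function is admissible if its logarithm satisfies the conditions
locally. -/
theorem isAdmissibleWeight_of_local [CompactSpace X] {S : Set X} {ξ : X → ℝ} (hc : Continuous ξ)
    (h0 : ∀ x, 0 ≤ ξ x) (hz : ∀ x, ξ x = 0 ↔ x ∈ S)
    (hs : ∀ x ∉ S, ContMDiffAt 𝓘(ℝ, E) 𝓘(ℝ) 2 (fun x => Real.log (ξ x)) x)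
    (hH : ∀ x₀, HessianBoundedBelowAt g Sᶜ (fun x => Real.log (ξ x)) x₀) :
    IsAdmissibleWeight g S ξ := by
  refine ⟨hc.continuousOn, fun x _ => h0 x, fun x _ => hz x, fun t => isClosed_closure.isCompact,
    fun x hx => (hs x hx.2).contMDiffWithinAt, ?_⟩
  obtain ⟨C, hC⟩ := HessianBoundedBelowAt.exists_global hH
  exact ⟨C, fun x hx => hC x hx.2⟩

/-- Positive powers of `∑ |f_j|²` are admissible weight functions for the common zero set of the
holomorphic functions `f_j`. -/
theorem isAdmissibleWeightOn_sum_norm_sq_rpow [CompactSpace X] {U : Set X} (hU : IsOpen U) {N : ℕ}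
    {f : Fin N → X → ℂ} (hf : ∀ j, ContMDiffOn 𝓘(ℂ, E) 𝓘(ℂ) ω (f j) U) {p : ℝ} (hp : 0 < p) :
    IsAdmissibleWeightOn g U {x ∈ U | ∀ j, f j x = 0} (fun x => (∑ j, ‖f j x‖ ^ 2) ^ p) := by
  have hfx : ∀ x ∈ U, ∀ j, ContMDiffAt 𝓘(ℂ, E) 𝓘(ℂ) ω (f j) x := fun x hx j =>
    (hf j).contMDiffAt (hU.mem_nhds hx)
  have hnn : ∀ x, 0 ≤ ∑ j, ‖f j x‖ ^ 2 := fun x => Finset.sum_nonneg fun j _ => by positivity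
  have hsm : ∀ x ∈ U, ContMDiffAt 𝓘(ℝ, E) 𝓘(ℝ) 2 (fun x => ∑ j, ‖f j x‖ ^ 2) x := fun x hx =>
    (ContMDiffAt.sum fun j _ => contMDiffAt_norm_sq (hfx x hx j)).of_le le_top
  have hlog : ∀ x ∈ U \ {x ∈ U | ∀ j, f j x = 0}, ∑ j, ‖f j x‖ ^ 2 ≠ 0 := fun x hx h =>
    hx.2 ⟨hx.1, sum_norm_sq_eq_zero_iff.1 h⟩
  have heq : ∀ x ∈ U \ {x ∈ U | ∀ j, f j x = 0},
      (fun x => Real.log ((∑ j, ‖f j x‖ ^ 2) ^ p)) =ᶠ[𝓝 x]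
        fun x => p * Real.log (∑ j, ‖f j x‖ ^ 2) := fun x hx => by
    filter_upwards [(hsm x hx.1).continuousAt.eventually_ne (hlog x hx)] with y hy
    exact Real.log_rpow (lt_of_le_of_ne (hnn y) hy.symm) p
  have hsl : ∀ x ∈ U \ {x ∈ U | ∀ j, f j x = 0},
      ContMDiffAt 𝓘(ℝ, E) 𝓘(ℝ) 2 (fun x => Real.log (∑ j, ‖f j x‖ ^ 2)) x := fun x hx =>
    ContMDiffAt.real_comp (Real.contDiffAt_log.2 (hlog x hx)) (hsm x hx.1)
  refine ⟨fun x hx => ?_, fun x _ => Real.rpow_nonneg (hnn x) p, fun x hx => ?_,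
    fun t => isClosed_closure.isCompact, fun x hx => ?_, 0, fun x hx v => ?_⟩
  · exact ((hsm x hx).continuousAt.rpow_const (Or.inr hp.le)).continuousWithinAt
  · rw [Real.rpow_eq_zero (hnn x) hp.ne', sum_norm_sq_eq_zero_iff]
    exact ⟨fun h => ⟨hx, h⟩, fun h => h.2⟩
  · exact ((contMDiffAt_const.mul (hsl x hx)).congr_of_eventuallyEq (heq x hx)).contMDiffWithinAt
  · rw [complexHessian_congr (heq x hx), complexHessian_const_mul (hsl x hx), neg_zero, zero_mul]
    exact mul_nonneg hp.le (complexHessian_log_sum_nonneg (hfx x hx.1) (hlog x hx) v)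

end

/-! ### Sections of hermitian line bundles -/

section LineBundle

variable {L : X → Type*} [TopologicalSpace (TotalSpace ℂ L)]
  [∀ x, AddCommGroup (L x)] [∀ x, Module ℂ (L x)] [∀ x, TopologicalSpace (L x)]
  [FiberBundle ℂ L] [VectorBundle ℂ ℂ L] (h : LineBundleHermitianMetric E L)

/-- The squared length of the local frame given by the trivialization at `x₀`. -/
noncomputable def frameLengthSq (x₀ x : X) : ℝ :=
  (h.inner x ((trivializationAt ℂ L x₀).symm x 1) ((trivializationAt ℂ L x₀).symm x 1)).re

theorem frameLengthSq_pos {x₀ x : X} (hx : x ∈ (trivializationAt ℂ L x₀).baseSet) :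
    0 < frameLengthSq h x₀ x := by
  refine h.pos x _ fun h0 => ?_
  have h1 := (trivializationAt ℂ L x₀).continuousLinearMapAt_symmL (R := ℂ) hx 1
  rw [Trivialization.symmL_apply _ hx, h0, map_zero] at h1
  exact zero_ne_one h1

theorem inner_self_eq_frame {x₀ x : X} (hx : x ∈ (trivializationAt ℂ L x₀).baseSet) (v : L x) :
    (h.inner x v v).re =
      ‖((trivializationAt ℂ L x₀) (TotalSpace.mk' ℂ x v)).2‖ ^ 2 * frameLengthSq h x₀ x := by
  set e := trivializationAt ℂ L x₀
  set c := (e (TotalSpace.mk' ℂ x v)).2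
  have h1 : v = c • e.symm x 1 := by
    have h2 : e.symmL ℂ x c = v := by
      rw [Trivialization.symmL_apply _ hx]
      exact e.symm_apply_apply_mk hx v
    rw [← h2, ← Trivialization.symmL_apply (R := ℂ) _ hx, ← map_smul, smul_eq_mul, mul_one]
  have h3 : h.inner x v v = ((‖c‖ ^ 2 : ℝ) : ℂ) * h.inner x (e.symm x 1) (e.symm x 1) := by
    rw [h1, ← Complex.normSq_eq_norm_sq, Complex.normSq_eq_conj_mul_self]
    simp only [map_smulₛₗ, LinearMap.smul_apply, RingHom.id_apply, smul_eq_mul]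
    ring
  rw [h3, Complex.re_ofReal_mul]
  rfl

variable [IsManifold 𝓘(ℂ, E) ω X] [ContMDiffVectorBundle ω ℂ L 𝓘(ℂ, E)] {g : KahlerMetric E X}

/-- Positive powers of the length of a holomorphic section are admissible weight functions. -/
theorem isAdmissibleWeight_length_rpow [FiniteDimensional ℂ E] [CompactSpace X]
    (s : ContMDiffSection 𝓘(ℂ, E) ℂ ω L) {V : Set X} (hV : ∀ x, x ∈ V ↔ s x = 0) {ν : ℝ}
    (hν : 0 < ν) : IsAdmissibleWeight g V (fun x => h.length (s x) ^ ν) := by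
  let e := fun x₀ : X => trivializationAt ℂ L x₀
  let σ : X → X → ℂ := fun x₀ x => ((trivializationAt ℂ L x₀) (TotalSpace.mk' ℂ x (s x))).2
  have hσ : ∀ x₀, ∀ x ∈ (e x₀).baseSet, ContMDiffAt 𝓘(ℂ, E) 𝓘(ℂ) ω (σ x₀) x := fun x₀ x hx =>
    ((e x₀).contMDiffAt_section_iff hx).1 (s.contMDiff x)
  have hH : ∀ x₀, ∀ x ∈ (e x₀).baseSet,
      ContMDiffAt 𝓘(ℝ, E) 𝓘(ℝ) ∞ (frameLengthSq h x₀) x := fun x₀ x hx =>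
    (h.smooth x₀).contMDiffAt ((e x₀).open_baseSet.mem_nhds hx)
  have hlen : ∀ x₀, ∀ x ∈ (e x₀).baseSet,
      h.length (s x) = Real.sqrt (‖σ x₀ x‖ ^ 2 * frameLengthSq h x₀ x) := fun x₀ x hx => by
    rw [LineBundleHermitianMetric.length, inner_self_eq_frame h hx]
  have hσ0 : ∀ x₀, ∀ x ∈ (e x₀).baseSet, σ x₀ x = 0 ↔ x ∈ V := fun x₀ x hx => by
    have h1 := (e x₀).continuousLinearMapAt_apply_of_mem (R := ℂ) hx (s x)
    have h2 := (e x₀).symmL_continuousLinearMapAt (R := ℂ) hx (s x)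
    rw [hV]
    refine ⟨fun h0 => ?_, fun h0 => ?_⟩
    · rw [← h2, h1]
      exact (congrArg _ h0).trans (map_zero _)
    · refine Eq.trans h1.symm ?_
      rw [h0, map_zero]
  have hx₀ : ∀ x₀, x₀ ∈ (e x₀).baseSet := fun x₀ => mem_baseSet_trivializationAt ℂ L x₀
  have hlog : ∀ x₀, ∀ x ∈ (e x₀).baseSet, x ∉ V → Real.log (h.length (s x) ^ ν) =
      ν / 2 * (Real.log (∑ _j : Unit, ‖σ x₀ x‖ ^ 2) + Real.log (frameLengthSq h x₀ x)) := by
    intro x₀ x hx hxV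
    have h1 : σ x₀ x ≠ 0 := fun h0 => hxV ((hσ0 x₀ x hx).1 h0)
    have h2 : 0 < ‖σ x₀ x‖ ^ 2 := by positivity
    have h3 := frameLengthSq_pos h hx
    rw [hlen x₀ x hx, Real.log_rpow (Real.sqrt_pos.2 (mul_pos h2 h3)),
      Real.log_sqrt (mul_pos h2 h3).le, Real.log_mul h2.ne' h3.ne']
    simp
    ring
  have hVe : ∀ x ∉ V, ∀ᶠ y in 𝓝 x, y ∉ V := fun x hxV => by
    have h1 : σ x x ≠ 0 := fun h0 => hxV ((hσ0 x x (hx₀ x)).1 h0)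
    filter_upwards [(hσ x x (hx₀ x)).continuousAt.eventually_ne h1,
      (e x).open_baseSet.mem_nhds (hx₀ x)] with y h2 h3 h4
    exact h2 ((hσ0 x y h3).2 h4)
  have hlen0 : ∀ x, 0 ≤ h.length (s x) := fun x => Real.sqrt_nonneg _
  have hS1 : ∀ x₀, ∀ x ∈ (e x₀).baseSet, x ∉ V → ContMDiffAt 𝓘(ℝ, E) 𝓘(ℝ) 2
      (fun x => Real.log (∑ _j : Unit, ‖σ x₀ x‖ ^ 2)) x := fun x₀ x hx hxV => by
    simp only [Finset.univ_unique, Finset.sum_singleton]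
    have h1 : σ x₀ x ≠ 0 := fun h0 => hxV ((hσ0 x₀ x hx).1 h0)
    exact ContMDiffAt.real_comp (Real.contDiffAt_log.2 (by simpa using h1))
      ((contMDiffAt_norm_sq (hσ x₀ x hx)).of_le le_top)
  have hS2 : ∀ x₀, ∀ x ∈ (e x₀).baseSet, ContMDiffAt 𝓘(ℝ, E) 𝓘(ℝ) 2
      (fun x => Real.log (frameLengthSq h x₀ x)) x := fun x₀ x hx =>
    ContMDiffAt.real_comp (Real.contDiffAt_log.2 (frameLengthSq_pos h hx).ne')
      ((hH x₀ x hx).of_le (by norm_cast))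
  refine isAdmissibleWeight_of_local (continuous_iff_continuousAt.2 fun x => ?_)
    (fun x => Real.rpow_nonneg (hlen0 x) _) (fun x => ?_) (fun x hx => ?_) fun x₀ => ?_
  · have h1 : ContinuousAt (fun y => Real.sqrt (‖σ x y‖ ^ 2 * frameLengthSq h x y)) x :=
      (((hσ x x (hx₀ x)).continuousAt.norm.pow 2).mul (hH x x (hx₀ x)).continuousAt).sqrt
    have h2 : ContinuousAt (fun y => h.length (s y)) x := h1.congr (by
      filter_upwards [(e x).open_baseSet.mem_nhds (hx₀ x)] with y hy using (hlen x y hy).symm)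
    exact h2.rpow_const (Or.inr hν.le)
  · rw [Real.rpow_eq_zero (hlen0 x) hν.ne', hlen x x (hx₀ x), ← hσ0 x x (hx₀ x),
      Real.sqrt_eq_zero (mul_nonneg (by positivity) (frameLengthSq_pos h (hx₀ x)).le)]
    simp [(frameLengthSq_pos h (hx₀ x)).ne']
  · have h1 := (contMDiffAt_const (c := ν / 2)).mul ((hS1 x x (hx₀ x) hx).add (hS2 x x (hx₀ x)))
    refine h1.congr_of_eventuallyEq ?_
    filter_upwards [(e x).open_baseSet.mem_nhds (hx₀ x), hVe x hx] with y h2 h3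
    exact hlog x y h2 h3
  · set φ := chartAt E x₀ with hφdef
    have hφ : IsHolomorphicChart φ := isHolomorphicChart_chartAt x₀
    have hx₀s : x₀ ∈ φ.source := mem_chart_source E x₀
    have hyt : φ x₀ ∈ φ.target := φ.map_source hx₀s
    have hnhds : ∀ x ∈ (e x₀).baseSet ∩ φ.source, x ∉ V →
        (fun x => Real.log (h.length (s x) ^ ν)) =ᶠ[𝓝 x]
        (fun y => ν / 2 * (Real.log (∑ _j : Unit, ‖σ x₀ (φ.symm y)‖ ^ 2) +
          Real.log (frameLengthSq h x₀ (φ.symm y)))) ∘ φ := fun x hx hxV => by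
      filter_upwards [((e x₀).open_baseSet.inter φ.open_source).mem_nhds hx, hVe x hxV]
        with z h1 h2
      rw [Function.comp_apply, φ.left_inv h1.2]
      exact hlog x₀ z h1.1 h2
    have hcomp : ∀ {f : X → ℝ} {y : E}, y ∈ φ.target →
        ContMDiffAt 𝓘(ℝ, E) 𝓘(ℝ) 2 f (φ.symm y) → ContDiffAt ℝ 2 (fun y => f (φ.symm y)) y :=
      fun hy hf => (hf.comp _
        ((hφ.holomorphic_symm _ hy).complexToReal.of_le le_top)).contDiffAt
    have hsx : φ.symm (φ x₀) = x₀ := φ.left_inv hx₀s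
    obtain ⟨C, hC⟩ := exists_abs_leviForm_le (hcomp hyt
      (by rw [hsx]; exact hS2 x₀ x₀ (hx₀ x₀)))
    refine hessianBoundedBelowAt_of_chart hφ hx₀s (C := ν / 2 * C)
      (Filter.eventually_of_mem (((e x₀).open_baseSet.inter φ.open_source).mem_nhds
        ⟨hx₀ x₀, hx₀s⟩) fun x hx hxV => hnhds x hx hxV) ?_
    have hev : ∀ᶠ y in 𝓝 (φ x₀), φ.symm y ∈ (e x₀).baseSet := by
      refine (φ.continuousAt_symm hyt).eventually_mem ?_
      rw [hsx]
      exact (e x₀).open_baseSet.mem_nhds (hx₀ x₀)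
    filter_upwards [hC, hev, φ.open_target.mem_nhds hyt] with y h1 h2 h3 h4
    have c1 := hcomp h3 (hS1 x₀ _ h2 h4)
    have c2 := hcomp h3 (hS2 x₀ _ h2)
    refine ⟨contDiffAt_const.mul (c1.add c2), fun v => ?_⟩
    rw [leviForm_const_mul (c1.add c2), leviForm_add c1 c2]
    have h5 := leviForm_log_sum_nonneg Finset.univ (f := fun _ : Unit => σ x₀ ∘ φ.symm) (y := y)
      (fun j _ => (((hσ x₀ _ h2).comp y (hφ.holomorphic_symm y h3)).contDiffAt.of_le le_top))
      (by simpa using fun h0 => h4 ((hσ0 x₀ _ h2).1 h0)) v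
    have h6 := (abs_le.1 (h1 v)).1
    have h7 := mul_le_mul_of_nonneg_left (add_le_add h5 h6) (half_pos hν).le
    refine le_trans (le_of_eq ?_) h7
    ring

end LineBundle

end AdmissibleWeights

/-! ### Slowly increasing concave functions -/

section SlowFunction

/-- A rapidly increasing sequence attached to a modulus `B`: it at least doubles in each step, and
its next term is at least the image of the present one under `B`. -/
noncomputable def scale (B : ℝ → ℝ) : ℕ → ℝ
  | 0 => 1
  | k + 1 => max (2 * scale B k) (B (scale B k))

variable (B : ℝ → ℝ)

theorem two_mul_scale_le (k : ℕ) : 2 * scale B k ≤ scale B (k + 1) := le_max_left _ _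

theorem le_scale_succ (k : ℕ) : B (scale B k) ≤ scale B (k + 1) := le_max_right _ _

theorem one_le_scale (k : ℕ) : 1 ≤ scale B k := by
  induction k with
  | zero => exact le_rfl
  | succ k ih => linarith [two_mul_scale_le B k]

theorem scale_pos (k : ℕ) : 0 < scale B k := one_pos.trans_le (one_le_scale B k)

theorem pow_mul_scale_le (k n : ℕ) : 2 ^ n * scale B k ≤ scale B (k + n) := by
  induction n with
  | zero => simp
  | succ n ih =>
    have := two_mul_scale_le B (k + n)
    rw [← add_assoc, pow_succ]
    linarith

theorem monotone_scale : Monotone (scale B) := monotone_nat_of_le_succ fun k => by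
  linarith [two_mul_scale_le B k, scale_pos B k]

/-- A concave increasing unbounded function, which grows slowly with respect to the modulus
`B`. -/
noncomputable def slowInf (t : ℝ) : ℝ := ⨅ k : ℕ, (k + t / scale B k)

theorem bddBelow_slowInf (t : ℝ) : BddBelow (range fun k : ℕ => (k + t / scale B k)) := by
  refine ⟨-|t|, ?_⟩
  rintro _ ⟨k, rfl⟩
  have h1 : |t / scale B k| ≤ |t| := by
    rw [abs_div, abs_of_pos (scale_pos B k)]
    exact div_le_self (abs_nonneg t) (one_le_scale B k)
  have h2 := (abs_le.1 h1).1
  have h3 : (0 : ℝ) ≤ k := Nat.cast_nonneg k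
  simp only
  linarith

theorem slowInf_le (t : ℝ) (k : ℕ) : slowInf B t ≤ k + t / scale B k :=
  ciInf_le (bddBelow_slowInf B t) k

theorem monotone_slowInf : Monotone (slowInf B) := fun s t h => le_ciInf fun k => by
  refine (slowInf_le B s k).trans ?_
  have := scale_pos B k
  gcongr

theorem slowInf_add_le (t : ℝ) {r : ℝ} (hr : 0 ≤ r) : slowInf B (t + r) ≤ slowInf B t + r := by
  rw [← sub_le_iff_le_add]
  refine le_ciInf fun k => ?_
  have h1 := slowInf_le B (t + r) k
  have h2 : r / scale B k ≤ r := div_le_self hr (one_le_scale B k)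
  rw [add_div] at h1
  linarith

theorem continuous_slowInf : Continuous (slowInf B) := by
  refine LipschitzWith.continuous (K := 1) (LipschitzWith.of_le_add fun s t => ?_)
  rcases le_total s t with h | h
  · exact (monotone_slowInf B h).trans (le_add_of_nonneg_right dist_nonneg)
  · have := slowInf_add_le B t (sub_nonneg.2 h)
    rw [add_sub_cancel] at this
    rwa [Real.dist_eq, abs_of_nonneg (sub_nonneg.2 h)]

theorem slowInf_midpoint (t : ℝ) :
    slowInf B (t + 2) - 2 * slowInf B (t + 1) + slowInf B t ≤ 0 := by
  have h : (slowInf B (t + 2) + slowInf B t) / 2 ≤ slowInf B (t + 1) := le_ciInf fun k => by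
    have h1 := slowInf_le B (t + 2) k
    have h2 := slowInf_le B t k
    have h3 : (t + 2) / scale B k + t / scale B k = 2 * ((t + 1) / scale B k) := by ring
    linarith
  linarith

theorem tendsto_slowInf : Filter.Tendsto (slowInf B) Filter.atTop Filter.atTop := by
  refine Filter.tendsto_atTop.2 fun b => ?_
  obtain ⟨m, hm⟩ := exists_nat_ge b
  filter_upwards [Filter.eventually_ge_atTop (m * scale B m)] with t ht
  refine hm.trans (le_ciInf fun k => ?_)
  have hm0 : (0 : ℝ) ≤ m := Nat.cast_nonneg m
  have ht0 : 0 ≤ t := (mul_nonneg hm0 (scale_pos B m).le).trans ht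
  rcases le_total m k with h | h
  · have : (m : ℝ) ≤ k := Nat.cast_le.2 h
    have := div_nonneg ht0 (scale_pos B k).le
    linarith
  · have h1 : (m : ℝ) ≤ t / scale B k := by
      rw [le_div_iff₀ (scale_pos B k)]
      exact (mul_le_mul_of_nonneg_left (monotone_scale B h) hm0).trans ht
    have : (0 : ℝ) ≤ k := Nat.cast_nonneg k
    linarith

/-- If `s ≤ B r` for all `r ≥ t` then `s` is at most one step of `scale B` further than `t`. -/
theorem slowInf_le_add_two {s t : ℝ} (ht : 0 ≤ t) (hst : ∀ r, t ≤ r → s ≤ B r) :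
    slowInf B s ≤ slowInf B t + 2 := by
  rw [← sub_le_iff_le_add]
  refine le_ciInf fun k => ?_
  have hup : ∀ m : ℕ, t ≤ scale B m → slowInf B s ≤ m + 2 := fun m hm => by
    have h1 : s ≤ scale B (m + 1) := (hst _ hm).trans (le_scale_succ B m)
    have h2 := slowInf_le B s (m + 1)
    have h3 : s / scale B (m + 1) ≤ 1 := (div_le_one (scale_pos B _)).2 h1
    push_cast at h2
    linarith
  have hex : ∃ n : ℕ, t ≤ scale B (k + n) := by
    obtain ⟨n, hn⟩ := pow_unbounded_of_one_lt t (one_lt_two (α := ℝ))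
    refine ⟨n, hn.le.trans (le_trans ?_ (pow_mul_scale_le B k n))⟩
    exact le_mul_of_one_le_right (by positivity) (one_le_scale B k)
  classical
  have h1 := hup _ (Nat.find_spec hex)
  have htk : 0 ≤ t / scale B k := div_nonneg ht (scale_pos B k).le
  rcases Nat.eq_zero_or_pos (Nat.find hex) with h0 | h0
  · rw [h0, add_zero] at h1
    linarith
  · obtain ⟨n, hn⟩ := Nat.exists_eq_succ_of_ne_zero h0.ne'
    have h2 := Nat.find_min hex (m := n) (by omega)
    rw [hn] at h1
    have h3 : ((n + 1 : ℕ) : ℝ) ≤ t / scale B k := by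
      rw [le_div_iff₀ (scale_pos B k)]
      have h4 : ((n + 1 : ℕ) : ℝ) ≤ 2 ^ n := by exact_mod_cast Nat.lt_two_pow_self
      have := pow_mul_scale_le B k n
      have := mul_le_mul_of_nonneg_right h4 (scale_pos B k).le
      linarith
    push_cast at h1 h3
    linarith

theorem sub_mem_Icc_of_hasDerivAt_monotone {F f : ℝ → ℝ} (hF : ∀ x, HasDerivAt F (f x) x)
    (hf : Monotone f) (a : ℝ) : F (a + 1) - F a ∈ Icc (f a) (f (a + 1)) := by
  obtain ⟨c, hc, h⟩ := exists_hasDerivAt_eq_slope F f (lt_add_one a)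
    (fun x _ => (hF x).continuousAt.continuousWithinAt) fun x _ => hF x
  rw [add_sub_cancel_left, div_one] at h
  rw [← h]
  exact ⟨hf hc.1.le, hf hc.2.le⟩

/-- For every modulus `B` there is a concave increasing unbounded `C²` function `μ` such that
`μ s ≤ μ t + c` as soon as `s` is controlled by `t` via `B`. -/
theorem exists_slow_function : ∃ μ : ℝ → ℝ, ContDiff ℝ 2 μ ∧ (∀ t, 0 ≤ deriv μ t) ∧
    (∀ t, deriv (deriv μ) t ≤ 0) ∧ Filter.Tendsto μ Filter.atTop Filter.atTop ∧
    ∀ R, ∃ c, ∀ s t, -R ≤ t → (∀ r, t ≤ r → s ≤ B r) → μ s ≤ μ t + c := by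
  set f := slowInf B with hf
  have hfc : Continuous f := continuous_slowInf B
  have hfm : Monotone f := monotone_slowInf B
  -- `μ` is the twofold moving average of `f`, and its second derivative is a second difference of `f`
  let P : ℝ → ℝ := fun x => ∫ y in (0 : ℝ)..x, f y
  have hP : ∀ x, HasDerivAt P (f x) x := fun x =>
    intervalIntegral.integral_hasDerivAt_right (hfc.intervalIntegrable _ _)
      hfc.stronglyMeasurable.stronglyMeasurableAtFilter hfc.continuousAt
  have hPc : Continuous P := continuous_iff_continuousAt.2 fun x => (hP x).continuousAt
  let Q : ℝ → ℝ := fun x => ∫ y in (0 : ℝ)..x, P y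
  have hQ : ∀ x, HasDerivAt Q (P x) x := fun x =>
    intervalIntegral.integral_hasDerivAt_right (hPc.intervalIntegrable _ _)
      hPc.stronglyMeasurable.stronglyMeasurableAtFilter hPc.continuousAt
  let μ : ℝ → ℝ := fun t => Q (t + 2) - 2 * Q (t + 1) + Q t
  have h1 : ∀ t, HasDerivAt μ (P (t + 2) - 2 * P (t + 1) + P t) t := fun t =>
    (((hQ (t + 2)).comp_add_const t 2).sub (((hQ (t + 1)).comp_add_const t 1).const_mul 2)).add
      (hQ t)
  have h2 : ∀ t, HasDerivAt (fun t => P (t + 2) - 2 * P (t + 1) + P t)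
      (f (t + 2) - 2 * f (t + 1) + f t) t := fun t =>
    (((hP (t + 2)).comp_add_const t 2).sub (((hP (t + 1)).comp_add_const t 1).const_mul 2)).add
      (hP t)
  have hd1 : deriv μ = fun t => P (t + 2) - 2 * P (t + 1) + P t := funext fun t => (h1 t).deriv
  have hd2 : deriv (deriv μ) = fun t => f (t + 2) - 2 * f (t + 1) + f t := by
    rw [hd1]
    exact funext fun t => (h2 t).deriv
  have hPm := sub_mem_Icc_of_hasDerivAt_monotone hP hfm
  have hd1n : ∀ t, 0 ≤ deriv μ t := fun t => by
    rw [hd1]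
    have e1 := (hPm t).2
    have e2 := (hPm (t + 1)).1
    rw [add_assoc, one_add_one_eq_two] at e2
    simp only
    linarith
  have hR : ∀ x, HasDerivAt (fun x => Q (x + 1) - Q x) (P (x + 1) - P x) x := fun x =>
    ((hQ (x + 1)).comp_add_const x 1).sub (hQ x)
  have hRm : Monotone fun x => P (x + 1) - P x := by
    refine monotone_of_hasDerivAt_nonneg (f' := fun x => f (x + 1) - f x)
      (fun x => ((hP (x + 1)).comp_add_const x 1).sub (hP x)) fun x => ?_
    exact sub_nonneg.2 (hfm (by linarith))
  have hμb : ∀ t, f t ≤ μ t ∧ μ t ≤ f (t + 2) := fun t => by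
    have e := sub_mem_Icc_of_hasDerivAt_monotone hR hRm t
    have e1 := (hPm t).1
    have e2 := (hPm (t + 1)).2
    simp only [add_assoc, one_add_one_eq_two, mem_Icc] at e e2
    simp only [μ]
    constructor <;> linarith
  have hμm : Monotone μ := monotone_of_deriv_nonneg (fun t => (h1 t).differentiableAt) hd1n
  refine ⟨μ, ?_, hd1n, fun t => ?_, ?_, fun R => ⟨max 4 (μ (B 0) - μ (-R)), fun s t ht hst => ?_⟩⟩
  · have : ContDiff ℝ (1 + 1) μ := by
      rw [contDiff_succ_iff_deriv]
      refine ⟨fun t => (h1 t).differentiableAt, by simp, ?_⟩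
      rw [contDiff_one_iff_deriv]
      refine ⟨fun t => by rw [hd1]; exact (h2 t).differentiableAt, ?_⟩
      rw [hd2]
      fun_prop
    simpa [one_add_one_eq_two] using this
  · rw [hd2]
    exact slowInf_midpoint B t
  · exact Filter.tendsto_atTop_mono (fun t => (hμb t).1) (tendsto_slowInf B)
  · rcases le_total 0 t with h0 | h0
    · have e1 := slowInf_le_add_two B h0 hst
      have e2 := slowInf_add_le B s (r := 2) (by norm_num)
      have e3 := (hμb s).2
      have e4 := (hμb t).1
      have e5 := le_max_left 4 (μ (B 0) - μ (-R))
      linarith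
    · have e1 := hμm (hst 0 h0)
      have e2 := hμm ht
      have e5 := le_max_right 4 (μ (B 0) - μ (-R))
      linarith

end SlowFunction

/-! ### Analytic subsets -/

section AnalyticSubset

variable {E : Type*} [NormedAddCommGroup E] [NormedSpace ℂ E] {X : Type*} [TopologicalSpace X]
  [ChartedSpace E X]

theorem IsHolomorphicChart.contDiffAt_comp_symm {φ : OpenPartialHomeomorph X E}
    (hφ : IsHolomorphicChart φ) {f : X → ℝ} {y : E} (hy : y ∈ φ.target) {n : ℕ∞ω}
    (hf : ContMDiffAt 𝓘(ℝ, E) 𝓘(ℝ) n f (φ.symm y)) : ContDiffAt ℝ n (fun y => f (φ.symm y)) y :=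
  (hf.comp _ ((hφ.holomorphic_symm _ hy).complexToReal.of_le le_top)).contDiffAt

/-- The function `exp (-μ (-log s))`, extended by `0` to the origin. -/
noncomputable def expNegLog (μ : ℝ → ℝ) : ℝ → ℝ :=
  Function.update (fun s => Real.exp (-μ (-Real.log s))) 0 0

theorem expNegLog_of_ne {μ : ℝ → ℝ} {s : ℝ} (hs : s ≠ 0) :
    expNegLog μ s = Real.exp (-μ (-Real.log s)) := by
  simp [expNegLog, hs]

theorem expNegLog_zero {μ : ℝ → ℝ} : expNegLog μ 0 = 0 := by
  simp [expNegLog]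

theorem expNegLog_nonneg {μ : ℝ → ℝ} (s : ℝ) : 0 ≤ expNegLog μ s := by
  rcases eq_or_ne s 0 with rfl | hs
  · rw [expNegLog_zero]
  · rw [expNegLog_of_ne hs]
    positivity

theorem continuous_expNegLog {μ : ℝ → ℝ} (hμ : Continuous μ)
    (h : Filter.Tendsto μ Filter.atTop Filter.atTop) : Continuous (expNegLog μ) := by
  refine continuous_iff_continuousAt.2 fun s => ?_
  rcases eq_or_ne s 0 with rfl | hs
  · rw [expNegLog, continuousAt_update_same]
    exact Real.tendsto_exp_atBot.comp (Filter.tendsto_neg_atTop_atBot.comp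
      (h.comp (Filter.tendsto_neg_atBot_atTop.comp Real.tendsto_log_nhdsNE_zero)))
  · rw [expNegLog, continuousAt_update_of_ne hs]
    exact (Real.continuous_exp.comp (hμ.comp continuous_neg).neg).continuousAt.comp
      (Real.continuousAt_log hs)

/-- The error term of a cut-off function in `leviForm_log_sum_sq_mul_exp_ge` is locally bounded. -/
theorem exists_cutoff_bound {θ : E → ℝ} {y₀ : E} (hθ : ContDiffAt ℝ 2 θ y₀) :
    ∃ K, 0 ≤ K ∧ ∀ᶠ y in 𝓝 y₀, ∀ u, 2 * fderiv ℝ θ y u ^ 2 -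
      2 * θ y * fderiv ℝ (fderiv ℝ θ) y u u ≤ K * ‖u‖ ^ 2 := by
  obtain ⟨K, hK⟩ := exists_hasJetBound_line hθ
  refine ⟨4 * K ^ 2, by positivity, ?_⟩
  filter_upwards [hK, hθ.eventually (by simp)] with y h1 h2 u
  obtain ⟨c₀, c₁, c₂, hj, b0, b1, b2⟩ := h1 u
  obtain ⟨e1, e2⟩ := hj.unique (h2.hasJet_line u)
  have e0 : c₀ = θ y := by
    rw [← hj.1]
    simp
  subst e0 e1 e2
  rw [Real.norm_eq_abs] at b0 b1 b2
  have hK0 : 0 ≤ K := (abs_nonneg _).trans b0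
  have d1 : fderiv ℝ θ y u ^ 2 ≤ (K * ‖u‖) ^ 2 := by
    rw [← sq_abs]
    gcongr
  have d2 : |θ y * fderiv ℝ (fderiv ℝ θ) y u u| ≤ K * (K * ‖u‖ ^ 2) := by
    rw [abs_mul]
    gcongr
  have d3 := (abs_le.1 d2).1
  nlinarith

variable [IsManifold 𝓘(ℂ, E) ω X] {g : KahlerMetric E X}

/-- Every analytic subset admits an admissible weight function. Near the set one glues the
functions `exp (-μ (-log ∑ |f_j|²))` formed with local equations, where `μ` increases so slowly that
different choices of local equations lead to comparable functions. -/
theorem exists_isAdmissibleWeight_of_isAnalyticSubset [FiniteDimensional ℂ E] [T2Space X]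
    [CompactSpace X] {S : Set X} (hS : IsAnalyticSubset E S) :
    ∃ ξ : X → ℝ, IsAdmissibleWeight g S ξ := by
  classical
  have : FiniteDimensional ℝ E := FiniteDimensional.complexToReal E
  choose U hUo hxU N f hf hSU using hS
  have hθex : ∀ x : X, ∃ θ : SmoothBumpFunction 𝓘(ℝ, E) x, tsupport θ ⊆ U x := fun x => by
    obtain ⟨θ, -, hθ⟩ := (SmoothBumpFunction.nhds_basis_tsupport (I := 𝓘(ℝ, E)) x).mem_iff.1
      ((hUo x).mem_nhds (hxU x))
    exact ⟨θ, hθ⟩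
  choose θ hθU using hθex
  obtain ⟨t, -, ht⟩ := isCompact_univ.elim_nhds_subcover (fun x => {y | θ x y = 1})
    fun x _ => (θ x).eventuallyEq_one
  have : IsManifold 𝓘(ℝ, E) ∞ X := IsManifold.of_le (n := ω) le_top
  have hθs : ∀ i, ContMDiff 𝓘(ℝ, E) 𝓘(ℝ) ∞ (θ i) := fun i => (θ i).contMDiff
  let φ : X → X → ℝ := fun i x => ∑ j, ‖f i j x‖ ^ 2
  have hφn : ∀ i x, 0 ≤ φ i x := fun i x => Finset.sum_nonneg fun j _ => by positivity
  have hfx : ∀ i, ∀ x ∈ U i, ∀ j, ContMDiffAt 𝓘(ℂ, E) 𝓘(ℂ) ω (f i j) x := fun i x hx j =>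
    (hf i j).contMDiffAt ((hUo i).mem_nhds hx)
  have hφs : ∀ i, ∀ x ∈ U i, ContMDiffAt 𝓘(ℝ, E) 𝓘(ℝ) ω (φ i) x := fun i x hx =>
    ContMDiffAt.sum fun j _ => contMDiffAt_norm_sq (hfx i x hx j)
  have hφ0 : ∀ i, ∀ x ∈ U i, (φ i x = 0 ↔ x ∈ S) := fun i x hx => by
    rw [sum_norm_sq_eq_zero_iff]
    have h1 : x ∈ S ∩ U i ↔ x ∈ {y ∈ U i | ∀ j, f i j y = 0} := by rw [hSU i]
    simpa [hx] using h1.symm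
  have hφc : ∀ i, ContinuousOn (φ i) (tsupport (θ i)) := fun i x hx =>
    (hφs i x (hθU i hx)).continuousAt.continuousWithinAt
  -- comparison of the equations on the overlaps
  have hB : ∀ r : ℝ, ∃ b : ℝ, ∀ i ∈ t, ∀ j ∈ t, ∀ x ∈ tsupport (θ i) ∩ tsupport (θ j), x ∉ S →
      -Real.log (φ i x) ≤ r → -Real.log (φ j x) ≤ b := by
    intro r
    have h1 : ∀ i j, ∃ b : ℝ, ∀ x ∈ tsupport (θ i) ∩ tsupport (θ j), x ∉ S →
        -Real.log (φ i x) ≤ r → -Real.log (φ j x) ≤ b := fun i j => by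
      have hK : IsCompact (tsupport (θ j) ∩ (tsupport (θ i) ∩ φ i ⁻¹' Ici (Real.exp (-r)))) :=
        ((isClosed_tsupport _).inter ((hφc i).preimage_isClosed_of_isClosed (isClosed_tsupport _)
          isClosed_Ici)).isCompact
      obtain ⟨b, hb⟩ := hK.bddAbove_image (f := fun x => -Real.log (φ j x)) fun x hx => by
        have h2 : x ∉ S := fun h => by
          have h3 := (hφ0 i x (hθU i hx.2.1)).2 h
          have h4 : Real.exp (-r) ≤ φ i x := hx.2.2
          rw [h3] at h4
          exact (Real.exp_pos _).not_ge h4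
        have h3 : φ j x ≠ 0 := fun h => h2 ((hφ0 j x (hθU j hx.1)).1 h)
        exact ((Real.continuousAt_log h3).comp
          (hφs j x (hθU j hx.1)).continuousAt).neg.continuousWithinAt
      refine ⟨b, fun x hx hxS hr => hb (mem_image_of_mem _ ⟨hx.2, hx.1, ?_⟩)⟩
      have h3 : φ i x ≠ 0 := fun h => hxS ((hφ0 i x (hθU i hx.1)).1 h)
      have h4 : 0 < φ i x := lt_of_le_of_ne (hφn i x) h3.symm
      exact (Real.le_log_iff_exp_le h4).1 (by linarith)
    choose b hb using h1
    refine ⟨∑ i ∈ t, ∑ j ∈ t, |b i j|, fun i hi j hj x hx hxS hr =>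
      (hb i j x hx hxS hr).trans ((le_abs_self _).trans ?_)⟩
    exact (Finset.single_le_sum (f := fun j => |b i j|) (fun _ _ => abs_nonneg _) hj).trans
      (Finset.single_le_sum (f := fun i => ∑ j ∈ t, |b i j|)
        (fun _ _ => Finset.sum_nonneg fun _ _ => abs_nonneg _) hi)
  choose B hB using hB
  have hR : ∃ R : ℝ, ∀ i ∈ t, ∀ x ∈ tsupport (θ i), -R ≤ -Real.log (φ i x) := by
    have h1 : ∀ i, ∃ R, ∀ x ∈ tsupport (θ i), φ i x ≤ R := fun i => by
      obtain ⟨R, hR⟩ := (isClosed_tsupport (θ i)).isCompact.bddAbove_image (hφc i)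
      exact ⟨R, fun x hx => hR (mem_image_of_mem _ hx)⟩
    choose R hR using h1
    refine ⟨∑ i ∈ t, |R i|, fun i hi x hx => neg_le_neg ?_⟩
    exact (Real.log_le_self (hφn i x)).trans ((hR i x hx).trans ((le_abs_self _).trans
      (Finset.single_le_sum (f := fun i => |R i|) (fun _ _ => abs_nonneg _) hi)))
  obtain ⟨R, hR⟩ := hR
  obtain ⟨μ, hμ, hμ1, hμ2, hμt, hμc⟩ := exists_slow_function B
  obtain ⟨c, hc⟩ := hμc R
  have hcomp : ∀ i ∈ t, ∀ j ∈ t, ∀ x ∈ tsupport (θ i) ∩ tsupport (θ j), x ∉ S →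
      μ (-Real.log (φ j x)) ≤ μ (-Real.log (φ i x)) + c := fun i hi j hj x hx hxS =>
    hc _ _ (hR i hi x hx.1) fun r hr => hB r i hi j hj x hx hxS hr
  -- the convex function `ν s = -μ (-s)`
  let ν : ℝ → ℝ := fun s => -μ (-s)
  have hν : ContDiff ℝ 2 ν := (hμ.comp contDiff_neg).neg
  have hμd : ContDiff ℝ 1 (deriv μ) := hμ.iterate_deriv' 1 1
  have hν1 : deriv ν = fun s => deriv μ (-s) := funext fun s => by
    have h1 : HasDerivAt ν _ s :=
      ((hμ.differentiable (by norm_num) (-s)).hasDerivAt.scomp s (hasDerivAt_neg s)).neg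
    simpa using h1.deriv
  have hν2 : deriv (deriv ν) = fun s => -deriv (deriv μ) (-s) := funext fun s => by
    rw [hν1]
    have h1 : HasDerivAt (fun s => deriv μ (-s)) _ s :=
      (hμd.differentiable one_ne_zero (-s)).hasDerivAt.scomp s (hasDerivAt_neg s)
    simpa using h1.deriv
  have hEc := continuous_expNegLog hμ.continuous hμt
  let ξ : X → ℝ := fun x => ∑ i ∈ t, θ i x ^ 2 * expNegLog μ (φ i x)
  let A : X → Finset X := fun x => t.filter fun i => x ∈ tsupport (θ i)
  have hA : ∀ {x i}, i ∈ A x ↔ i ∈ t ∧ x ∈ tsupport (θ i) := fun {x i} => Finset.mem_filter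
  have hoff : ∀ {x i}, x ∉ tsupport (θ i) → ∀ᶠ y in 𝓝 x, θ i y = 0 := fun hx =>
    notMem_tsupport_iff_eventuallyEq.1 hx
  have hne : ∀ {x i}, x ∉ S → x ∈ tsupport (θ i) → φ i x ≠ 0 := fun hxS hx h =>
    hxS ((hφ0 _ _ (hθU _ hx)).1 h)
  have hone : ∀ x, ∃ j ∈ A x, θ j x = 1 := fun x => by
    obtain ⟨j, hj, hxj⟩ := mem_iUnion₂.1 (ht (mem_univ x))
    have hxj' : θ j x = 1 := hxj
    exact ⟨j, hA.2 ⟨hj, subset_tsupport _ (by simp [hxj'])⟩, hxj'⟩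
  have hterm : ∀ i x, 0 ≤ θ i x ^ 2 * expNegLog μ (φ i x) := fun i x =>
    mul_nonneg (sq_nonneg _) (expNegLog_nonneg _)
  -- near a point outside of `S`
  have hloc : ∀ x ∉ S, ξ =ᶠ[𝓝 x] fun y => ∑ i ∈ A x, θ i y ^ 2 *
      Real.exp (ν (Real.log (φ i y))) := fun x hxS => by
    have h1 : ∀ᶠ y in 𝓝 x, ∀ i ∈ t, θ i y ^ 2 * expNegLog μ (φ i y) =
        if x ∈ tsupport (θ i) then θ i y ^ 2 * Real.exp (ν (Real.log (φ i y))) else 0 := by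
      refine (Finset.eventually_all t).2 fun i _ => ?_
      by_cases hx : x ∈ tsupport (θ i)
      · filter_upwards [(hφs i x (hθU i hx)).continuousAt.eventually_ne (hne hxS hx)] with y hy
        rw [if_pos hx, expNegLog_of_ne hy]
      · filter_upwards [hoff hx] with y hy
        rw [if_neg hx, hy]
        ring
    filter_upwards [h1] with y hy
    simp only [ξ, A]
    rw [Finset.sum_filter]
    exact Finset.sum_congr rfl hy
  have hpos : ∀ x ∉ S, 0 < ξ x := fun x hxS => by
    obtain ⟨j, hj, hj1⟩ := hone x
    refine Finset.sum_pos' (fun i _ => hterm i x) ⟨j, (hA.1 hj).1, ?_⟩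
    rw [hj1, expNegLog_of_ne (hne hxS (hA.1 hj).2)]
    positivity
  have hψs : ∀ {x i}, x ∉ S → x ∈ tsupport (θ i) →
      ContMDiffAt 𝓘(ℝ, E) 𝓘(ℝ) 2 (fun y => Real.log (φ i y)) x := fun {x i} hxS hx =>
    ContMDiffAt.real_comp (Real.contDiffAt_log.2 (hne hxS hx))
      ((hφs i x (hθU i hx)).of_le le_top)
  have hws : ∀ {x i}, x ∉ S → x ∈ tsupport (θ i) →
      ContMDiffAt 𝓘(ℝ, E) 𝓘(ℝ) 2 (fun y => ν (Real.log (φ i y))) x := fun {x i} hxS hx =>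
    ContMDiffAt.real_comp hν.contDiffAt (hψs hxS hx)
  have hθ2 : ∀ i x, ContMDiffAt 𝓘(ℝ, E) 𝓘(ℝ) 2 (θ i) x := fun i x =>
    ((hθs i) x).of_le (by norm_cast)
  have hξs : ∀ x ∉ S, ContMDiffAt 𝓘(ℝ, E) 𝓘(ℝ) 2 (fun y => Real.log (ξ y)) x := fun x hxS => by
    refine ContMDiffAt.real_comp (Real.contDiffAt_log.2 (hpos x hxS).ne')
      (ContMDiffAt.congr_of_eventuallyEq ?_ (hloc x hxS))
    exact ContMDiffAt.sum fun i hi => ((hθ2 i x).pow 2).mul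
      (ContMDiffAt.real_comp Real.contDiff_exp.contDiffAt (hws hxS (hA.1 hi).2))
  refine ⟨ξ, isAdmissibleWeight_of_local (continuous_iff_continuousAt.2 fun x => ?_)
    (fun x => Finset.sum_nonneg fun i _ => hterm i x) (fun x => ⟨fun h => ?_, fun h => ?_⟩) hξs
    fun x₀ => ?_⟩
  · refine tendsto_finsetSum _ fun i _ => ?_
    by_cases hx : x ∈ tsupport (θ i)
    · exact ((hθs i).continuous.continuousAt.pow 2).mul
        (hEc.continuousAt.comp (hφs i x (hθU i hx)).continuousAt)
    · refine (continuousAt_const (y := (0 : ℝ))).congr ?_ |>.tendsto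
      filter_upwards [hoff hx] with y hy
      rw [hy]
      ring
  · by_contra hxS
    exact (hpos x hxS).ne' h
  · refine Finset.sum_eq_zero fun i _ => ?_
    by_cases hx : x ∈ tsupport (θ i)
    · rw [(hφ0 i x (hθU i hx)).2 h, expNegLog_zero, mul_zero]
    · rw [(hoff hx).self_of_nhds]
      ring
  · set χ := chartAt E x₀ with hχdef
    have hχ : IsHolomorphicChart χ := isHolomorphicChart_chartAt x₀
    have hx₀s : x₀ ∈ χ.source := mem_chart_source E x₀
    have hyt : χ x₀ ∈ χ.target := χ.map_source hx₀s
    have hsx : χ.symm (χ x₀) = x₀ := χ.left_inv hx₀s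
    have hKex : ∀ i, ∃ K, 0 ≤ K ∧ ∀ᶠ y in 𝓝 (χ x₀), ∀ u,
        2 * fderiv ℝ (fun y => θ i (χ.symm y)) y u ^ 2 - 2 * θ i (χ.symm y) *
          fderiv ℝ (fderiv ℝ (fun y => θ i (χ.symm y))) y u u ≤ K * ‖u‖ ^ 2 := fun i =>
      exists_cutoff_bound (hχ.contDiffAt_comp_symm hyt (hθ2 i _))
    choose K hK0 hK using hKex
    set K' := ∑ i ∈ t, K i with hK'
    have hK'0 : 0 ≤ K' := Finset.sum_nonneg fun i _ => hK0 i
    set M : ℝ := t.card * Real.exp c with hM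
    refine hessianBoundedBelowAt_of_chart hχ hx₀s (w := fun y => Real.log (ξ (χ.symm y)))
      (C := K' * M / 2) (Filter.eventually_of_mem (χ.open_source.mem_nhds hx₀s) fun x hx _ => ?_) ?_
    · filter_upwards [χ.open_source.mem_nhds hx] with z hz
      rw [Function.comp_apply, χ.left_inv hz]
    · filter_upwards [χ.open_target.mem_nhds hyt, (Finset.eventually_all t).2 fun i _ => hK i]
        with y hy hKy hyS
      refine ⟨hχ.contDiffAt_comp_symm hy (hξs _ hyS), fun v => ?_⟩
      have hcont : Filter.Tendsto χ.symm (𝓝 y) (𝓝 (χ.symm y)) := χ.continuousAt_symm hy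
      have hlog : (fun z => Real.log (ξ (χ.symm z))) =ᶠ[𝓝 y] fun z =>
          Real.log (∑ i ∈ A (χ.symm y), θ i (χ.symm z) ^ 2 *
            Real.exp (ν (Real.log (φ i (χ.symm z))))) := by
        filter_upwards [hcont.eventually (hloc _ hyS)] with z hz
        rw [hz]
      rw [leviForm_congr hlog]
      have hFy := (hloc _ hyS).self_of_nhds
      have hFpos := hpos _ hyS
      rw [hFy] at hFpos
      refine leviForm_log_sum_sq_mul_exp_ge (A (χ.symm y))
        (θ := fun i z => θ i (χ.symm z)) (w := fun i z => ν (Real.log (φ i (χ.symm z))))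
        (fun i hi => hχ.contDiffAt_comp_symm hy (hθ2 i _))
        (fun i hi => hχ.contDiffAt_comp_symm hy (hws hyS (hA.1 hi).2)) (fun i hi => ?_) hFpos
        (fun i hi u => ?_) ?_ hK'0
      · refine leviForm_comp_nonneg hν (fun s => ?_) (fun s => ?_)
          (ψ := fun z => Real.log (φ i (χ.symm z)))
          (hχ.contDiffAt_comp_symm hy (hψs hyS (hA.1 hi).2)) ?_
        · rw [hν1]
          exact hμ1 _
        · rw [hν2]
          exact neg_nonneg.2 (hμ2 _)
        · exact leviForm_log_sum_nonneg Finset.univ (f := fun j => f i j ∘ χ.symm) (fun j _ =>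
            (((hfx i _ (hθU i (hA.1 hi).2) j).comp y (hχ.holomorphic_symm y hy)).contDiffAt.of_le
              le_top)) (hne hyS (hA.1 hi).2) v
      · refine (hKy i (hA.1 hi).1 u).trans ?_
        gcongr
        exact Finset.single_le_sum (fun i _ => hK0 i) (hA.1 hi).1
      · obtain ⟨j, hj, hj1⟩ := hone (χ.symm y)
        have h1 : Real.exp (ν (Real.log (φ j (χ.symm y)))) ≤ ∑ i ∈ A (χ.symm y),
            θ i (χ.symm y) ^ 2 * Real.exp (ν (Real.log (φ i (χ.symm y)))) := by
          have := Finset.single_le_sum (f := fun i => θ i (χ.symm y) ^ 2 *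
            Real.exp (ν (Real.log (φ i (χ.symm y))))) (fun i _ => by positivity) hj
          simpa [hj1] using this
        have h2 : ∀ i ∈ A (χ.symm y), Real.exp (ν (Real.log (φ i (χ.symm y)))) ≤
            Real.exp c * Real.exp (ν (Real.log (φ j (χ.symm y)))) := fun i hi => by
          rw [← Real.exp_add]
          refine Real.exp_le_exp.2 ?_
          have := hcomp i (hA.1 hi).1 j (hA.1 hj).1 _ ⟨(hA.1 hi).2, (hA.1 hj).2⟩ hyS
          simp only [ν]
          linarith
        calc _ ≤ ∑ i ∈ A (χ.symm y), Real.exp c * Real.exp (ν (Real.log (φ j (χ.symm y)))) :=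
              Finset.sum_le_sum h2
          _ = (A (χ.symm y)).card * (Real.exp c * Real.exp (ν (Real.log (φ j (χ.symm y))))) := by
              rw [Finset.sum_const, nsmul_eq_mul]
          _ ≤ t.card * (Real.exp c * ∑ i ∈ A (χ.symm y),
              θ i (χ.symm y) ^ 2 * Real.exp (ν (Real.log (φ i (χ.symm y))))) := by
              have : (A (χ.symm y)).card ≤ t.card := Finset.card_filter_le _ _
              gcongr
          _ = _ := by rw [hM, mul_assoc]

end AnalyticSubset

/-! ### Charts straightening a hypersurface -/

section Straightening

variable {E : Type*} [NormedAddCommGroup E] [NormedSpace ℂ E] {X : Type*} [TopologicalSpace X]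
  [ChartedSpace E X]

/-- A smooth hypersurface is a complex hyperplane in a suitable holomorphic chart, by the inverse
function theorem. -/
theorem exists_isHolomorphicChart_straightening [FiniteDimensional ℂ E] [IsManifold 𝓘(ℂ, E) ω X]
    {V : Set X} (hV : IsSmoothHypersurface E V) {x₀ : X} (hx₀ : x₀ ∈ V) :
    ∃ φ : OpenPartialHomeomorph X E, IsHolomorphicChart φ ∧ x₀ ∈ φ.source ∧ φ x₀ = 0 ∧
      ∃ (ℓ : E →L[ℂ] ℂ) (e : E), ℓ e = 1 ∧ ∀ᶠ x in 𝓝 x₀, x ∈ V ↔ ℓ (φ x) = 0 := by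
  have : CompleteSpace E := FiniteDimensional.complete ℂ E
  obtain ⟨U, hU, hxU, f, hf, hVU, hdf⟩ := hV.2 x₀ hx₀
  set χ := chartAt E x₀ with hχ
  have hχ' := isHolomorphicChart_chartAt (E := E) x₀
  have hxχ : x₀ ∈ χ.source := mem_chart_source E x₀
  have hfx : ContMDiffAt 𝓘(ℂ, E) 𝓘(ℂ) ω f x₀ := hf.contMDiffAt (hU.mem_nhds hxU)
  set F : E → ℂ := f ∘ χ.symm with hF
  set y₀ := χ x₀ with hy₀
  have hFω : ContDiffAt ℂ ω F y₀ := (contMDiffAt_iff_contDiffAt_chartAt.1 hfx).2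
  have hF0 : F y₀ = 0 := by
    have h1 : x₀ ∈ V ∩ U := ⟨hx₀, hxU⟩
    rw [hVU] at h1
    simp only [hF, hy₀, Function.comp_apply, χ.left_inv hxχ]
    exact h1.2
  set ℓ : E →L[ℂ] ℂ := fderiv ℂ F y₀ with hℓ
  have hℓ0 : ℓ ≠ 0 := by
    rw [mfderiv_eq_fderiv_chartAt (hfx.mdifferentiableAt (by simp))] at hdf
    exact hdf
  obtain ⟨e, he⟩ : ∃ e, ℓ e = 1 := by
    obtain ⟨v, hv⟩ : ∃ v, ℓ v ≠ 0 := by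
      by_contra! h
      exact hℓ0 (ContinuousLinearMap.ext h)
    exact ⟨(ℓ v)⁻¹ • v, by simp [hv]⟩
  -- a change of coordinates with `ℓ ∘ Ψ = F` and derivative the identity at `y₀`
  set Ψ : E → E := fun y => (y - y₀) + (F y - ℓ (y - y₀)) • e with hΨ
  have hΨω : ContDiffAt ℂ ω Ψ y₀ := by
    have h1 : ContDiffAt ℂ ω (fun y : E => y - y₀) y₀ := contDiffAt_id.sub contDiffAt_const
    exact h1.add ((hFω.sub (ℓ.contDiff.contDiffAt.comp y₀ h1)).smul contDiffAt_const)
  have hΨd : HasFDerivAt Ψ ((ContinuousLinearEquiv.refl ℂ E : E ≃L[ℂ] E) : E →L[ℂ] E) y₀ := by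
    have h1 : HasFDerivAt (fun y : E => y - y₀) (ContinuousLinearMap.id ℂ E) y₀ :=
      (hasFDerivAt_id y₀).sub_const y₀
    have h2 := h1.add (((hFω.differentiableAt (by simp)).hasFDerivAt.sub
      (ℓ.hasFDerivAt.comp y₀ h1)).smul_const e)
    refine h2.congr_fderiv ?_
    ext v
    simp [hℓ]
  have hℓΨ : ∀ y, ℓ (Ψ y) = F y := fun y => by
    simp [hΨ, he]
  have hΨ0 : Ψ y₀ = 0 := by simp [hΨ, hF0]
  have hω0 : (ω : ℕ∞ω) ≠ 0 := by simp
  set Θ := hΨω.toOpenPartialHomeomorph Ψ hΨd hω0 with hΘ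
  have hΘc : ⇑Θ = Ψ := hΨω.toOpenPartialHomeomorph_coe hΨd hω0
  have hyΘ : y₀ ∈ Θ.source := hΨω.mem_toOpenPartialHomeomorph_source hΨd hω0
  have hsymm : ContDiffAt ℂ ω Θ.symm (Ψ y₀) := hΨω.to_localInverse hΨd hω0
  -- restrict to the points where `Ψ` and its inverse are holomorphic
  set s : Set E := {y | ContDiffAt ℂ ω Ψ y ∧ ContDiffAt ℂ ω Θ.symm (Ψ y)} with hs
  have hsn : s ∈ 𝓝 y₀ := by
    filter_upwards [hΨω.eventually (by simp), hΨω.continuousAt.eventually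
      (hsymm.eventually (by simp))] with y h1 h2 using ⟨h1, h2⟩
  have hsi : ∀ y ∈ (Θ.restr s).source, y ∈ s := fun y hy => by
    rw [Θ.restr_source] at hy
    exact interior_subset hy.2
  refine ⟨χ.trans (Θ.restr s), ⟨fun x hx => ?_, fun y hy => ?_⟩, ?_, ?_, ℓ, e, he, ?_⟩
  · rw [χ.trans_source] at hx
    have h1 := (hsi _ hx.2).1
    have h2 : ContMDiffAt 𝓘(ℂ, E) 𝓘(ℂ, E) ω Ψ (χ x) := h1.contMDiffAt
    have h3 := h2.comp x (hχ'.holomorphic x hx.1)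
    rw [← hΘc] at h3
    exact h3
  · have hy' := hy
    rw [χ.trans_target] at hy
    have h0 := (Θ.restr s).map_target hy.1
    have h1 := (hsi _ h0).2
    rw [← hΘc] at h1
    have h2 : Θ ((Θ.restr s).symm y) = y := (Θ.restr s).right_inv hy.1
    rw [h2] at h1
    exact (hχ'.holomorphic_symm _ hy.2).comp y h1.contMDiffAt
  · rw [χ.trans_source]
    refine ⟨hxχ, ?_⟩
    rw [mem_preimage, Θ.restr_source]
    exact ⟨hyΘ, mem_interior_iff_mem_nhds.2 hsn⟩
  · change Θ (χ x₀) = 0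
    rw [hΘc]
    exact hΨ0
  · filter_upwards [hU.mem_nhds hxU, χ.open_source.mem_nhds hxχ] with x h1 h2
    have h3 : ℓ ((χ.trans (Θ.restr s)) x) = f x := by
      change ℓ (Θ (χ x)) = f x
      rw [hΘc, hℓΨ]
      simp [hF, χ.left_inv h2]
    rw [h3]
    have h4 : x ∈ V ∩ U ↔ x ∈ {y ∈ U | f y = 0} := by rw [hVU]
    simpa [h1] using h4

end Straightening

/-! ### The cometric in a holomorphic chart -/

section Cometric

variable {E : Type*} [NormedAddCommGroup E] [NormedSpace ℂ E] {X : Type*} [TopologicalSpace X]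
  [ChartedSpace E X] {φ : OpenPartialHomeomorph X E} [IsManifold 𝓘(ℂ, E) ω X]

theorem IsHolomorphicChart.chartDerivSymm_I_smul (hφ : IsHolomorphicChart φ) {y : E}
    (hy : y ∈ φ.target) (v : E) :
    chartDerivSymm φ.symm y (Complex.I • v) = Complex.I • chartDerivSymm φ.symm y v := by
  have hd := hφ.holomorphic_symm y hy
  have h1 : ContDiffAt ℂ ω (chartAt E (φ.symm y) ∘ φ.symm) y :=
    (((isHolomorphicChart_chartAt (φ.symm y)).holomorphic _ (mem_chart_source E _)).comp y
      hd).contDiffAt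
  have h2 : ∀ v : E, chartDerivSymm φ.symm y v = fderiv ℂ (chartAt E (φ.symm y) ∘ φ.symm) y v := by
    intro v
    have h3 : chartDerivSymm φ.symm y = fderiv ℝ (chartAt E (φ.symm y) ∘ φ.symm) y := by
      refine ((hφ.mdifferentiableAt_symm hy).mfderiv).trans ?_
      simp only [mfld_simps, writtenInExtChartAt, fderivWithin_univ]
      rfl
    rw [h3, (h1.differentiableAt (by simp)).fderiv_restrictScalars ℝ]
    rfl
  rw [h2, h2, map_smul]

variable {g : KahlerMetric E X}

theorem metricForm_I_smul (x : X) (v w : E) :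
    metricForm g x (Complex.I • v) (Complex.I • w) = metricForm g x v w := g.hermitian x v w

theorem chartInner_I_smul (hφ : IsHolomorphicChart φ) {y : E} (hy : y ∈ φ.target) (v w : E) :
    chartInner g φ y (Complex.I • v) (Complex.I • w) = chartInner g φ y v w := by
  rw [chartInner_apply, hφ.chartDerivSymm_I_smul hy, hφ.chartDerivSymm_I_smul hy,
    metricForm_I_smul, chartInner_apply]

/-- The inverse of the metric in a chart, cut off to a function on the whole model space. -/
theorem exists_chartCometric [FiniteDimensional ℂ E] (hφ : IsHolomorphicChart φ)
    {y₀ : E} (hy₀ : y₀ ∈ φ.target) (n : ℕ) :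
    ∃ S : E → (E →L[ℝ] ℝ) →L[ℝ] E, ContDiff ℝ n S ∧
      ∀ᶠ y in 𝓝 y₀, IsHermitianCometric (S y) ∧ ∀ p v, chartInner g φ y (S y p) v = p v := by
  have : FiniteDimensional ℝ E := FiniteDimensional.complexToReal E
  have : CompleteSpace E := FiniteDimensional.complete ℝ E
  have key : ∀ y ∈ φ.target, ∃ Q : E ≃L[ℝ] (E →L[ℝ] ℝ), (Q : E →L[ℝ] E →L[ℝ] ℝ) =
      chartInner g φ y := by
    intro y hy
    have hinj : Function.Injective (chartInner g φ y : E →ₗ[ℝ] E →L[ℝ] ℝ) := by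
      rw [injective_iff_map_eq_zero]
      intro v hv
      by_contra h
      have h1 := chartInner_pos (g := g) hφ hy h
      have h2 : chartInner g φ y v = 0 := hv
      rw [h2] at h1
      simp at h1
    have hdim : Module.finrank ℝ E = Module.finrank ℝ (E →L[ℝ] ℝ) := by
      rw [← (LinearMap.toContinuousLinearMap : (E →ₗ[ℝ] ℝ) ≃ₗ[ℝ] E →L[ℝ] ℝ).finrank_eq]
      exact (Subspace.dual_finrank_eq (K := ℝ) (V := E)).symm
    refine ⟨(LinearEquiv.ofInjectiveOfFinrankEq _ hinj hdim).toContinuousLinearEquiv, ?_⟩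
    ext v
    rfl
  have hsm : ContDiffAt ℝ (n : ℕ∞ω) (fun y => ContinuousLinearMap.inverse (chartInner g φ y)) y₀ := by
    obtain ⟨Q, hQ⟩ := key y₀ hy₀
    have h1 := contDiffAt_map_inverse (n := (n : ℕ∞ω)) Q
    rw [hQ] at h1
    exact h1.comp y₀ ((contDiffAt_chartInner g hφ hy₀).of_le (by exact_mod_cast le_top))
  obtain ⟨S, hS, hSe⟩ := exists_contDiff_eventuallyEq hsm
  refine ⟨S, hS, ?_⟩
  filter_upwards [hSe, φ.open_target.mem_nhds hy₀] with y h1 hy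
  obtain ⟨Q, hQ⟩ := key y hy
  have h2 : S y = (Q.symm : (E →L[ℝ] ℝ) →L[ℝ] E) := by
    rw [h1, ← hQ, ContinuousLinearMap.inverse_equiv]
  have h3 : ∀ p v, chartInner g φ y (S y p) v = p v := by
    intro p v
    rw [h2, ← hQ]
    simp
  have hext : ∀ a b : E, (∀ v, chartInner g φ y a v = chartInner g φ y b v) → a = b := by
    intro a b h
    apply Q.injective
    ext v
    have := h v
    rw [← hQ] at this
    exact this
  refine ⟨⟨fun p r => ?_, fun p hp => ?_, fun p r hpr => ?_⟩, h3⟩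
  · rw [← h3 p, ← h3 r, chartInner_symm]
  · have h4 : S y p ≠ 0 := by
      intro h0
      apply hp
      ext v
      rw [← h3 p v, h0]
      simp
    rw [← h3 p]
    exact chartInner_pos hφ hy h4
  · refine hext _ _ fun v => ?_
    rw [h3, hpr, ← h3 p, map_neg, neg_apply, ← chartInner_I_smul hφ hy (Complex.I • S y p) v,
      smul_smul, Complex.I_mul_I, neg_one_smul, map_neg, neg_apply, neg_neg]

/-- The Cauchy–Schwarz inequality for the pairing of covectors and vectors. -/
theorem sq_le_mul_chartInner {y : E}
    {A : (E →L[ℝ] ℝ) →L[ℝ] E} (hA : ∀ p v, chartInner g φ y (A p) v = p v) (p : E →L[ℝ] ℝ) (v : E) :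
    p v ^ 2 ≤ p (A p) * chartInner g φ y v v := by
  have hn : ∀ v, 0 ≤ chartInner g φ y v v := fun v => metricForm_self_nonneg _ _
  have h1 : ∀ t : ℝ, 0 ≤ chartInner g φ y v v * (t * t) + 2 * p v * t + p (A p) := by
    intro t
    have h2 := hn (A p + t • v)
    have h3 : chartInner g φ y v (A p) = p v := by rw [chartInner_symm, hA]
    simp only [map_add, map_smul, add_apply, smul_apply, smul_eq_mul, hA, h3] at h2
    linarith
  have h2 := discrim_le_zero h1
  rw [discrim] at h2
  linarith

end Cometric

/-! ### The Riemannian distance -/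

section RiemannianDistance

variable {E : Type*} [NormedAddCommGroup E] [NormedSpace ℂ E] {X : Type*} [TopologicalSpace X]
  [ChartedSpace E X] [IsManifold 𝓘(ℂ, E) ω X] (g : KahlerMetric E X)

/-- The Riemannian distance of two points. The metric is passed explicitly, so that no instance on
the tangent spaces is involved. -/
noncomputable def kahlerEDist (x y : X) : ℝ≥0∞ :=
  letI : RiemannianBundle (fun x : X => TangentSpace 𝓘(ℝ, E) x) :=
    ⟨g.toContMDiffRiemannianMetric.toRiemannianMetric⟩
  Manifold.riemannianEDist 𝓘(ℝ, E) x y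

/-- The velocity at time `t` of a path defined on `[a, b]`, as a vector of the model space. -/
noncomputable def pathVelocity (a b : ℝ) (γ : ℝ → X) (t : ℝ) : E :=
  mfderivWithin 𝓘(ℝ, ℝ) 𝓘(ℝ, E) γ (Icc a b) t (1 : ℝ)

/-- The speed at time `t` of a path defined on `[a, b]`. -/
noncomputable def pathSpeed (a b : ℝ) (γ : ℝ → X) (t : ℝ) : ℝ :=
  √(metricForm g (γ t) (pathVelocity a b γ t) (pathVelocity a b γ t))

theorem distTo_eq_iInf_kahlerEDist (V : Set X) (x : X) :
    g.distTo V x = ⨅ y ∈ V, kahlerEDist g x y := rfl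

theorem enorm_tangentSpace_eq (x : X) (v : TangentSpace 𝓘(ℝ, E) x) :
    letI : RiemannianBundle (fun x : X => TangentSpace 𝓘(ℝ, E) x) :=
      ⟨g.toContMDiffRiemannianMetric.toRiemannianMetric⟩
    ‖v‖ₑ = ENNReal.ofReal √(metricForm g x v v) := by
  let : RiemannianBundle (fun x : X => TangentSpace 𝓘(ℝ, E) x) :=
    ⟨g.toContMDiffRiemannianMetric.toRiemannianMetric⟩
  rw [← ofReal_norm, norm_eq_sqrt_real_inner]
  rfl

theorem pathELength_eq_lintegral_pathSpeed (γ : ℝ → X) (a b : ℝ) :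
    letI : RiemannianBundle (fun x : X => TangentSpace 𝓘(ℝ, E) x) :=
      ⟨g.toContMDiffRiemannianMetric.toRiemannianMetric⟩
    Manifold.pathELength 𝓘(ℝ, E) γ a b = ∫⁻ t in Icc a b, ENNReal.ofReal (pathSpeed g a b γ t) := by
  let : RiemannianBundle (fun x : X => TangentSpace 𝓘(ℝ, E) x) :=
    ⟨g.toContMDiffRiemannianMetric.toRiemannianMetric⟩
  rw [Manifold.pathELength_eq_lintegral_mfderivWithin_Icc]
  refine MeasureTheory.lintegral_congr fun t => ?_
  exact enorm_tangentSpace_eq g _ _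

theorem kahlerEDist_le_lintegral {γ : ℝ → X} {a b : ℝ} (hab : a ≤ b)
    (hγ : ContMDiffOn 𝓘(ℝ, ℝ) 𝓘(ℝ, E) 1 γ (Icc a b)) :
    kahlerEDist g (γ a) (γ b) ≤ ∫⁻ t in Icc a b, ENNReal.ofReal (pathSpeed g a b γ t) := by
  rw [← pathELength_eq_lintegral_pathSpeed]
  let : RiemannianBundle (fun x : X => TangentSpace 𝓘(ℝ, E) x) :=
    ⟨g.toContMDiffRiemannianMetric.toRiemannianMetric⟩
  have : IsManifold 𝓘(ℝ, E) 1 X := IsManifold.of_le (n := ω) le_top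
  exact Manifold.riemannianEDist_le_pathELength hγ rfl rfl hab

/-- Almost minimizing paths do not leave the ball around their starting point. -/
theorem exists_path_of_kahlerEDist_lt {x y : X} {r : ℝ≥0∞} (h : kahlerEDist g x y < r) :
    ∃ γ : ℝ → X, γ 0 = x ∧ γ 1 = y ∧ ContMDiffOn 𝓘(ℝ, ℝ) 𝓘(ℝ, E) 1 γ (Icc 0 1) ∧
      (∫⁻ t in Icc 0 1, ENNReal.ofReal (pathSpeed g 0 1 γ t) < r) ∧
      ∀ t ∈ Icc (0 : ℝ) 1, kahlerEDist g x (γ t) < r := by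
  let : RiemannianBundle (fun x : X => TangentSpace 𝓘(ℝ, E) x) :=
    ⟨g.toContMDiffRiemannianMetric.toRiemannianMetric⟩
  have : IsManifold 𝓘(ℝ, E) 1 X := IsManifold.of_le (n := ω) le_top
  obtain ⟨γ, h0, h1, hγ, hl⟩ := Manifold.exists_lt_of_riemannianEDist_lt h
  refine ⟨γ, h0, h1, hγ, ?_, fun t ht => ?_⟩
  · rw [← pathELength_eq_lintegral_pathSpeed]
    exact hl
  · refine lt_of_le_of_lt ?_ hl
    exact (Manifold.riemannianEDist_le_pathELength (hγ.mono (Icc_subset_Icc le_rfl ht.2)) h0 rfl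
      ht.1).trans (Manifold.pathELength_mono le_rfl ht.2)

theorem kahlerEDist_triangle (x y z : X) :
    kahlerEDist g x z ≤ kahlerEDist g x y + kahlerEDist g y z := by
  let : RiemannianBundle (fun x : X => TangentSpace 𝓘(ℝ, E) x) :=
    ⟨g.toContMDiffRiemannianMetric.toRiemannianMetric⟩
  have : IsManifold 𝓘(ℝ, E) 1 X := IsManifold.of_le (n := ω) le_top
  exact Manifold.riemannianEDist_triangle

theorem kahlerEDist_comm (x y : X) : kahlerEDist g x y = kahlerEDist g y x := by
  let : RiemannianBundle (fun x : X => TangentSpace 𝓘(ℝ, E) x) :=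
    ⟨g.toContMDiffRiemannianMetric.toRiemannianMetric⟩
  have : IsManifold 𝓘(ℝ, E) 1 X := IsManifold.of_le (n := ω) le_top
  exact Manifold.riemannianEDist_comm

theorem kahlerEDist_self (x : X) : kahlerEDist g x x = 0 := by
  let : RiemannianBundle (fun x : X => TangentSpace 𝓘(ℝ, E) x) :=
    ⟨g.toContMDiffRiemannianMetric.toRiemannianMetric⟩
  have : IsManifold 𝓘(ℝ, E) 1 X := IsManifold.of_le (n := ω) le_top
  exact Manifold.riemannianEDist_self

theorem isContinuousRiemannianBundle_kahler :
    letI : RiemannianBundle (fun x : X => TangentSpace 𝓘(ℝ, E) x) :=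
      ⟨g.toContMDiffRiemannianMetric.toRiemannianMetric⟩
    IsContinuousRiemannianBundle E (fun x : X => TangentSpace 𝓘(ℝ, E) x) := by
  let : RiemannianBundle (fun x : X => TangentSpace 𝓘(ℝ, E) x) :=
    ⟨g.toContMDiffRiemannianMetric.toRiemannianMetric⟩
  exact ⟨g.toContMDiffRiemannianMetric.inner,
    g.toContMDiffRiemannianMetric.contMDiff.continuous, fun _ _ _ => rfl⟩

theorem eventually_kahlerEDist_lt (x : X) {c : ℝ≥0∞} (hc : 0 < c) :
    ∀ᶠ y in 𝓝 x, kahlerEDist g x y < c := by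
  let : RiemannianBundle (fun x : X => TangentSpace 𝓘(ℝ, E) x) :=
    ⟨g.toContMDiffRiemannianMetric.toRiemannianMetric⟩
  have : IsManifold 𝓘(ℝ, E) 1 X := IsManifold.of_le (n := ω) le_top
  have := isContinuousRiemannianBundle_kahler g
  exact eventually_riemannianEDist_lt 𝓘(ℝ, E) x hc

theorem exists_kahlerEDist_ball_subset [RegularSpace X] {x : X} {s : Set X} (hs : s ∈ 𝓝 x) :
    ∃ c > 0, {y | kahlerEDist g x y < c} ⊆ s := by
  let : RiemannianBundle (fun x : X => TangentSpace 𝓘(ℝ, E) x) :=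
    ⟨g.toContMDiffRiemannianMetric.toRiemannianMetric⟩
  have : IsManifold 𝓘(ℝ, E) 1 X := IsManifold.of_le (n := ω) le_top
  have := isContinuousRiemannianBundle_kahler g
  exact setOfPred_riemannianEDist_lt_subset_nhds' 𝓘(ℝ, E) hs

end RiemannianDistance

/-! ### The distance to a hypersurface in a chart -/

section DistanceInChart

variable {E : Type*} [NormedAddCommGroup E] [NormedSpace ℂ E] {X : Type*} [TopologicalSpace X]
  [ChartedSpace E X] [IsManifold 𝓘(ℂ, E) ω X] {g : KahlerMetric E X}
  {φ : OpenPartialHomeomorph X E}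

theorem pathSpeed_eq_chartInner (hφ : IsHolomorphicChart φ) {γ : ℝ → X} {a b t : ℝ} (hab : a < b)
    (hγ : ContMDiffOn 𝓘(ℝ, ℝ) 𝓘(ℝ, E) 1 γ (Icc a b)) (ht : t ∈ Icc a b) (hs : γ t ∈ φ.source) :
    pathSpeed g a b γ t = √(chartInner g φ (φ (γ t)) (derivWithin (φ ∘ γ) (Icc a b) t)
      (derivWithin (φ ∘ γ) (Icc a b) t)) := by
  have h1 : mfderivWithin 𝓘(ℝ, ℝ) 𝓘(ℝ, E) (φ ∘ γ) (Icc a b) t =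
      (mfderiv 𝓘(ℝ, E) 𝓘(ℝ, E) φ (γ t)).comp
        (mfderivWithin 𝓘(ℝ, ℝ) 𝓘(ℝ, E) γ (Icc a b) t) := by
    apply mfderiv_comp_mfderivWithin
    · exact hφ.mdifferentiableAt hs
    · exact hγ.mdifferentiableOn one_ne_zero _ ht
    · rw [uniqueMDiffWithinAt_iff_uniqueDiffWithinAt]
      exact uniqueDiffOn_Icc hab _ ht
  have h2 : derivWithin (φ ∘ γ) (Icc a b) t =
      chartDeriv φ (γ t) (pathVelocity a b γ t) := by
    rw [← fderivWithin_derivWithin, ← mfderivWithin_eq_fderivWithin, h1]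
    rfl
  rw [h2, chartInner_chartDeriv hφ hs, pathSpeed]

/-- The distance of the end points of a curve of constant speed. -/
theorem kahlerEDist_symm_le_ofReal (hφ : IsHolomorphicChart φ) {c : ℝ → E} (hc : ContDiff ℝ 1 c)
    (hct : ∀ t ∈ Icc (0 : ℝ) 1, c t ∈ φ.target) {k : ℝ}
    (hk : ∀ t ∈ Icc (0 : ℝ) 1, chartInner g φ (c t) (deriv c t) (deriv c t) = k) :
    kahlerEDist g (φ.symm (c 0)) (φ.symm (c 1)) ≤ ENNReal.ofReal √k := by
  have hγ : ContMDiffOn 𝓘(ℝ, ℝ) 𝓘(ℝ, E) 1 (φ.symm ∘ c) (Icc 0 1) := fun t ht =>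
    (((hφ.holomorphic_symm _ (hct t ht)).complexToReal.of_le le_top).comp t
      hc.contMDiff.contMDiffAt).contMDiffWithinAt
  refine (kahlerEDist_le_lintegral g zero_le_one hγ).trans ?_
  have h1 : ∀ t ∈ Icc (0 : ℝ) 1, ENNReal.ofReal (pathSpeed g 0 1 (φ.symm ∘ c) t) =
      ENNReal.ofReal √k := by
    intro t ht
    have h2 : EqOn (φ ∘ φ.symm ∘ c) c (Icc 0 1) := fun s hs => φ.right_inv (hct s hs)
    rw [pathSpeed_eq_chartInner hφ one_pos hγ ht (φ.map_target (hct t ht)),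
      derivWithin_congr h2 (h2 ht),
      (hc.differentiable one_ne_zero t).derivWithin (uniqueDiffOn_Icc one_pos t ht)]
    have h3 : φ ((φ.symm ∘ c) t) = c t := h2 ht
    rw [h3, hk t ht]
  rw [MeasureTheory.setLIntegral_congr_fun measurableSet_Icc h1]
  simp

/-- The eikonal equation says that `√q` has a gradient of length `1`, so it is bounded by the length of
any path to its zero set. -/
theorem ofReal_sqrt_le_lintegral_pathSpeed (hφ : IsHolomorphicChart φ) {γ : ℝ → X}
    (hγ : ContMDiffOn 𝓘(ℝ, ℝ) 𝓘(ℝ, E) 1 γ (Icc 0 1)) {q : E → ℝ}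
    {S : E → (E →L[ℝ] ℝ) →L[ℝ] E}
    (hs : ∀ t ∈ Icc (0 : ℝ) 1, γ t ∈ φ.source)
    (hS : ∀ t ∈ Icc (0 : ℝ) 1, ∀ p v, chartInner g φ (φ (γ t)) (S (φ (γ t)) p) v = p v)
    (hq : ∀ t ∈ Icc (0 : ℝ) 1, ContDiffAt ℝ 1 q (φ (γ t)))
    (hq0 : ∀ t ∈ Icc (0 : ℝ) 1, 0 ≤ q (φ (γ t)))
    (he : ∀ t ∈ Icc (0 : ℝ) 1,
      fderiv ℝ q (φ (γ t)) (S (φ (γ t)) (fderiv ℝ q (φ (γ t)))) = 4 * q (φ (γ t)))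
    (h1 : q (φ (γ 1)) = 0) :
    ENNReal.ofReal √(q (φ (γ 0))) ≤ ∫⁻ t in Icc 0 1, ENNReal.ofReal (pathSpeed g 0 1 γ t) := by
  have hσ : ContDiffOn ℝ 1 (φ ∘ γ) (Icc 0 1) := by
    rw [← contMDiffOn_iff_contDiffOn]
    intro t ht
    exact ((hφ.holomorphic _ (hs t ht)).complexToReal.of_le le_top).comp_contMDiffWithinAt t
      (hγ t ht)
  -- `√q` is not differentiable at its zeros, so it is replaced by `√(q + ε²)`
  refine ENNReal.le_of_forall_pos_le_add fun ε hε _ => ?_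
  have hε' : (0 : ℝ) < ε := hε
  have hpos : ∀ t ∈ Icc (0 : ℝ) 1, 0 < q (φ (γ t)) + (ε : ℝ) ^ 2 := fun t ht => by
    have := hq0 t ht
    positivity
  set h : ℝ → ℝ := fun t => √(q ((φ ∘ γ) t) + (ε : ℝ) ^ 2) with hh
  have hh1 : ContDiffOn ℝ 1 h (Icc 0 1) := by
    intro t ht
    have h2 : ContDiffWithinAt ℝ 1 (fun t => q ((φ ∘ γ) t) + (ε : ℝ) ^ 2) (Icc 0 1) t :=
      ((hq t ht).comp_contDiffWithinAt t (hσ t ht)).add contDiffWithinAt_const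
    exact h2.sqrt (hpos t ht).ne'
  have hd : ∀ t ∈ Icc (0 : ℝ) 1, ‖derivWithin h (Icc 0 1) t‖ₑ ≤
      ENNReal.ofReal (pathSpeed g 0 1 γ t) := by
    intro t ht
    have hu := uniqueDiffOn_Icc (zero_lt_one (α := ℝ)) t ht
    have h2 := (hσ.differentiableOn one_ne_zero t ht).hasDerivWithinAt
    have h3 := (((hq t ht).differentiableAt one_ne_zero).hasFDerivAt.comp_hasDerivWithinAt t
      h2).add_const ((ε : ℝ) ^ 2)
    have h4 := (h3.sqrt (hpos t ht).ne').derivWithin hu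
    have h5 : derivWithin h (Icc 0 1) t = _ := h4
    rw [h5, pathSpeed_eq_chartInner hφ one_pos hγ ht (hs t ht), ← ofReal_norm]
    apply ENNReal.ofReal_le_ofReal
    have h6 := sq_le_mul_chartInner (hS t ht) (fderiv ℝ q (φ (γ t)))
      (derivWithin (φ ∘ γ) (Icc 0 1) t)
    rw [he t ht] at h6
    have hn : 0 ≤ chartInner g φ (φ (γ t)) (derivWithin (φ ∘ γ) (Icc 0 1) t)
      (derivWithin (φ ∘ γ) (Icc 0 1) t) := metricForm_self_nonneg _ _
    simp only [Function.comp_apply]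
    rw [Real.norm_eq_abs, abs_div, abs_of_pos (show (0 : ℝ) < 2 * √(q (φ (γ t)) + (ε : ℝ) ^ 2) by
      have := Real.sqrt_pos.2 (hpos t ht)
      positivity), div_le_iff₀ (by
      have := Real.sqrt_pos.2 (hpos t ht)
      positivity)]
    refine abs_le_of_sq_le_sq (h6.trans ?_) (by positivity)
    rw [mul_pow, mul_pow, Real.sq_sqrt hn, Real.sq_sqrt (hpos t ht).le]
    nlinarith [sq_nonneg (ε : ℝ)]
  have hle := enorm_sub_le_lintegral_derivWithin_Icc_of_contDiffOn_Icc hh1 zero_le_one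
  have hle2 := hle.trans (MeasureTheory.setLIntegral_mono' measurableSet_Icc hd)
  have h7 : h 1 = ε := by
    simp [hh, h1]
  have h8 : √(q (φ (γ 0))) ≤ h 0 := Real.sqrt_le_sqrt (by
    simp only [Function.comp_apply]
    nlinarith)
  have h9 : √(q (φ (γ 0))) ≤ ‖h 1 - h 0‖ + ε := by
    rw [h7, Real.norm_eq_abs]
    linarith [neg_abs_le ((ε : ℝ) - h 0)]
  calc ENNReal.ofReal √(q (φ (γ 0))) ≤ ENNReal.ofReal (‖h 1 - h 0‖ + ε) :=
        ENNReal.ofReal_le_ofReal h9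
    _ = ‖h 1 - h 0‖ₑ + ε := by
        rw [ENNReal.ofReal_add (norm_nonneg _) hε'.le, ofReal_norm, ENNReal.ofReal_coe_nnreal]
    _ ≤ _ := by gcongr

/-- In a suitable holomorphic chart the distance to a smooth hypersurface is `√q`, where `q` has the
form required by `exists_leviForm_log_ge`. -/
theorem exists_distTo_eq_sqrt [FiniteDimensional ℂ E] [RegularSpace X] {V : Set X}
    (hV : IsSmoothHypersurface E V) {x₀ : X} (hx₀ : x₀ ∈ V) :
    ∃ φ : OpenPartialHomeomorph X E, IsHolomorphicChart φ ∧ x₀ ∈ φ.source ∧ φ x₀ = 0 ∧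
      ∃ (ℓ : E →L[ℂ] ℂ) (e : E), ℓ e = 1 ∧ (∀ᶠ x in 𝓝 x₀, x ∈ V ↔ ℓ (φ x) = 0) ∧
      ∃ (q b : E → ℝ) (c : E → ℂ), ContDiffAt ℝ 2 b 0 ∧ ContDiffAt ℝ 2 c 0 ∧ 0 < b 0 ∧
        (∀ᶠ y in 𝓝 (0 : E), q y = ‖ℓ y‖ ^ 2 * b y + (ℓ y ^ 4 * c y).re) ∧
        (∀ᶠ y in 𝓝 (0 : E), 0 ≤ q y) ∧
        ∀ᶠ x in 𝓝 x₀, g.distTo V x = ENNReal.ofReal √(q (φ x)) := by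
  obtain ⟨φ, hφ, hx, h0, ℓ, e, he, hℓ⟩ := exists_isHolomorphicChart_straightening hV hx₀
  have h0t : (0 : E) ∈ φ.target := h0 ▸ φ.map_source hx
  have hsymm0 : φ.symm 0 = x₀ := by rw [← h0, φ.left_inv hx]
  obtain ⟨S, hS, hSy⟩ := exists_chartCometric (g := g) hφ h0t 7
  obtain ⟨q, hq6, heik, hqV, ⟨k, hk, hqk⟩, hcurve⟩ :=
    exists_eikonal_solution hS (hSy.mono fun _ h => h.1) he
  obtain ⟨b, c, hb, hc, hb0, hqbc⟩ := eikonal_normalForm he (hS.of_le (by norm_num))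
    (hSy.mono fun _ h => h.1) hq6 heik hqV ⟨k, hk, hqk⟩
  have hqn : ∀ᶠ y in 𝓝 (0 : E), 0 ≤ q y := hqk.mono fun y h => le_trans (by positivity) h
  refine ⟨φ, hφ, hx, h0, ℓ, e, he, hℓ, q, b, c, hb, hc, hb0, hqbc, hqn, ?_⟩
  have hφt : Filter.Tendsto φ (𝓝 x₀) (𝓝 0) := h0 ▸ φ.continuousAt hx
  have hφst : Filter.Tendsto φ.symm (𝓝 0) (𝓝 x₀) := by
    have := φ.continuousAt_symm h0t
    rwa [ContinuousAt, hsymm0] at this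
  have hq00 : q 0 = 0 := hqV.self_of_nhds (map_zero ℓ)
  -- the upper bound, by the length of an explicit curve
  have hupper : ∀ᶠ x in 𝓝 x₀, g.distTo V x ≤ ENNReal.ofReal √(q (φ x)) := by
    have hU : {y | y ∈ φ.target ∧ (φ.symm y ∈ V ↔ ℓ (φ (φ.symm y)) = 0) ∧
        ∀ p v, chartInner g φ y (S y p) v = p v} ∈ 𝓝 (0 : E) := by
      filter_upwards [φ.open_target.mem_nhds h0t, hφst.eventually hℓ, hSy] with y h1 h2 h3
      exact ⟨h1, h2, h3.2⟩
    filter_upwards [hφt.eventually (hcurve _ hU), φ.open_source.mem_nhds hx] with x h1 h2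
    obtain ⟨γ, hγ, hγU, hγ0, hγ1, hγd⟩ := h1
    have h3 : φ.symm (γ 0) ∈ V := by
      obtain ⟨h4, h5, -⟩ := hγU 0 (by simp)
      rw [h5, φ.right_inv h4, hγ0]
    have h6 := kahlerEDist_symm_le_ofReal (g := g) hφ hγ (fun t ht => (hγU t ht).1)
      (k := q (φ x)) fun t ht => by
        obtain ⟨p, hp, hpq⟩ := hγd t ht
        rw [hp, (hγU t ht).2.2, hpq]
    rw [hγ1, φ.left_inv h2, kahlerEDist_comm] at h6
    exact (iInf₂_le _ h3).trans h6
  -- the lower bound, by integrating along an almost minimizing path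
  have hlower : ∀ᶠ x in 𝓝 x₀, ENNReal.ofReal √(q (φ x)) ≤ g.distTo V x := by
    have hW : ∀ᶠ x in 𝓝 x₀, x ∈ φ.source ∧ (x ∈ V ↔ ℓ (φ x) = 0) ∧
        (∀ p v, chartInner g φ (φ x) (S (φ x) p) v = p v) ∧ ContDiffAt ℝ 1 q (φ x) ∧
        0 ≤ q (φ x) ∧ fderiv ℝ q (φ x) (S (φ x) (fderiv ℝ q (φ x))) = 4 * q (φ x) ∧
        (ℓ (φ x) = 0 → q (φ x) = 0) := by
      filter_upwards [φ.open_source.mem_nhds hx, hℓ, hφt.eventually hSy,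
        hφt.eventually ((hq6.of_le (m := 1) (by norm_num)).eventually (by simp)),
        hφt.eventually hqn, hφt.eventually heik, hφt.eventually hqV]
        with x h1 h2 h3 h4 h5 h6 h7 using ⟨h1, h2, h3.2, h4, h5, h6, h7⟩
    obtain ⟨δ, hδ, hball⟩ := exists_kahlerEDist_ball_subset g hW
    have hδ2 : 0 < δ / 2 := ENNReal.half_pos hδ.ne'
    have hsmall : ∀ᶠ x in 𝓝 x₀, ENNReal.ofReal √(q (φ x)) < δ / 2 := by
      have h1 : Filter.Tendsto (fun x => ENNReal.ofReal √(q (φ x))) (𝓝 x₀) (𝓝 0) := by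
        have h2 : Filter.Tendsto q (𝓝 0) (𝓝 0) := by
          have := hq6.continuousAt
          rwa [ContinuousAt, hq00] at this
        have h3 : Filter.Tendsto (fun x => √(q (φ x))) (𝓝 x₀) (𝓝 0) := by
          simpa using (h2.comp hφt).sqrt
        simpa using ENNReal.tendsto_ofReal h3
      exact h1.eventually_lt_const hδ2
    filter_upwards [hsmall, eventually_kahlerEDist_lt g x₀ hδ2] with x h1 h2
    rw [distTo_eq_iInf_kahlerEDist]
    refine le_iInf₂ fun z hz => le_of_forall_gt_imp_ge_of_dense fun r hr => ?_
    rcases le_or_gt (δ / 2) r with h3 | h3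
    · exact h1.le.trans h3
    obtain ⟨γ, hγ0, hγ1, hγ, hγl, hγd⟩ := exists_path_of_kahlerEDist_lt g hr
    have h4 : ∀ t ∈ Icc (0 : ℝ) 1, _ := fun t ht => hball (show kahlerEDist g x₀ (γ t) < δ from
      calc kahlerEDist g x₀ (γ t) ≤ kahlerEDist g x₀ x + kahlerEDist g x (γ t) :=
            kahlerEDist_triangle g _ _ _
        _ < δ / 2 + δ / 2 := ENNReal.add_lt_add h2 ((hγd t ht).trans h3)
        _ = δ := ENNReal.add_halves δ)
    obtain ⟨-, h5, -, -, -, -, h6⟩ := h4 1 (by simp)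
    have h7 := ofReal_sqrt_le_lintegral_pathSpeed hφ hγ (fun t ht => (h4 t ht).1)
      (fun t ht => (h4 t ht).2.2.1) (fun t ht => (h4 t ht).2.2.2.1)
      (fun t ht => (h4 t ht).2.2.2.2.1) (fun t ht => (h4 t ht).2.2.2.2.2.1)
      (h6 (h5.1 (hγ1 ▸ hz)))
    rw [hγ0] at h7
    exact h7.trans hγl.le
  filter_upwards [hupper, hlower] with x h1 h2 using le_antisymm h1 h2

end DistanceInChart

/-! ### Distance weights -/

section DistanceWeights

variable {E : Type*} [NormedAddCommGroup E] [NormedSpace ℂ E] {X : Type*} [TopologicalSpace X]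
  [ChartedSpace E X] [IsManifold 𝓘(ℂ, E) ω X] {g : KahlerMetric E X} {V : Set X} {ρ : X → ℝ}

theorem IsDistanceWeight.nonneg (h : IsDistanceWeight g V ρ) (x : X) : 0 ≤ ρ x := by
  by_cases hx : x ∈ V
  · obtain ⟨U, -, hVU, hU⟩ := h.eq_dist
    exact (hU x (hVU hx)).1
  · exact (h.pos x hx).le

theorem IsDistanceWeight.eq_zero_iff (h : IsDistanceWeight g V ρ) (x : X) : ρ x = 0 ↔ x ∈ V := by
  refine ⟨fun h0 => ?_, fun hx => ?_⟩
  · by_contra hx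
    exact (h.pos x hx).ne' h0
  · obtain ⟨U, -, hVU, hU⟩ := h.eq_dist
    obtain ⟨h1, h2⟩ := hU x (hVU hx)
    have h3 : g.distTo V x = 0 :=
      le_antisymm ((iInf₂_le x hx).trans_eq (kahlerEDist_self g x)) zero_le
    rw [h3, ENNReal.ofReal_eq_zero] at h2
    exact le_antisymm h2 h1

theorem IsDistanceWeight.contMDiffAt (h : IsDistanceWeight g V ρ) (hV : IsClosed V) {x : X}
    (hx : x ∉ V) : ContMDiffAt 𝓘(ℝ, E) 𝓘(ℝ) ∞ ρ x :=
  h.smooth.contMDiffAt (hV.isOpen_compl.mem_nhds hx)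

theorem IsDistanceWeight.contMDiffAt_log (h : IsDistanceWeight g V ρ) (hV : IsClosed V) {x : X}
    (hx : x ∉ V) : ContMDiffAt 𝓘(ℝ, E) 𝓘(ℝ) 2 (fun x => Real.log (ρ x)) x :=
  ContMDiffAt.real_comp (Real.contDiffAt_log.2 (h.pos x hx).ne')
    ((h.contMDiffAt hV hx).of_le (WithTop.coe_le_coe.2 (le_top : (2 : ℕ∞) ≤ ⊤)))

/-- Functions of class `C²` have locally bounded complex Hessians. -/
theorem hessianBoundedBelowAt_of_contMDiffAt [FiniteDimensional ℂ E] {u : X → ℝ} {x₀ : X}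
    (hu : ContMDiffAt 𝓘(ℝ, E) 𝓘(ℝ) 2 u x₀) (W : Set X) : HessianBoundedBelowAt g W u x₀ := by
  have hx : x₀ ∈ (chartAt E x₀).source := mem_chart_source E x₀
  have h1 := (contMDiffAt_iff_contDiffAt_chartAt.1 hu).2
  obtain ⟨C, hC⟩ := exists_abs_leviForm_le h1
  refine hessianBoundedBelowAt_of_chart (isHolomorphicChart_chartAt x₀) hx
    (w := u ∘ (chartAt E x₀).symm) (C := C) ?_ ?_
  · filter_upwards [(chartAt E x₀).open_source.mem_nhds hx] with x h2 _
    filter_upwards [(chartAt E x₀).open_source.mem_nhds h2] with y h3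
    simp only [Function.comp_apply, (chartAt E x₀).left_inv h3]
  · filter_upwards [h1.eventually (by simp), hC] with y h2 h3 _
    refine ⟨h2, fun v => ?_⟩
    have := (abs_le.1 (h3 v)).1
    linarith

theorem IsDistanceWeight.exists_eq_sqrt [FiniteDimensional ℂ E] [RegularSpace X]
    (h : IsDistanceWeight g V ρ) (hV : IsSmoothHypersurface E V) {x₀ : X} (hx₀ : x₀ ∈ V) :
    ∃ φ : OpenPartialHomeomorph X E, IsHolomorphicChart φ ∧ x₀ ∈ φ.source ∧ φ x₀ = 0 ∧
      ∃ (ℓ : E →L[ℂ] ℂ) (q b : E → ℝ) (c : E → ℂ), (∀ᶠ x in 𝓝 x₀, x ∈ V ↔ ℓ (φ x) = 0) ∧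
        ContDiffAt ℝ 2 b 0 ∧ ContDiffAt ℝ 2 c 0 ∧ 0 < b 0 ∧
        (∀ᶠ y in 𝓝 (0 : E), q y = ‖ℓ y‖ ^ 2 * b y + (ℓ y ^ 4 * c y).re) ∧
        ∀ᶠ x in 𝓝 x₀, 0 ≤ q (φ x) ∧ ρ x = √(q (φ x)) := by
  obtain ⟨φ, hφ, hx, h0, ℓ, -, -, hℓ, q, b, c, hb, hc, hb0, hq, hqn, hd⟩ :=
    exists_distTo_eq_sqrt (g := g) hV hx₀
  obtain ⟨U, hUo, hVU, hU⟩ := h.eq_dist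
  have hφt : Filter.Tendsto φ (𝓝 x₀) (𝓝 0) := h0 ▸ φ.continuousAt hx
  refine ⟨φ, hφ, hx, h0, ℓ, q, b, c, hℓ, hb, hc, hb0, hq, ?_⟩
  filter_upwards [hd, hUo.mem_nhds (hVU hx₀), hφt.eventually hqn] with x h1 h2 h3
  obtain ⟨h4, h5⟩ := hU x h2
  exact ⟨h3, (ENNReal.ofReal_eq_ofReal_iff h4 (Real.sqrt_nonneg _)).1 (h5.trans h1)⟩

theorem IsDistanceWeight.continuous [FiniteDimensional ℂ E] [RegularSpace X]
    (h : IsDistanceWeight g V ρ) (hV : IsSmoothHypersurface E V) : Continuous ρ := by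
  rw [continuous_iff_continuousAt]
  intro x₀
  by_cases hx₀ : x₀ ∈ V
  · obtain ⟨φ, -, hx, h0, ℓ, q, b, c, -, hb, hc, -, hq, hρ⟩ := h.exists_eq_sqrt hV hx₀
    have hqc : ContinuousAt q 0 := by
      refine ContinuousAt.congr ?_ (hq.mono fun _ h => h.symm)
      have h1 := hb.continuousAt
      have h2 := hc.continuousAt
      have h3 : ContinuousAt ℓ 0 := ℓ.continuous.continuousAt
      exact ((h3.norm.pow 2).mul h1).add
        (Complex.continuous_re.continuousAt.comp ((h3.pow 4).mul h2))
    have h1 : ContinuousAt (fun x => √(q (φ x))) x₀ := by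
      rw [← h0] at hqc
      exact (ContinuousAt.comp (f := φ) hqc (φ.continuousAt hx)).sqrt
    exact h1.congr (hρ.mono fun _ h => h.2.symm)
  · exact (h.contMDiffAt hV.1 hx₀).continuousAt

theorem IsDistanceWeight.hessianBoundedBelowAt_log [FiniteDimensional ℂ E] [RegularSpace X]
    (h : IsDistanceWeight g V ρ) (hV : IsSmoothHypersurface E V) (x₀ : X) :
    HessianBoundedBelowAt g Vᶜ (fun x => Real.log (ρ x)) x₀ := by
  by_cases hx₀ : x₀ ∈ V
  · obtain ⟨φ, hφ, hx, h0, ℓ, q, b, c, hℓ, hb, hc, hb0, hq, hρ⟩ := h.exists_eq_sqrt hV hx₀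
    obtain ⟨C, hC⟩ := exists_leviForm_log_ge hb hc hb0 hq
    have h0t : (0 : E) ∈ φ.target := h0 ▸ φ.map_source hx
    have hφst : Filter.Tendsto φ.symm (𝓝 0) (𝓝 x₀) := by
      have := φ.continuousAt_symm h0t
      rwa [ContinuousAt, ← h0, φ.left_inv hx, h0] at this
    refine hessianBoundedBelowAt_of_chart hφ hx (w := fun y => 1 / 2 * Real.log (q y))
      (C := 1 / 2 * C) ?_ ?_
    · filter_upwards [hρ.eventually_nhds] with x h1 _
      filter_upwards [h1] with y h2
      rw [h2.2, Real.log_sqrt h2.1, Function.comp_apply]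
      ring
    · rw [h0]
      filter_upwards [hC, hφst.eventually hℓ, φ.open_target.mem_nhds h0t] with y h1 h2 h3 h4
      rw [φ.right_inv h3] at h2
      obtain ⟨-, h5, h6⟩ := h1 fun h => h4 (h2.2 h)
      refine ⟨contDiffAt_const.mul h5, fun v => ?_⟩
      rw [leviForm_const_mul h5]
      linarith [h6 v]
  · exact hessianBoundedBelowAt_of_contMDiffAt (h.contMDiffAt_log hV.1 hx₀) _

/-- Products of positive powers of distance weights are admissible weight functions. -/
theorem isAdmissibleWeight_prod_rpow [FiniteDimensional ℂ E] [T2Space X] [CompactSpace X]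
    {ι : Type*} [Fintype ι] {V : ι → Set X} {ρ : ι → X → ℝ} {ν : ι → ℝ}
    (hV : ∀ j, IsSmoothHypersurface E (V j)) (hρ : ∀ j, IsDistanceWeight g (V j) (ρ j))
    (hν : ∀ j, 0 < ν j) : IsAdmissibleWeight g (⋃ j, V j) (fun x => ∏ j, ρ j x ^ ν j) := by
  have hnot : ∀ {x}, x ∉ ⋃ j, V j → ∀ j, x ∉ V j := fun hx j hj => hx (mem_iUnion.2 ⟨j, hj⟩)
  have hcl : IsClosed (⋃ j, V j) := isClosed_iUnion_of_finite fun j => (hV j).1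
  have hlog : ∀ x ∉ ⋃ j, V j, Real.log (∏ j, ρ j x ^ ν j) = ∑ j, ν j * Real.log (ρ j x) := by
    intro x hx
    have hpos : ∀ j, 0 < ρ j x := fun j => (hρ j).pos x (hnot hx j)
    rw [Real.log_prod fun j _ => (Real.rpow_pos_of_pos (hpos j) _).ne']
    exact Finset.sum_congr rfl fun j _ => Real.log_rpow (hpos j) _
  have hev : ∀ x ∈ (⋃ j, V j)ᶜ, (fun x => Real.log (∏ j, ρ j x ^ ν j)) =ᶠ[𝓝 x]
      fun x => ∑ j, ν j * Real.log (ρ j x) := fun x hx => by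
    filter_upwards [hcl.isOpen_compl.mem_nhds hx] with y hy using hlog y hy
  have hsm : ∀ j, ∀ x ∉ V j, ContMDiffAt 𝓘(ℝ, E) 𝓘(ℝ) 2 (fun x => ν j * Real.log (ρ j x)) x :=
    fun j x hx => contMDiffAt_const.mul ((hρ j).contMDiffAt_log (hV j).1 hx)
  refine isAdmissibleWeight_of_local ?_ ?_ ?_ ?_ ?_
  · exact continuous_finsetProd _ fun j _ =>
      ((hρ j).continuous (hV j)).rpow_const fun _ => Or.inr (hν j).le
  · exact fun x => Finset.prod_nonneg fun j _ => Real.rpow_nonneg ((hρ j).nonneg x) _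
  · intro x
    simp only [Finset.prod_eq_zero_iff, Finset.mem_univ, true_and, mem_iUnion,
      Real.rpow_eq_zero ((hρ _).nonneg x) (hν _).ne', (hρ _).eq_zero_iff]
  · exact fun x hx => (ContMDiffAt.sum fun j _ => hsm j x (hnot hx j)).congr_of_eventuallyEq
      (hev x hx)
  · intro x₀
    refine HessianBoundedBelowAt.congr (HessianBoundedBelowAt.sum Finset.univ (fun j _ => ?_)
      fun j _ x hx => hsm j x (hnot hx j)) hev
    exact (((hρ j).hessianBoundedBelowAt_log (hV j) x₀).const_mul
      (fun x hx => (hρ j).contMDiffAt_log (hV j).1 hx) (hν j).le).mono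
      (compl_subset_compl.2 (subset_iUnion V j))

end DistanceWeights

theorem lemma3p3 {E : Type*} [NormedAddCommGroup E] [NormedSpace ℂ E] [FiniteDimensional ℂ E]
    {X : Type*} [TopologicalSpace X] [T2Space X] [CompactSpace X]
    [ChartedSpace E X] [IsManifold 𝓘(ℂ, E) ω X] (g : KahlerMetric E X) :
    -- positive powers of the distance to a smooth complex hypersurface
    (∀ (V : Set X) (ρ : X → ℝ), IsSmoothHypersurface E V → IsDistanceWeight g V ρ →
      ∀ ν : ℝ, 0 < ν → IsAdmissibleWeight g V (fun x => ρ x ^ ν)) ∧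
    -- products of such functions for several hypersurfaces
    (∀ (m : ℕ) (V : Fin m → Set X) (ρ : Fin m → X → ℝ) (ν : Fin m → ℝ),
      (∀ j, IsSmoothHypersurface E (V j)) → (∀ j, IsDistanceWeight g (V j) (ρ j)) →
      (∀ j, 0 < ν j) →
      IsAdmissibleWeight g (⋃ j, V j) (fun x => ∏ j, ρ j x ^ ν j)) ∧
    -- positive powers of the length of a holomorphic section of a hermitian line bundle
    (∀ (L : X → Type*) [TopologicalSpace (TotalSpace ℂ L)]
      [∀ x, AddCommGroup (L x)] [∀ x, Module ℂ (L x)] [∀ x, TopologicalSpace (L x)]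
      [FiberBundle ℂ L] [VectorBundle ℂ ℂ L] [ContMDiffVectorBundle ω ℂ L 𝓘(ℂ, E)]
      (h : LineBundleHermitianMetric E L) (s : ContMDiffSection 𝓘(ℂ, E) ℂ ω L)
      (V : Set X), (∀ x, x ∈ V ↔ s x = 0) →
      ∀ ν : ℝ, 0 < ν → IsAdmissibleWeight g V (fun x => h.length (s x) ^ ν)) ∧
    -- every analytic subset admits an admissible weight function
    (∀ S : Set X, IsAnalyticSubset E S → ∃ ξ : X → ℝ, IsAdmissibleWeight g S ξ) ∧
    -- positive powers of `∑ |f_j|²` for holomorphic functions on an open set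
    (∀ (U : Set X), IsOpen U → ∀ (N : ℕ) (f : Fin N → X → ℂ),
      (∀ j, ContMDiffOn 𝓘(ℂ, E) 𝓘(ℂ) ω (f j) U) →
      ∀ p : ℝ, 0 < p →
      IsAdmissibleWeightOn g U {x ∈ U | ∀ j, f j x = 0}
        (fun x => (∑ j, ‖f j x‖ ^ 2) ^ p)) := by
  refine ⟨fun V ρ hV hρ ν hν => ?_, fun m V ρ ν hV hρ hν => isAdmissibleWeight_prod_rpow hV hρ hν,
    ?_, fun S hS => exists_isAdmissibleWeight_of_isAnalyticSubset hS, fun U hU N f hf p hp =>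
      isAdmissibleWeightOn_sum_norm_sq_rpow hU hf hp⟩
  · have h := isAdmissibleWeight_prod_rpow (g := g) (ι := Unit) (V := fun _ => V) (ρ := fun _ => ρ)
      (ν := fun _ => ν) (fun _ => hV) (fun _ => hρ) (fun _ => hν)
    simpa [iUnion_const] using h
  · intro L _ _ _ _ _ _ _ h s V hV ν hν
    exact isAdmissibleWeight_length_rpow h s hV hν
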